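/- Let $n\ge 2$, $Q:=(-1,1)^n$, and let $0<\alpha<\infty$, $1<q<\infty$ satisfy $q>1+\alpha$. Let $s\in[0,1]$, $\Lambda\ge 1$, $\mu\ge 1$, and let $L\colon\mathbb{R}^n\to\mathbb{R}$ be of class $C^1(\mathbb{R}^n)\cap C^2(\mathbb{R}^n\setminus\{0\})$ with $$\frac1\Lambda |z|g(|z|)\le L(z)\le \Lambda|z|g(|z|)+\Lambda,\qquad \frac{|\xi|^2}{\Lambda(1+|z|^2)^{\mu/2}}\le\langle\partial^2L(z)\xi,\xi\rangle,\qquad |\partial^2L(z)|\le\frac{\Lambda(g(|z|)+1)}{(1+|z|^2)^{1/2}}$$ for all $z\in\mathbb{R}^n\setminus\{0\}$ and $\xi\in\mathbb{R}^n$. Here either $g\equiv 1$ on $[0,\infty)$, or $g\colon[0,\infty)\to\mathbb{R}$ is continuous, nondecreasing, unbounded and concave, $t\mapsto t\,g(t)$ is convex, and for every $\delta>0$ there is a constant $c$ with $g(t)\le c(1+t^\delta)$ for all $t\ge 0$. For a function $a\colon\bar Q\to[0,\infty)$ put $$\mathcal{H}(w;Q):=\int_Q L(Dw)+a(x)\,(s^2+|Dw|^2)^{q/2}\,dx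 .$$ Then for every $\varepsilon\in(0,q-1-\alpha)$ there exist a coefficient $0\le a\in C^{\alpha}(\bar Q)$ and a function $\tilde u_0\in C^\infty(\bar Q)$ such that the Dirichlet problem $$\min_{w\in\tilde u_0+W^{1,1}_0(Q)}\mathcal{H}(w;Q)$$ has a solution $u\in\tilde u_0+W^{1,1}_0(Q)$, of finite energy, with $u\notin W^{1,p}_{\mathrm{loc}}(Q)$ for every $p\in(1+\varepsilon,\infty]$. Moreover, the set of non-Lebesgue points of $u$, i.e. of those $x\in Q$ for which there is no $c\in\mathbb{R}$ with $\lim_{r\to0^+}\frac{1}{|B_r(x)|}\int_{B_r(x)}|u-c|\,dy=0$, has Hausdorff dimension at least $n-1-\varepsilon$. Here $a\in C^\alpha(\bar Q)$ means, with $k=\lfloor\alpha\rfloor$, that $a$ is of class $C^k$ up to the boundary of $Q$ and that its derivatives of order $k$ are Hölder continuous on $\bar Q$ with exponent $\alpha-k$ (no further condition if $\alpha$ is an integer). -/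

import Mathlib

open MeasureTheory Filter Set Topology
open scoped ENNReal NNReal ContDiff

noncomputable section

namespace DoublePhase

/-- `ℝⁿ` with the Euclidean norm. -/
abbrev E (n : ℕ) : Type := EuclideanSpace ℝ (Fin n)

/-- The open cube `Q = (-1,1)ⁿ`. -/
def cube (n : ℕ) : Set (E n) := {x | ∀ i, x i ∈ Ioo (-1 : ℝ) 1}

/-- The closed cube `[-1,1]ⁿ`, the closure of `Q`. -/
def closedCube (n : ℕ) : Set (E n) := {x | ∀ i, x i ∈ Icc (-1 : ℝ) 1}

section Sobolev

variable {n : ℕ}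

/-- `φ ∈ C_c^∞(Ω)`. -/
def IsTestFunction (Ω : Set (E n)) (φ : E n → ℝ) : Prop :=
  ContDiff ℝ ∞ φ ∧ HasCompactSupport φ ∧ tsupport φ ⊆ Ω

/-- `G` is the weak (distributional) gradient of `u` in `Ω`. -/
def HasWeakGradient (Ω : Set (E n)) (u : E n → ℝ) (G : E n → E n) : Prop :=
  LocallyIntegrableOn u Ω ∧ LocallyIntegrableOn G Ω ∧
    ∀ φ : E n → ℝ, IsTestFunction Ω φ → ∀ v : E n,
      ∫ x in Ω, u x * fderiv ℝ φ x v = -∫ x in Ω, φ x * inner ℝ (G x) v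

open Classical in
/-- The weak gradient `Du` of `u` in `Ω` (determined up to null sets), and `0` if `u` has none. -/
def weakGradient (Ω : Set (E n)) (u : E n → ℝ) : E n → E n :=
  if h : ∃ G : E n → E n, HasWeakGradient Ω u G then h.choose else 0

theorem weakGradient_spec {Ω : Set (E n)} {u : E n → ℝ} {G : E n → E n}
    (h : HasWeakGradient Ω u G) : HasWeakGradient Ω u (weakGradient Ω u) := by
  have h' : ∃ G : E n → E n, HasWeakGradient Ω u G := ⟨G, h⟩
  unfold weakGradient
  rw [dif_pos h']
  exact h'.choose_spec

/-- `u ∈ W^{1,p}(Ω)`. -/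
def MemW1p (p : ℝ≥0∞) (Ω : Set (E n)) (u : E n → ℝ) : Prop :=
  MemLp u p (volume.restrict Ω) ∧
    ∃ G : E n → E n, HasWeakGradient Ω u G ∧ MemLp G p (volume.restrict Ω)

/-- `u ∈ W^{1,p}_loc(Ω)`: `u ∈ W^{1,p}(Ω')` for every open `Ω' ⋐ Ω`. -/
def MemW1pLoc (p : ℝ≥0∞) (Ω : Set (E n)) (u : E n → ℝ) : Prop :=
  ∀ Ω' : Set (E n), IsOpen Ω' → IsCompact (closure Ω') → closure Ω' ⊆ Ω → MemW1p p Ω' u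

/-- `u ∈ W^{1,1}_0(Ω)`, the closure of `C_c^∞(Ω)` in `W^{1,1}(Ω)`. -/
def MemW011 (Ω : Set (E n)) (u : E n → ℝ) : Prop :=
  MemLp u 1 (volume.restrict Ω) ∧
    ∃ G : E n → E n, HasWeakGradient Ω u G ∧ MemLp G 1 (volume.restrict Ω) ∧
      ∃ φ : ℕ → E n → ℝ, (∀ k, IsTestFunction Ω (φ k)) ∧
        Tendsto (fun k => eLpNorm (fun x => u x - φ k x) 1 (volume.restrict Ω)) atTop (𝓝 0) ∧
        Tendsto (fun k => eLpNorm (fun x => G x - gradient (φ k) x) 1 (volume.restrict Ω))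
          atTop (𝓝 0)

/-- `f ∈ C^α(K)` for a closed convex set `K` with interior points: with `k = ⌊α⌋`, `f` is of class
`C^k` up to the boundary and its `k`-th derivative is Hölder continuous with exponent `α - k`
on `K`. -/
def MemHolderClass (α : ℝ) (K : Set (E n)) (f : E n → ℝ) : Prop :=
  ContDiffOn ℝ (⌊α⌋₊ : ℕ) f K ∧
    ∃ C : ℝ≥0, HolderOnWith C (Real.toNNReal (α - ⌊α⌋₊)) (iteratedFDerivWithin ℝ ⌊α⌋₊ f K) K

/-- `x` is a Lebesgue point of `u`: some `c` is the limit of `u` at `x` in the mean. This does not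
depend on the representative of `u`. -/
def IsLebesguePoint (u : E n → ℝ) (x : E n) : Prop :=
  ∃ c : ℝ, Tendsto (fun r : ℝ => ⨍ y in Metric.ball x r, |u y - c|) (𝓝[>] 0) (𝓝 0)

end Sobolev

/-- The nearly linear growth conditions on `g : [0,∞) → ℝ`. -/
structure IsNearlyLinear (g : ℝ → ℝ) : Prop where
  continuousOn : ContinuousOn g (Ici 0)
  convexOn_mul : ConvexOn ℝ (Ici 0) fun t => t * g t
  monotoneOn : MonotoneOn g (Ici 0)
  unbounded : ¬ BddAbove (g '' Ici 0)
  concaveOn : ConcaveOn ℝ (Ici 0) g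
  growth : ∀ δ : ℝ, 0 < δ → ∃ c : ℝ, ∀ t : ℝ, 0 ≤ t → g t ≤ c * (1 + t ^ δ)

/-- The regularity, growth and `μ`-ellipticity conditions on the integrand `L`, with constant `Λ`
and growth governed by `g`. -/
structure IsAdmissibleIntegrand {n : ℕ} (Λ μ : ℝ) (g : ℝ → ℝ) (L : E n → ℝ) : Prop where
  contDiff_one : ContDiff ℝ 1 L
  contDiffOn_two : ContDiffOn ℝ 2 L {0}ᶜ
  lower_growth : ∀ z : E n, z ≠ 0 → 1 / Λ * (‖z‖ * g ‖z‖) ≤ L z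
  upper_growth : ∀ z : E n, z ≠ 0 → L z ≤ Λ * (‖z‖ * g ‖z‖) + Λ
  lower_ellipticity : ∀ z : E n, z ≠ 0 → ∀ ξ : E n,
    ‖ξ‖ ^ 2 / (Λ * (1 + ‖z‖ ^ 2) ^ (μ / 2)) ≤ fderiv ℝ (fderiv ℝ L) z ξ ξ
  upper_ellipticity : ∀ z : E n, z ≠ 0 →
    ‖fderiv ℝ (fderiv ℝ L) z‖ ≤ Λ * (g ‖z‖ + 1) / (1 + ‖z‖ ^ 2) ^ (1 / 2 : ℝ)

section Energy

variable {n : ℕ}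

/-- The integrand `H(x,z) = L(z) + a(x) (s² + |z|²)^{q/2}`. -/
def integrand (L : E n → ℝ) (a : E n → ℝ) (s q : ℝ) (x z : E n) : ℝ :=
  L z + a x * (s ^ 2 + ‖z‖ ^ 2) ^ (q / 2)

open Classical in
/-- The energy `H(w;Ω) = ∫_Ω L(Dw) + a(x) (s² + |Dw|²)^{q/2} dx ∈ (-∞,∞]`. The integrands
considered are measurable and bounded below, and `Ω` is bounded, so that the integral is `+∞`
precisely when `H(·,Dw)` is not integrable. -/
def energy (L : E n → ℝ) (a : E n → ℝ) (s q : ℝ) (Ω : Set (E n)) (w : E n → ℝ) : EReal :=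
  if IntegrableOn (fun x => integrand L a s q x (weakGradient Ω w x)) Ω then
    ((∫ x in Ω, integrand L a s q x (weakGradient Ω w x) : ℝ) : EReal)
  else ⊤

/-- `w ∈ u₀ + W^{1,1}_0(Ω)`. -/
def InDirichletClass (Ω : Set (E n)) (u₀ w : E n → ℝ) : Prop :=
  MemW011 Ω fun x => w x - u₀ x

/-- `u` minimizes `H(·;Ω)` in the Dirichlet class `u₀ + W^{1,1}_0(Ω)`, with finite energy. -/
def IsDirichletMinimizer (L : E n → ℝ) (a : E n → ℝ) (s q : ℝ) (Ω : Set (E n))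
    (u₀ u : E n → ℝ) : Prop :=
  InDirichletClass Ω u₀ u ∧ energy L a s q Ω u ≠ ⊤ ∧
    ∀ w : E n → ℝ, InDirichletClass Ω u₀ w → energy L a s q Ω u ≤ energy L a s q Ω w

end Energy

end DoublePhase

end

open MeasureTheory Filter Set Topology
open scoped ENNReal NNReal ContDiff

noncomputable section

namespace DoublePhase

/-! ### Weak gradients and `L¹` limits of smooth pairs -/

section SobolevPairs

variable {n : ℕ} {Ω : Set (E n)}

/-! Write `n = m + 1` and split a point into a height `t` and a horizontal part in `ℝᵐ`. Fix `0 < e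
< ε` and let `𝒞 ⊂ ℝᵐ` be the product of `m` copies of a two-branch Cantor set of ratio `lam`, where
`(2 lam)^m = lam^e`, so that `𝒞` has dimension `m - e`. The main coefficient `aOut` is at least
`|t|^α'`, with `α' = q - 1 - ε > α`, on narrow double cones with vertices on `𝒞`, and vanishes away
from them. The boundary values equal `M` at height `1` and `-M` at height `-1` over the cones. For
`M` large a minimizer has to stay near `M` above `𝒞` and near `-M` below it, on average, and this
forces the irregularity.

Upper bound for the energy. The function `M * ∑ block k` equals `M * sign t` wherever `aOut` is
positive (`gstar_eq_zero`), so `aOut` does not see its gradient. At scale `r` that gradient has size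
`M / r` on a set of volume `r^(1+e)`; it is therefore in `L^(1+δ)` for `δ < e`, and since `L` grows
more slowly than any power above one, the competitor costs at most `C * M^(1+δ)`
(`exists_energy_bound`). Hence a minimizer satisfies `∫ aOut |Du|^q ≤ C * M^(1+δ)`.

Rigidity of the traces. Send rays from the points of `𝒞` into the cones. At height `t` they occupy
the horizontal slice with density at most `C * t^(-e)` (`lintegral_ray_le`). Because `α' + e < q -
1`, Hölder's inequality bounds the integral of `|Du|` along the rays by `C * (∫ aOut |Du|^q)^(1/q)`
(`exists_lintegral_cone_gradient_le`). Integrating inwards from height `±1`, the mean of `|u ∓ M|`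
on every window of the cones is at most `C * M^((1+δ)/q)` (`lintegral_cone_sub_le`). The exponent is
below one, so for large `M` this is less than `M`.

Consequences. Were almost every point of `𝒞` a Lebesgue point, the means above and below would share
a limit, which is impossible (`volume_nonLebesgue_ne_zero`); since the inverse of the digit
parametrization is Hölder continuous, the non-Lebesgue points have dimension at least `m - e`
(`le_dimH_image`). Likewise the jump at scale `r` is bounded by `r^(-e)` times the integral of
`|Du|` over a set of volume `r^(1+e)`; if `Du` were in `L^(1+ε)` near `𝒞`, this would be
`O(r^((ε-e)/(1+ε)))` and tend to zero (`not_memW1pLoc`).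

Existence. `L` may grow only linearly, so `L` alone gives no compactness. For this the term `M^(-q)
* aIn` is added, with `aIn` comparable to `|t|^β` and `q - 1 - e < β < q - 1`. The upper bound on
`β` makes `a^(-1/(q-1))` integrable, which together with strict convexity of `L` makes gradients of
a minimizing sequence Cauchy in `L¹` (`exists_integral_norm_sub_le`). The lower bound keeps the
competitor's energy finite, and the factor `M^(-q)` cancels its growth in `M`. Both coefficients are
sums of rescaled copies of one smooth function with homogeneity above `α`, hence of class `C^α`
(`IsScaledFamily.exists_holder`). -/

theorem norm_gradient_eq_norm_fderiv (f : E n → ℝ) (x : E n) :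
    ‖gradient f x‖ = ‖fderiv ℝ f x‖ := by
  simp [gradient]

theorem continuous_gradient {f : E n → ℝ} (hf : ContDiff ℝ 1 f) : Continuous (gradient f) := by
  unfold gradient
  exact (LinearIsometryEquiv.continuous _).comp (hf.continuous_fderiv one_ne_zero)

theorem IsTestFunction.contDiff_one {φ : E n → ℝ} (h : IsTestFunction Ω φ) : ContDiff ℝ 1 φ :=
  h.1.of_le (by exact_mod_cast le_top)

theorem IsTestFunction.eq_zero {φ : E n → ℝ} (h : IsTestFunction Ω φ) {x : E n} (hx : x ∉ Ω) :
    φ x = 0 := by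
  by_contra h0
  exact hx (h.2.2 (subset_tsupport _ h0))

theorem IsTestFunction.fderiv_eq_zero {φ : E n → ℝ} (h : IsTestFunction Ω φ) {x : E n}
    (hx : x ∉ Ω) : fderiv ℝ φ x = 0 := by
  by_contra h0
  exact hx (h.2.2 (support_fderiv_subset ℝ h0))

theorem IsTestFunction.mono {Ω' : Set (E n)} {φ : E n → ℝ} (h : IsTestFunction Ω φ)
    (hΩ : Ω ⊆ Ω') : IsTestFunction Ω' φ := ⟨h.1, h.2.1, h.2.2.trans hΩ⟩

/-- The product of a locally integrable function with a continuous function whose support is a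
compact subset of `Ω` is integrable. -/
theorem integrable_smul_of_tsupport_subset {F : Type*} [NormedAddCommGroup F] [NormedSpace ℝ F]
    {f : E n → F} (hf : LocallyIntegrableOn f Ω) {φ : E n → ℝ} (hφ : Continuous φ)
    (hc : HasCompactSupport φ) (hs : tsupport φ ⊆ Ω) : Integrable (fun x => φ x • f x) := by
  have h1 : IntegrableOn (fun x => φ x • f x) (tsupport φ) :=
    (hf.integrableOn_compact_subset hs hc).continuousOn_smul hφ.continuousOn hc
  refine (integrableOn_iff_integrable_of_support_subset ?_).1 h1
  intro x hx
  refine subset_tsupport φ ?_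
  intro h0
  exact hx (by simp [h0])

/-- Uniqueness of weak gradients. -/
theorem HasWeakGradient.ae_eq (hΩ : IsOpen Ω) {u : E n → ℝ} {G₁ G₂ : E n → E n}
    (h₁ : HasWeakGradient Ω u G₁) (h₂ : HasWeakGradient Ω u G₂) :
    G₁ =ᵐ[volume.restrict Ω] G₂ := by
  have hloc : LocallyIntegrableOn (fun x => G₁ x - G₂ x) Ω := h₁.2.1.sub h₂.2.1
  have key : ∀ᵐ x : E n, x ∈ Ω → G₁ x - G₂ x = 0 := by
    refine hΩ.ae_eq_zero_of_integral_contDiff_smul_eq_zero hloc ?_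
    intro φ hφ hc hs
    have i1 := integrable_smul_of_tsupport_subset h₁.2.1 hφ.continuous hc hs
    have i2 := integrable_smul_of_tsupport_subset h₂.2.1 hφ.continuous hc hs
    have hT : IsTestFunction Ω φ := ⟨hφ, hc, hs⟩
    refine ext_inner_right ℝ fun v => ?_
    have e : ∀ G : E n → E n, Integrable (fun x => φ x • G x) →
        inner ℝ (∫ x, φ x • G x) v = ∫ x in Ω, φ x * inner ℝ (G x) v := by
      intro G hG
      rw [setIntegral_eq_integral_of_forall_compl_eq_zero
        (fun x hx => by simp [hT.eq_zero hx]), real_inner_comm, ← integral_inner hG]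
      congr with x
      rw [real_inner_comm, real_inner_smul_left]
    simp_rw [smul_sub]
    rw [integral_sub i1 i2, inner_sub_left, e _ i1, e _ i2, inner_zero_left,
      ← neg_neg (∫ x in Ω, φ x * inner ℝ (G₁ x) v), ← h₁.2.2 φ hT v, h₂.2.2 φ hT v]
    ring
  rw [EventuallyEq, ae_restrict_iff' hΩ.measurableSet]
  filter_upwards [key] with x hx hxΩ using sub_eq_zero.1 (hx hxΩ)

theorem HasWeakGradient.mono {Ω' : Set (E n)} (hΩ : Ω' ⊆ Ω) {u : E n → ℝ} {G : E n → E n}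
    (h : HasWeakGradient Ω u G) : HasWeakGradient Ω' u G := by
  refine ⟨h.1.mono_set hΩ, h.2.1.mono_set hΩ, fun φ hφ v => ?_⟩
  have hφ' := hφ.mono hΩ
  have := h.2.2 φ hφ' v
  rw [setIntegral_eq_integral_of_forall_compl_eq_zero
      (fun x hx => by simp [hφ'.fderiv_eq_zero hx]),
    setIntegral_eq_integral_of_forall_compl_eq_zero (fun x hx => by simp [hφ'.eq_zero hx])] at this
  rw [setIntegral_eq_integral_of_forall_compl_eq_zero
      (fun x hx => by simp [hφ.fderiv_eq_zero hx]),
    setIntegral_eq_integral_of_forall_compl_eq_zero (fun x hx => by simp [hφ.eq_zero hx])]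
  exact this

theorem integral_mul_fderiv_add_eq_zero {f φ : E n → ℝ} (hf : ContDiff ℝ 1 f)
    (hφ : IsTestFunction Ω φ) (v : E n) :
    ∫ x in Ω, (f x * fderiv ℝ φ x v + φ x * inner ℝ (gradient f x) v) = 0 := by
  have hd : Continuous fun x => fderiv ℝ φ x v :=
    (hφ.contDiff_one.continuous_fderiv one_ne_zero).clm_apply continuous_const
  have hd' : Continuous fun x => fderiv ℝ f x v :=
    (hf.continuous_fderiv one_ne_zero).clm_apply continuous_const
  have hcd : HasCompactSupport fun x => fderiv ℝ φ x v :=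
    (hφ.2.1.fderiv (𝕜 := ℝ)).comp_left (g := fun T : E n →L[ℝ] ℝ => T v) (by simp)
  have i1 : Integrable (fun x => f x * fderiv ℝ φ x v) :=
    (hf.continuous.mul hd).integrable_of_hasCompactSupport hcd.mul_left
  have i2 : Integrable (fun x => fderiv ℝ f x v * φ x) :=
    (hd'.mul hφ.1.continuous).integrable_of_hasCompactSupport hφ.2.1.mul_left
  have i3 : Integrable (fun x => f x * φ x) :=
    (hf.continuous.mul hφ.1.continuous).integrable_of_hasCompactSupport hφ.2.1.mul_left
  rw [setIntegral_eq_integral_of_forall_compl_eq_zero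
      (fun x hx => by simp [hφ.fderiv_eq_zero hx, hφ.eq_zero hx])]
  have := integral_mul_fderiv_eq_neg_fderiv_mul_of_integrable i2 i1 i3
    (fun x _ => hf.differentiable one_ne_zero x)
    (fun x _ => hφ.contDiff_one.differentiable one_ne_zero x)
  have e : ∀ x, f x * fderiv ℝ φ x v + φ x * inner ℝ (gradient f x) v
      = f x * fderiv ℝ φ x v + fderiv ℝ f x v * φ x := by
    intro x
    rw [inner_gradient_left]; ring
  simp_rw [e]
  rw [integral_add i1 i2, this]; ring

theorem eq_zero_of_forall_le_mul {x K : ℝ≥0∞} (hK : K ≠ ⊤)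
    (h : ∀ δ : ℝ≥0∞, δ ≠ 0 → x ≤ K * δ) : x = 0 := by
  refine nonpos_iff_eq_zero.1 (le_of_forall_gt_imp_ge_of_dense fun η hη => ?_)
  have hK1 : K + 1 ≠ ⊤ := by simp [hK]
  refine (h (η / (K + 1)) ?_).trans ?_
  · simp [ENNReal.div_eq_zero_iff, hη.ne', hK]
  · calc K * (η / (K + 1)) ≤ (K + 1) * (η / (K + 1)) := by gcongr; exact le_self_add
      _ = η := ENNReal.mul_div_cancel (by simp) hK1

theorem lintegral_enorm_sub_le {X F : Type*} [MeasurableSpace X] {μ : Measure X}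
    [NormedAddCommGroup F] {u v : X → F} (w : X → F) (hu : AEStronglyMeasurable u μ)
    (hv : AEStronglyMeasurable v μ) :
    ∫⁻ x, ‖u x - w x‖ₑ ∂μ ≤ (∫⁻ x, ‖u x - v x‖ₑ ∂μ) + ∫⁻ x, ‖v x - w x‖ₑ ∂μ := by
  have hm : AEMeasurable (fun x => ‖u x - v x‖ₑ) μ := (hu.sub hv).enorm
  rw [← lintegral_add_left' hm]
  refine lintegral_mono fun x => ?_
  rw [← sub_add_sub_cancel (u x) (v x) (w x)]
  exact enorm_add_le _ _

theorem lintegral_mul_enorm_add_le {X F F' : Type*} [MeasurableSpace X] {μ : Measure X}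
    [NormedAddCommGroup F] [NormedAddCommGroup F'] {u : X → F} (v : X → F')
    (hu : AEStronglyMeasurable u μ) {a b δ ε : ℝ≥0∞} (ha : a ≠ ⊤) (hb : b ≠ ⊤)
    (h1 : ∫⁻ x, ‖u x‖ₑ ∂μ ≤ δ) (h2 : ∫⁻ x, ‖v x‖ₑ ∂μ ≤ ε) :
    ∫⁻ x, (a * ‖u x‖ₑ + b * ‖v x‖ₑ) ∂μ ≤ a * δ + b * ε := by
  have hm : AEMeasurable (fun x => a * ‖u x‖ₑ) μ := hu.enorm.const_mul _
  rw [lintegral_add_left' hm, lintegral_const_mul' _ _ ha, lintegral_const_mul' _ _ hb]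
  gcongr

/-- `(u, G)` is a limit in `L¹(Ω)` of pairs `(ψ, Dψ)` with `ψ ∈ 𝒜`. -/
def IsL1Limit (𝒜 : Set (E n → ℝ)) (Ω : Set (E n)) (u : E n → ℝ) (G : E n → E n) : Prop :=
  MemLp u 1 (volume.restrict Ω) ∧ MemLp G 1 (volume.restrict Ω) ∧
    ∀ δ : ℝ≥0∞, δ ≠ 0 → ∃ ψ ∈ 𝒜,
      ∫⁻ x in Ω, ‖u x - ψ x‖ₑ ≤ δ ∧ ∫⁻ x in Ω, ‖G x - gradient ψ x‖ₑ ≤ δ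

/-- Integration by parts holds for the `C¹` approximants. For a fixed test function both sides
depend continuously on the pair in `L¹`, since the test function and its derivative are bounded. -/
theorem IsL1Limit.hasWeakGradient {𝒜 : Set (E n → ℝ)} (h𝒜 : ∀ ψ ∈ 𝒜, ContDiff ℝ 1 ψ)
    {u : E n → ℝ} {G : E n → E n} (h : IsL1Limit 𝒜 Ω u G) : HasWeakGradient Ω u G := by
  obtain ⟨hu, hG, happ⟩ := h
  have hu' : IntegrableOn u Ω := memLp_one_iff_integrable.1 hu
  have hG' : IntegrableOn G Ω := memLp_one_iff_integrable.1 hG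
  refine ⟨hu'.locallyIntegrableOn, hG'.locallyIntegrableOn, fun φ hφ v => ?_⟩
  have hd : Continuous fun x => fderiv ℝ φ x v :=
    (hφ.contDiff_one.continuous_fderiv one_ne_zero).clm_apply continuous_const
  have hcd : HasCompactSupport fun x => fderiv ℝ φ x v :=
    (hφ.2.1.fderiv (𝕜 := ℝ)).comp_left (g := fun T : E n →L[ℝ] ℝ => T v) (by simp)
  have hsd : tsupport (fun x => fderiv ℝ φ x v) ⊆ Ω := by
    refine (closure_minimal ?_ (isClosed_tsupport φ)).trans hφ.2.2
    intro x hx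
    refine support_fderiv_subset ℝ (f := φ) (fun h0 => hx ?_)
    simp [h0]
  obtain ⟨C₁, hC₁⟩ := hd.bounded_above_of_compact_support hcd
  obtain ⟨C₂, hC₂⟩ := hφ.1.continuous.bounded_above_of_compact_support hφ.2.1
  have key : ∀ u : E n → ℝ, ∀ G : E n → E n, LocallyIntegrableOn u Ω → LocallyIntegrableOn G Ω →
      Integrable (fun x => u x * fderiv ℝ φ x v) ∧
      Integrable (fun x => φ x * inner ℝ (G x) v) := by
    intro u G hu hG
    constructor
    · have := integrable_smul_of_tsupport_subset hu hd hcd hsd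
      simpa [mul_comm] using this
    · have := (integrable_smul_of_tsupport_subset hG hφ.1.continuous hφ.2.1 hφ.2.2).inner_const
        (𝕜 := ℝ) v
      simpa [real_inner_smul_left] using this
  obtain ⟨i1, i2⟩ := key u G hu'.locallyIntegrableOn hG'.locallyIntegrableOn
  set K : ℝ≥0∞ := ‖C₁‖ₑ + ‖C₂‖ₑ * ‖v‖ₑ with hK
  have hKtop : K ≠ ⊤ := by
    simp [hK, ENNReal.mul_eq_top]
  have bound : ∀ δ : ℝ≥0∞, δ ≠ 0 →
      ‖∫ x in Ω, (u x * fderiv ℝ φ x v + φ x * inner ℝ (G x) v)‖ₑ ≤ K * δ := by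
    intro δ hδ
    obtain ⟨ψ, hψ, b1, b2⟩ := happ δ hδ
    have hψ1 := h𝒜 ψ hψ
    obtain ⟨j1, j2⟩ := key ψ (gradient ψ)
      (hψ1.continuous.locallyIntegrable.locallyIntegrableOn _)
      ((continuous_gradient hψ1).locallyIntegrable.locallyIntegrableOn _)
    have := integral_mul_fderiv_add_eq_zero hψ1 hφ v
    have hsub := integral_sub (μ := volume.restrict Ω) (i1.add i2).integrableOn
      (j1.add j2).integrableOn
    simp only [Pi.add_apply] at hsub
    rw [← sub_zero (∫ x in Ω, _), ← this, ← hsub]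
    refine (enorm_integral_le_lintegral_enorm _).trans ?_
    calc _ ≤ ∫⁻ x in Ω, (‖C₁‖ₑ * ‖u x - ψ x‖ₑ + ‖C₂‖ₑ * ‖v‖ₑ * ‖G x - gradient ψ x‖ₑ) := by
            refine lintegral_mono fun x => ?_
            have : u x * fderiv ℝ φ x v + φ x * inner ℝ (G x) v
                - (ψ x * fderiv ℝ φ x v + φ x * inner ℝ (gradient ψ x) v)
                = fderiv ℝ φ x v * (u x - ψ x) + φ x * inner ℝ (G x - gradient ψ x) v := by
              rw [inner_sub_left]; ring
            rw [this]
            refine (enorm_add_le _ _).trans (add_le_add ?_ ?_)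
            · rw [enorm_mul]
              gcongr
              exact enorm_le_iff_norm_le.2 ((hC₁ x).trans (le_abs_self _))
            · rw [enorm_mul, mul_assoc]
              gcongr
              · exact enorm_le_iff_norm_le.2 ((hC₂ x).trans (le_abs_self _))
              · rw [mul_comm, ← enorm_norm v, ← enorm_norm (G x - gradient ψ x), ← enorm_mul]
                refine enorm_le_iff_norm_le.2 ?_
                rw [norm_mul, norm_norm, norm_norm]
                exact norm_inner_le_norm _ _
      _ ≤ K * δ := by
            rw [hK, add_mul]
            exact lintegral_mul_enorm_add_le (fun x => G x - gradient ψ x)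
              (hu.1.sub hψ1.continuous.aestronglyMeasurable) (by simp)
              (by simp [ENNReal.mul_eq_top]) b1 b2
  have hz : ∫ x in Ω, (u x * fderiv ℝ φ x v + φ x * inner ℝ (G x) v) = 0 := by
    rw [← enorm_eq_zero]
    exact eq_zero_of_forall_le_mul hKtop bound
  rw [integral_add i1.integrableOn i2.integrableOn] at hz
  linarith

/-- Closedness under `L¹` convergence of pairs, by splitting the tolerance in two. It places the
limit of a minimizing sequence in the Dirichlet class. -/
theorem IsL1Limit.of_approx {𝒜 : Set (E n → ℝ)} {u : E n → ℝ} {G : E n → E n}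
    (hu : MemLp u 1 (volume.restrict Ω)) (hG : MemLp G 1 (volume.restrict Ω))
    (h : ∀ δ : ℝ≥0∞, δ ≠ 0 → ∃ u' G', IsL1Limit 𝒜 Ω u' G' ∧
      ∫⁻ x in Ω, ‖u x - u' x‖ₑ ≤ δ ∧ ∫⁻ x in Ω, ‖G x - G' x‖ₑ ≤ δ) : IsL1Limit 𝒜 Ω u G := by
  refine ⟨hu, hG, fun δ hδ => ?_⟩
  obtain ⟨u', G', h', b1, b2⟩ := h (δ / 2) (by simp [hδ])
  obtain ⟨ψ, hψ, c1, c2⟩ := h'.2.2 (δ / 2) (by simp [hδ])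
  refine ⟨ψ, hψ, ?_, ?_⟩
  · refine (lintegral_enorm_sub_le _ hu.1 h'.1.1).trans ?_
    rw [← ENNReal.add_halves δ]
    gcongr
  · refine (lintegral_enorm_sub_le _ hG.1 h'.2.1.1).trans ?_
    rw [← ENNReal.add_halves δ]
    gcongr

theorem IsL1Limit.congr {𝒜 : Set (E n → ℝ)} {u u' : E n → ℝ} {G G' : E n → E n}
    (h : IsL1Limit 𝒜 Ω u G) (hu : u =ᵐ[volume.restrict Ω] u') (hG : G =ᵐ[volume.restrict Ω] G') :
    IsL1Limit 𝒜 Ω u' G' := by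
  refine ⟨h.1.ae_eq hu, h.2.1.ae_eq hG, fun δ hδ => ?_⟩
  obtain ⟨ψ, hψ, b1, b2⟩ := h.2.2 δ hδ
  refine ⟨ψ, hψ, ?_, ?_⟩
  · rwa [lintegral_congr_ae (g := fun x => ‖u x - ψ x‖ₑ) (by filter_upwards [hu] with x hx; rw [hx])]
  · rwa [lintegral_congr_ae (g := fun x => ‖G x - gradient ψ x‖ₑ)
      (by filter_upwards [hG] with x hx; rw [hx])]

theorem gradient_linear_comb {φ ψ : E n → ℝ} (hφ : ContDiff ℝ 1 φ) (hψ : ContDiff ℝ 1 ψ)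
    (a b : ℝ) (x : E n) :
    gradient (fun y => a * φ y + b * ψ y) x = a • gradient φ x + b • gradient ψ x := by
  have h1 := (hφ.differentiable one_ne_zero x).hasFDerivAt.const_mul a
  have h2 := (hψ.differentiable one_ne_zero x).hasFDerivAt.const_mul b
  have h3 : HasFDerivAt (fun y => a * φ y + b * ψ y) (a • fderiv ℝ φ x + b • fderiv ℝ ψ x) x :=
    h1.add h2
  unfold gradient
  rw [h3.fderiv]
  simp

theorem gradient_add' {φ ψ : E n → ℝ} (hφ : ContDiff ℝ 1 φ) (hψ : ContDiff ℝ 1 ψ) (x : E n) :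
    gradient (fun y => φ y + ψ y) x = gradient φ x + gradient ψ x := by
  simpa using gradient_linear_comb hφ hψ 1 1 x

theorem IsTestFunction.linear_comb {φ ψ : E n → ℝ} (hφ : IsTestFunction Ω φ)
    (hψ : IsTestFunction Ω ψ) (a b : ℝ) : IsTestFunction Ω fun y => a * φ y + b * ψ y := by
  have hs : Function.support (fun y => a * φ y + b * ψ y) ⊆ tsupport φ ∪ tsupport ψ := by
    intro x hx
    by_contra h0
    rw [mem_union, not_or] at h0
    exact hx (by simp [image_eq_zero_of_notMem_tsupport h0.1,
      image_eq_zero_of_notMem_tsupport h0.2])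
  refine ⟨(contDiff_const.mul hφ.1).add (contDiff_const.mul hψ.1), ?_, ?_⟩
  · exact HasCompactSupport.of_support_subset_isCompact (hφ.2.1.union hψ.2.1) hs
  · exact (closure_minimal hs ((isClosed_tsupport _).union (isClosed_tsupport _))).trans
      (union_subset hφ.2.2 hψ.2.2)

/-- The set of test functions on `Ω`. -/
abbrev testFunctions (Ω : Set (E n)) : Set (E n → ℝ) := {φ | IsTestFunction Ω φ}

theorem IsL1Limit.linear_comb {u v : E n → ℝ} {F G : E n → E n}
    (h₁ : IsL1Limit (testFunctions Ω) Ω u F) (h₂ : IsL1Limit (testFunctions Ω) Ω v G) (a b : ℝ) :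
    IsL1Limit (testFunctions Ω) Ω (fun x => a * u x + b * v x) (fun x => a • F x + b • G x) := by
  refine ⟨(h₁.1.const_mul a).add (h₂.1.const_mul b),
    (h₁.2.1.const_smul a).add (h₂.2.1.const_smul b), fun δ hδ => ?_⟩
  set K : ℝ≥0∞ := ‖a‖ₑ + ‖b‖ₑ + 1 with hK
  have hKtop : K ≠ ⊤ := by simp [hK]
  have hη : δ / K ≠ 0 := by simp [ENNReal.div_eq_zero_iff, hδ, hKtop]
  obtain ⟨φ, hφ, b1, b2⟩ := h₁.2.2 (δ / K) hη
  obtain ⟨ψ, hψ, c1, c2⟩ := h₂.2.2 (δ / K) hη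
  have fin : ‖a‖ₑ * (δ / K) + ‖b‖ₑ * (δ / K) ≤ δ := by
    rw [← add_mul]
    calc _ ≤ K * (δ / K) := by gcongr; exact le_self_add
      _ = δ := ENNReal.mul_div_cancel (by simp [hK]) hKtop
  refine ⟨_, IsTestFunction.linear_comb hφ hψ a b, ?_, ?_⟩
  · calc _ ≤ ∫⁻ x in Ω, (‖a‖ₑ * ‖u x - φ x‖ₑ + ‖b‖ₑ * ‖v x - ψ x‖ₑ) := by
          refine lintegral_mono fun x => ?_
          rw [← enorm_mul, ← enorm_mul]
          refine le_trans (le_of_eq ?_) (enorm_add_le _ _)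
          congr 1; ring
      _ ≤ ‖a‖ₑ * (δ / K) + ‖b‖ₑ * (δ / K) := by
          exact lintegral_mul_enorm_add_le (fun x => v x - ψ x)
            (h₁.1.1.sub hφ.1.continuous.aestronglyMeasurable) (by simp) (by simp) b1 c1
      _ ≤ δ := fin
  · calc _ ≤ ∫⁻ x in Ω, (‖a‖ₑ * ‖F x - gradient φ x‖ₑ + ‖b‖ₑ * ‖G x - gradient ψ x‖ₑ) := by
          refine lintegral_mono fun x => ?_
          rw [← enorm_smul, ← enorm_smul, gradient_linear_comb
            (IsTestFunction.contDiff_one hφ) (IsTestFunction.contDiff_one hψ)]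
          refine le_trans (le_of_eq ?_) (enorm_add_le _ _)
          congr 1
          module
      _ ≤ ‖a‖ₑ * (δ / K) + ‖b‖ₑ * (δ / K) := by
          exact lintegral_mul_enorm_add_le (fun x => G x - gradient ψ x) (h₁.2.1.1.sub
            (continuous_gradient (IsTestFunction.contDiff_one hφ)).aestronglyMeasurable)
            (by simp) (by simp) b2 c2
      _ ≤ δ := fin

theorem memW011_iff {u : E n → ℝ} :
    MemW011 Ω u ↔ ∃ G, IsL1Limit (testFunctions Ω) Ω u G := by
  constructor
  · rintro ⟨hu, G, -, hG, φ, hφ, t1, t2⟩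
    refine ⟨G, hu, hG, fun δ hδ => ?_⟩
    have hpos : 0 < δ := pos_iff_ne_zero.2 hδ
    obtain ⟨k, k1, k2⟩ := ((t1.eventually_le_const hpos).and (t2.eventually_le_const hpos)).exists
    rw [eLpNorm_one_eq_lintegral_enorm] at k1 k2
    exact ⟨φ k, hφ k, k1, k2⟩
  · rintro ⟨G, h⟩
    refine ⟨h.1, G, h.hasWeakGradient fun ψ hψ => IsTestFunction.contDiff_one hψ, h.2.1, ?_⟩
    choose φ hφ b1 b2 using fun k : ℕ => h.2.2 ((k : ℝ≥0∞)⁻¹) (by simp)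
    refine ⟨φ, hφ, ?_, ?_⟩
    · refine tendsto_of_tendsto_of_tendsto_of_le_of_le tendsto_const_nhds
        ENNReal.tendsto_inv_nat_nhds_zero (fun _ => zero_le) fun k => ?_
      rw [eLpNorm_one_eq_lintegral_enorm]; exact b1 k
    · refine tendsto_of_tendsto_of_tendsto_of_le_of_le tendsto_const_nhds
        ENNReal.tendsto_inv_nat_nhds_zero (fun _ => zero_le) fun k => ?_
      rw [eLpNorm_one_eq_lintegral_enorm]; exact b2 k

/-- Translation of a class of approximating functions by a fixed function. -/
theorem IsL1Limit.const_add {u₀ v : E n → ℝ} {G : E n → E n} (hu₀ : ContDiff ℝ 1 u₀)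
    (h0 : MemLp u₀ 1 (volume.restrict Ω)) (h1 : MemLp (gradient u₀) 1 (volume.restrict Ω))
    (h : IsL1Limit (testFunctions Ω) Ω v G) :
    IsL1Limit {ψ | ∃ φ, IsTestFunction Ω φ ∧ ψ = fun x => u₀ x + φ x} Ω
      (fun x => u₀ x + v x) (fun x => gradient u₀ x + G x) := by
  refine ⟨h0.add h.1, h1.add h.2.1, fun δ hδ => ?_⟩
  obtain ⟨φ, hφ, b1, b2⟩ := h.2.2 δ hδ
  refine ⟨_, ⟨φ, hφ, rfl⟩, ?_, ?_⟩
  · simpa using b1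
  · simpa [gradient_add' hu₀ (IsTestFunction.contDiff_one hφ)] using b2

end SobolevPairs

/-! ### The cube and its Poincaré inequality -/

section Cube

variable {n : ℕ}

theorem isOpen_cube : IsOpen (cube n) := by
  simp only [cube, ofPred_forall]
  exact isOpen_iInter_of_finite fun i => isOpen_Ioo.preimage (by fun_prop)

theorem isClosed_closedCube : IsClosed (closedCube n) := by
  simp only [closedCube, ofPred_forall]
  exact isClosed_iInter fun i => isClosed_Icc.preimage (by fun_prop)

theorem cube_subset_closedCube : cube n ⊆ closedCube n :=
  fun _ hx i => ⟨(hx i).1.le, (hx i).2.le⟩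

theorem norm_le_of_mem_closedCube {x : E n} (hx : x ∈ closedCube n) : ‖x‖ ≤ √n := by
  rw [EuclideanSpace.norm_eq]
  refine Real.sqrt_le_sqrt ?_
  calc ∑ i, ‖x i‖ ^ 2 ≤ ∑ _i : Fin n, (1 : ℝ) := by
        refine Finset.sum_le_sum fun i _ => ?_
        rw [Real.norm_eq_abs, sq_abs]
        have := hx i
        nlinarith [this.1, this.2]
    _ = n := by simp

theorem isCompact_closedCube : IsCompact (closedCube n) := by
  refine Metric.isCompact_of_isClosed_isBounded isClosed_closedCube ?_
  refine (Metric.isBounded_closedBall (x := (0 : E n)) (r := √n)).subset fun x hx => ?_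
  simpa using norm_le_of_mem_closedCube hx

theorem volume_cube_lt_top : volume (cube n) < ⊤ :=
  (measure_mono cube_subset_closedCube).trans_lt isCompact_closedCube.measure_lt_top

instance isFiniteMeasure_restrict_cube : IsFiniteMeasure (volume.restrict (cube n)) :=
  ⟨by simpa using volume_cube_lt_top⟩

theorem memLp_one_cube_of_continuous {F : Type*} [NormedAddCommGroup F] {f : E n → F}
    (hf : Continuous f) : MemLp f 1 (volume.restrict (cube n)) := by
  refine memLp_one_iff_integrable.2 (IntegrableOn.mono_set ?_ cube_subset_closedCube)
  exact hf.continuousOn.integrableOn_compact isCompact_closedCube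

/-- Poincaré inequality in `W^{1,1}_0` of the cube. -/
theorem exists_poincare (hn : 2 ≤ n) : ∃ C : ℝ≥0, ∀ (v : E n → ℝ) (G : E n → E n),
    IsL1Limit (testFunctions (cube n)) (cube n) v G →
      ∫⁻ x in cube n, ‖v x‖ₑ ≤ C * ∫⁻ x in cube n, ‖G x‖ₑ := by
  set C := eLpNormLESNormFDerivOfLeConst ℝ (volume : Measure (E n)) (cube n) 1 1
  have htest : ∀ φ, IsTestFunction (cube n) φ →
      ∫⁻ x in cube n, ‖φ x‖ₑ ≤ C * ∫⁻ x in cube n, ‖gradient φ x‖ₑ := by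
    intro φ hφ
    -- The Sobolev inequality is used with exponent `1` on both sides; it asks that this exponent be
    -- smaller than the dimension, which is where `2 ≤ n` enters.
    have := eLpNorm_le_eLpNorm_fderiv (volume : Measure (E n)) hφ.contDiff_one
      (s := cube n) ((subset_tsupport φ).trans hφ.2.2) (p := 1) le_rfl
      (by simp; omega) (isCompact_closedCube.isBounded.subset cube_subset_closedCube)
    simp only [ENNReal.coe_one, eLpNorm_one_eq_lintegral_enorm] at this
    refine (setLIntegral_le_lintegral _ _).trans (this.trans (le_of_eq ?_))
    congr 1
    rw [← setLIntegral_eq_of_support_subset (s := cube n)]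
    · refine lintegral_congr fun x => ?_
      rw [← enorm_norm, ← norm_gradient_eq_norm_fderiv, enorm_norm]
    · intro x hx
      by_contra h0
      have hz : ‖fderiv ℝ φ x‖ₑ = 0 := by 
        rw [← enorm_norm, hφ.fderiv_eq_zero h0, norm_zero, enorm_zero]
      exact hx hz
  refine ⟨C, fun v G h => ?_⟩
  refine ENNReal.le_of_forall_pos_le_add fun η hη _ => ?_
  have hη' : (η : ℝ≥0∞) / (C + 1) ≠ 0 := by simp [ENNReal.div_eq_zero_iff, hη.ne']
  obtain ⟨φ, hφ, b1, b2⟩ := h.2.2 _ hη'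
  have hφ : IsTestFunction (cube n) φ := hφ
  have hmφ : AEStronglyMeasurable φ (volume.restrict (cube n)) :=
    hφ.1.continuous.aestronglyMeasurable
  have e1 : ∫⁻ x in cube n, ‖v x‖ₑ ≤ η / (C + 1) + ∫⁻ x in cube n, ‖φ x‖ₑ := by
    have := lintegral_enorm_sub_le (0 : E n → ℝ) h.1.1 hmφ
    simp only [Pi.zero_apply, sub_zero] at this
    exact this.trans (by gcongr)
  have e2 : ∫⁻ x in cube n, ‖gradient φ x‖ₑ ≤ η / (C + 1) + ∫⁻ x in cube n, ‖G x‖ₑ := by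
    have := lintegral_enorm_sub_le (0 : E n → E n) (μ := volume.restrict (cube n))
      (continuous_gradient hφ.contDiff_one).aestronglyMeasurable h.2.1.1
    simp only [Pi.zero_apply, sub_zero] at this
    simp_rw [enorm_sub_rev (gradient φ _)] at this
    exact this.trans (by gcongr)
  calc ∫⁻ x in cube n, ‖v x‖ₑ
      ≤ η / (C + 1) + C * (η / (C + 1) + ∫⁻ x in cube n, ‖G x‖ₑ) := by
        refine e1.trans ?_
        gcongr
        exact (htest φ hφ).trans (by gcongr)
    _ = (C * ∫⁻ x in cube n, ‖G x‖ₑ) + (C + 1) * (η / (C + 1)) := by ring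
    _ = (C * ∫⁻ x in cube n, ‖G x‖ₑ) + η := by
        rw [ENNReal.mul_div_cancel (by simp) (by simp)]

end Cube

/-! ### Minimizing gradients are Cauchy in `L¹` -/

section Existence

variable {n : ℕ}

/-- Midpoint convexity of `z ↦ (s² + |z|²)^{q/2}`. -/
theorem rpow_sq_add_norm_sq_midpoint_le {q : ℝ} (hq : 1 ≤ q) (s : ℝ) (z₁ z₂ : E n) :
    (s ^ 2 + ‖(1 / 2 : ℝ) • (z₁ + z₂)‖ ^ 2) ^ (q / 2)
      ≤ ((s ^ 2 + ‖z₁‖ ^ 2) ^ (q / 2) + (s ^ 2 + ‖z₂‖ ^ 2) ^ (q / 2)) / 2 := by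
  -- `√(s² + |z|²)` is the Euclidean norm of the pair `(s, z)`, so the function is a norm followed
  -- by the increasing convex power `q`.
  set N : E n → ℝ := fun z => ‖(WithLp.toLp 2 (s, z) : WithLp 2 (ℝ × E n))‖ with hN
  have hpow : ∀ z, (s ^ 2 + ‖z‖ ^ 2) ^ (q / 2) = N z ^ q := by
    intro z
    have : N z = (s ^ 2 + ‖z‖ ^ 2) ^ (1 / 2 : ℝ) := by
      simp [hN, WithLp.prod_norm_eq_of_L2, Real.sqrt_eq_rpow]
    rw [this, ← Real.rpow_mul (by positivity)]
    congr 1; ring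
  have hmid : N ((1 / 2 : ℝ) • (z₁ + z₂)) ≤ (N z₁ + N z₂) / 2 := by
    have : (WithLp.toLp 2 (s, (1 / 2 : ℝ) • (z₁ + z₂)) : WithLp 2 (ℝ × E n))
        = (1 / 2 : ℝ) • (WithLp.toLp 2 (s, z₁) + WithLp.toLp 2 (s, z₂)) := by
      rw [← WithLp.toLp_add, ← WithLp.toLp_smul]
      congr 1
      ext1
      · simp; ring
      · simp
    simp only [hN]
    rw [this, norm_smul]
    have := norm_add_le (WithLp.toLp 2 (s, z₁) : WithLp 2 (ℝ × E n)) (WithLp.toLp 2 (s, z₂))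
    rw [Real.norm_of_nonneg (by norm_num)]
    linarith
  rw [hpow, hpow, hpow]
  have h1 : 0 ≤ N z₁ := norm_nonneg _
  have h2 : 0 ≤ N z₂ := norm_nonneg _
  refine (Real.rpow_le_rpow (norm_nonneg _) hmid (by linarith)).trans ?_
  have hhalf : (0 : ℝ) ≤ 1 / 2 := by norm_num
  have := (convexOn_rpow hq).2 (mem_Ici.2 h1) (mem_Ici.2 h2) hhalf hhalf (by norm_num)
  simp only [smul_eq_mul] at this
  convert this using 1
  · congr 1; ring
  · ring

/-- Strict midpoint convexity. -/
def StrictMidpointConvex (L : E n → ℝ) : Prop :=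
  ∀ z₁ z₂ : E n, z₁ ≠ z₂ → L ((1 / 2 : ℝ) • (z₁ + z₂)) < (L z₁ + L z₂) / 2

theorem StrictMidpointConvex.le {L : E n → ℝ} (h : StrictMidpointConvex L) (z₁ z₂ : E n) :
    L ((1 / 2 : ℝ) • (z₁ + z₂)) ≤ (L z₁ + L z₂) / 2 := by
  by_cases h0 : z₁ = z₂
  · subst h0
    have : (1 / 2 : ℝ) • (z₁ + z₁) = z₁ := by module
    rw [this]; linarith
  · exact (h z₁ z₂ h0).le

/-- The convexity defect is continuous and positive on the compact set of pairs in a ball that are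
`δ` apart, so it attains a positive minimum there. -/
theorem StrictMidpointConvex.exists_gap {L : E n → ℝ} (hL : Continuous L)
    (h : StrictMidpointConvex L) (R : ℝ) {δ : ℝ} (hδ : 0 < δ) :
    ∃ c > 0, ∀ z₁ z₂ : E n, ‖z₁‖ ≤ R → ‖z₂‖ ≤ R → δ ≤ ‖z₁ - z₂‖ →
      c ≤ (L z₁ + L z₂) / 2 - L ((1 / 2 : ℝ) • (z₁ + z₂)) := by
  set S : Set (E n × E n) :=
    (Metric.closedBall 0 R ×ˢ Metric.closedBall 0 R) ∩ {p | δ ≤ ‖p.1 - p.2‖} with hS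
  have hSc : IsCompact S := by
    refine ((isCompact_closedBall _ _).prod (isCompact_closedBall _ _)).inter_right ?_
    exact isClosed_le continuous_const (by fun_prop)
  have hf : Continuous fun p : E n × E n =>
      (L p.1 + L p.2) / 2 - L ((1 / 2 : ℝ) • (p.1 + p.2)) := by fun_prop
  rcases S.eq_empty_or_nonempty with he | hne
  · refine ⟨1, one_pos, fun z₁ z₂ h1 h2 h3 => ?_⟩
    have : (z₁, z₂) ∈ S := ⟨⟨by simpa using h1, by simpa using h2⟩, h3⟩
    rw [he] at this; exact this.elim
  · obtain ⟨p, hp, hmin⟩ := hSc.exists_isMinOn hne hf.continuousOn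
    refine ⟨_, ?_, fun z₁ z₂ h1 h2 h3 =>
      hmin (show (z₁, z₂) ∈ S from ⟨⟨by simpa using h1, by simpa using h2⟩, h3⟩)⟩
    have hne' : p.1 ≠ p.2 := by
      intro h0
      have := hp.2
      simp only [mem_ofPred_eq, h0, sub_self, norm_zero] at this
      linarith
    exact sub_pos.2 (h _ _ hne')

theorem norm_le_mul_rpow_of_lt {q η : ℝ} (hq : 1 < q) (hη : 0 < η) {t : ℝ}
    (h : η ^ (-1 / (q - 1)) < t) : t ≤ η * t ^ q := by
  have h0 : 0 < η ^ (-1 / (q - 1)) := Real.rpow_pos_of_pos hη _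
  have ht : 0 < t := h0.trans h
  have h2 : (η ^ (-1 / (q - 1))) ^ (q - 1) ≤ t ^ (q - 1) :=
    Real.rpow_le_rpow h0.le h.le (by linarith)
  rw [← Real.rpow_mul hη.le, div_mul_cancel₀ _ (by linarith), Real.rpow_neg_one] at h2
  have h3 : t ^ q = t ^ (q - 1) * t := by
    rw [← Real.rpow_add_one ht.ne']; congr 1; ring
  have h4 : 1 ≤ η * t ^ (q - 1) := by
    have := mul_le_mul_of_nonneg_left h2 hη.le
    rwa [mul_inv_cancel₀ hη.ne'] at this
  rw [h3, ← mul_assoc]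
  nlinarith

/-- The pointwise inequality behind the convergence of minimizing sequences: distances are
controlled by the `q`-energy, an integrable tail, and the convexity defect. -/
theorem norm_sub_le_energy_add_tail_add_defect {L : E n → ℝ} (hLc : StrictMidpointConvex L)
    {q η R δ c A : ℝ} (hq : 1 < q) (hη : 0 < η) (hR : 0 ≤ R) (hδ : 0 < δ) (hc : 0 < c)
    (hgap : ∀ z₁ z₂ : E n, ‖z₁‖ ≤ R → ‖z₂‖ ≤ R → δ ≤ ‖z₁ - z₂‖ →
      c ≤ (L z₁ + L z₂) / 2 - L ((1 / 2 : ℝ) • (z₁ + z₂))) (hA : 0 < A) (z₁ z₂ : E n) :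
    ‖z₁ - z₂‖ ≤ 2 * η * (A * ‖z₁‖ ^ q + A * ‖z₂‖ ^ q)
      + 2 * (Ioi R).indicator id ((η * A) ^ (-1 / (q - 1))) + δ
      + 2 * R / c * ((L z₁ + L z₂) / 2 - L ((1 / 2 : ℝ) • (z₁ + z₂))) := by
  set ρ := (η * A) ^ (-1 / (q - 1)) with hρ
  have hηA : 0 < η * A := mul_pos hη hA
  have hρ0 : 0 < ρ := Real.rpow_pos_of_pos hηA _
  have hdef := sub_nonneg.2 (hLc.le z₁ z₂)
  have hdef' : 0 ≤ 2 * R / c * ((L z₁ + L z₂) / 2 - L ((1 / 2 : ℝ) • (z₁ + z₂))) := by positivity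
  have hind : 0 ≤ (Ioi R).indicator id ρ := by
    unfold indicator; split_ifs
    · exact hρ0.le
    · exact le_rfl
  have hp1 : 0 ≤ A * ‖z₁‖ ^ q := by positivity
  have hp2 : 0 ≤ A * ‖z₂‖ ^ q := by positivity
  have htri := norm_sub_le z₁ z₂
  -- `ρ` is the length beyond which `t ≤ η * A * t^q`. If one vector is longer than `ρ`, the longer
  -- of the two absorbs the distance into the `q`-energy. Otherwise the distance is at most `2ρ`:
  -- this is the tail term when `ρ > R`, and when `ρ ≤ R` both vectors lie in the ball of radius
  -- `R`, where either they are `δ`-close or the gap `c` applies.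
  by_cases h1 : ρ < ‖z₁‖ ∨ ρ < ‖z₂‖
  · have hmax : ∀ t, ρ < t → t ≤ η * (A * t ^ q) := fun t ht => by
      have := norm_le_mul_rpow_of_lt hq hηA ht
      linarith [mul_assoc η A (t ^ q)]
    rcases le_total ‖z₁‖ ‖z₂‖ with h2 | h2
    · have h3 := hmax ‖z₂‖ (h1.elim (fun h => h.trans_le h2) id)
      nlinarith [mul_nonneg hη.le hp1]
    · have h3 := hmax ‖z₁‖ (h1.elim id (fun h => h.trans_le h2))
      nlinarith [mul_nonneg hη.le hp2]
  · push Not at h1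
    have hq1 : 0 ≤ 2 * η * (A * ‖z₁‖ ^ q + A * ‖z₂‖ ^ q) := by positivity
    by_cases h2 : R < ρ
    · rw [indicator_of_mem (show ρ ∈ Ioi R from h2), id]
      linarith [h1.1, h1.2]
    · push Not at h2
      by_cases h3 : δ ≤ ‖z₁ - z₂‖
      · have h4 := hgap z₁ z₂ (h1.1.trans h2) (h1.2.trans h2) h3
        have h5 : 2 * R ≤ 2 * R / c * ((L z₁ + L z₂) / 2 - L ((1 / 2 : ℝ) • (z₁ + z₂))) := by
          rw [div_mul_eq_mul_div, le_div_iff₀ hc]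
          gcongr
        linarith [h1.1, h1.2]
      · push Not at h3
        linarith

theorem tendsto_integral_indicator_Ioi {X : Type*} [MeasurableSpace X] {μ : Measure X}
    {ρ : X → ℝ} (hρ : Integrable ρ μ) :
    Tendsto (fun R : ℕ => ∫ x, (Ioi (R : ℝ)).indicator id (ρ x) ∂μ) atTop (𝓝 0) := by
  have h0 : (0 : ℝ) = ∫ _x, (0 : ℝ) ∂μ := by simp
  rw [h0]
  refine tendsto_integral_of_dominated_convergence (fun x => ‖ρ x‖) (fun R => ?_) hρ.norm
    (fun R => ?_) ?_
  · exact ((measurable_id.indicator measurableSet_Ioi).comp_aemeasurable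
      hρ.1.aemeasurable).aestronglyMeasurable
  · refine Eventually.of_forall fun x => ?_
    unfold indicator; split_ifs <;> simp
  · refine Eventually.of_forall fun x => tendsto_const_nhds.congr' ?_
    filter_upwards [eventually_ge_atTop ⌈ρ x⌉₊] with R hR
    have : ρ x ≤ R := (Nat.le_ceil _).trans (by exact_mod_cast hR)
    rw [indicator_of_notMem (by simpa using this)]

variable {L a : E n → ℝ} {s q : ℝ}

theorem continuous_uncurry_integrand (hL : Continuous L) (ha : Continuous a) (hq : 0 < q) :
    Continuous fun p : E n × E n => integrand L a s q p.1 p.2 := by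
  unfold integrand
  refine (hL.comp continuous_snd).add ((ha.comp continuous_fst).mul ?_)
  exact Continuous.rpow_const (by fun_prop) fun _ => Or.inr (by positivity)

theorem aestronglyMeasurable_integrand (hL : Continuous L) (ha : Continuous a) (hq : 0 < q)
    {μ : Measure (E n)} {D : E n → E n} (hD : AEStronglyMeasurable D μ) :
    AEStronglyMeasurable (fun x => integrand L a s q x (D x)) μ :=
  (continuous_uncurry_integrand hL ha hq).comp_aestronglyMeasurable
    (aestronglyMeasurable_id.prodMk hD)

theorem mul_norm_rpow_le_integrand {c : ℝ} (hLb : ∀ z, -c ≤ L z) (hq : 0 < q) {x : E n}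
    (hax : 0 ≤ a x) (z : E n) : a x * ‖z‖ ^ q ≤ integrand L a s q x z + c := by
  have h1 : ‖z‖ ^ q ≤ (s ^ 2 + ‖z‖ ^ 2) ^ (q / 2) := by
    calc ‖z‖ ^ q = (‖z‖ ^ 2) ^ (q / 2) := by
          rw [← Real.rpow_natCast, ← Real.rpow_mul (norm_nonneg _)]; congr 1; push_cast; ring
      _ ≤ _ := Real.rpow_le_rpow (by positivity) (by nlinarith [sq_nonneg s]) (by positivity)
  have := mul_le_mul_of_nonneg_left h1 hax
  unfold integrand
  linarith [hLb z]

/-- The `q`-term is convex, so it only adds to the convexity defect of `L`. -/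
theorem defect_le_integrand_defect (hq : 1 ≤ q) {x : E n} (hax : 0 ≤ a x) (z₁ z₂ : E n) :
    (L z₁ + L z₂) / 2 - L ((1 / 2 : ℝ) • (z₁ + z₂))
      ≤ (integrand L a s q x z₁ + integrand L a s q x z₂) / 2
        - integrand L a s q x ((1 / 2 : ℝ) • (z₁ + z₂)) := by
  have := mul_le_mul_of_nonneg_left (rpow_sq_add_norm_sq_midpoint_le hq s z₁ z₂) hax
  unfold integrand
  linarith

theorem integrable_integrand_midpoint (hL : Continuous L) (hLc : StrictMidpointConvex L) {c : ℝ}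
    (hLb : ∀ z, -c ≤ L z) (ha : Continuous a) (ha0 : ∀ x ∈ cube n, 0 ≤ a x) (hq : 1 ≤ q)
    {D₁ D₂ : E n → E n} (h₁ : IntegrableOn (fun x => integrand L a s q x (D₁ x)) (cube n))
    (h₂ : IntegrableOn (fun x => integrand L a s q x (D₂ x)) (cube n))
    (m₁ : AEStronglyMeasurable D₁ (volume.restrict (cube n)))
    (m₂ : AEStronglyMeasurable D₂ (volume.restrict (cube n))) :
    IntegrableOn (fun x => integrand L a s q x ((1 / 2 : ℝ) • (D₁ x + D₂ x))) (cube n) := by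
  have hb : IntegrableOn (fun x => |c| + |integrand L a s q x (D₁ x)|
      + |integrand L a s q x (D₂ x)|) (cube n) :=
    ((integrable_const _).add h₁.abs).add h₂.abs
  have hmeas : AEStronglyMeasurable (fun x => (1 / 2 : ℝ) • (D₁ x + D₂ x))
      (volume.restrict (cube n)) := AEStronglyMeasurable.const_smul (m₁.add m₂) (1 / 2 : ℝ)
  refine Integrable.mono' hb (aestronglyMeasurable_integrand hL ha (by linarith) hmeas) ?_
  refine (ae_restrict_iff' isOpen_cube.measurableSet).2 (Eventually.of_forall fun x hx => ?_)
  have h1 := defect_le_integrand_defect (L := L) (s := s) hq (ha0 x hx) (D₁ x) (D₂ x)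
  have h2 := hLc.le (D₁ x) (D₂ x)
  have h3 := mul_norm_rpow_le_integrand (s := s) hLb (by linarith : 0 < q) (ha0 x hx)
    ((1 / 2 : ℝ) • (D₁ x + D₂ x))
  have h4 : 0 ≤ a x * ‖(1 / 2 : ℝ) • (D₁ x + D₂ x)‖ ^ q :=
    mul_nonneg (ha0 x hx) (Real.rpow_nonneg (norm_nonneg _) _)
  rw [Real.norm_eq_abs, abs_le]
  constructor
  · linarith [le_abs_self c, abs_nonneg (integrand L a s q x (D₁ x)),
      abs_nonneg (integrand L a s q x (D₂ x))]
  · linarith [le_abs_self (integrand L a s q x (D₁ x)), le_abs_self (integrand L a s q x (D₂ x)),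
      abs_nonneg c, abs_nonneg (integrand L a s q x (D₁ x)),
      abs_nonneg (integrand L a s q x (D₂ x))]

theorem integrable_mul_norm_rpow {c : ℝ} (hLb : ∀ z, -c ≤ L z) (ha : Continuous a)
    (ha0 : ∀ x ∈ cube n, 0 ≤ a x) (hq : 0 < q) {D : E n → E n}
    (hi : IntegrableOn (fun x => integrand L a s q x (D x)) (cube n))
    (hm : AEStronglyMeasurable D (volume.restrict (cube n))) :
    IntegrableOn (fun x => a x * ‖D x‖ ^ q) (cube n) ∧
      ∫ x in cube n, a x * ‖D x‖ ^ q
        ≤ (∫ x in cube n, integrand L a s q x (D x)) + c * volume.real (cube n) := by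
  have hb : IntegrableOn (fun x => integrand L a s q x (D x) + c) (cube n) :=
    hi.add (integrable_const _)
  have hle : ∀ᵐ x ∂volume.restrict (cube n),
      a x * ‖D x‖ ^ q ≤ integrand L a s q x (D x) + c :=
    (ae_restrict_iff' isOpen_cube.measurableSet).2
      (Eventually.of_forall fun x hx => mul_norm_rpow_le_integrand hLb hq (ha0 x hx) _)
  have hi' : IntegrableOn (fun x => a x * ‖D x‖ ^ q) (cube n) := by
    refine Integrable.mono' hb ?_ ?_
    · have := (Real.continuous_rpow_const hq.le).comp_aestronglyMeasurable hm.norm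
      exact ha.aestronglyMeasurable.mul this
    · filter_upwards [hle, ae_restrict_mem isOpen_cube.measurableSet] with x hx hxc
      rw [Real.norm_of_nonneg (mul_nonneg (ha0 x hxc) (Real.rpow_nonneg (norm_nonneg _) _))]
      exact hx
  refine ⟨hi', (integral_mono_ae hi' hb hle).trans (le_of_eq ?_)⟩
  rw [integral_add hi (integrable_const _)]
  simp [mul_comm]

/-- Gradients of a minimizing sequence form a Cauchy sequence in `L¹`. -/
theorem exists_integral_norm_sub_le (hL : Continuous L) (hLc : StrictMidpointConvex L) {c : ℝ}
    (hLb : ∀ z, -c ≤ L z) (ha : Continuous a) (ha0 : ∀ x ∈ cube n, 0 ≤ a x) (hq : 1 < q)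
    (hae : ∀ᵐ x ∂volume.restrict (cube n), 0 < a x)
    (haw : IntegrableOn (fun x => a x ^ (-1 / (q - 1))) (cube n))
    {D : ℕ → E n → E n} (hD : ∀ k, MemLp (D k) 1 (volume.restrict (cube n)))
    (hi : ∀ k, IntegrableOn (fun x => integrand L a s q x (D k x)) (cube n)) {I : ℝ}
    (hmid : ∀ k l, I ≤ ∫ x in cube n, integrand L a s q x ((1 / 2 : ℝ) • (D k x + D l x)))
    (hI : Tendsto (fun k => ∫ x in cube n, integrand L a s q x (D k x)) atTop (𝓝 I))
    {η₀ : ℝ} (hη₀ : 0 < η₀) :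
    ∃ N, ∀ k ≥ N, ∀ l ≥ N, ∫ x in cube n, ‖D k x - D l x‖ ≤ η₀ := by
  set V := volume.real (cube n) with hV
  have hV0 : 0 ≤ V := measureReal_nonneg
  set K := |I| + 1 + |c| * V with hK
  have hK1 : 0 < K := by positivity
  -- Each of the four terms of the pointwise inequality receives `η₀ / 4`. The energy bound `K`
  -- fixes `η`; integrability of `ρ` then fixes `R`; the volume fixes `δ`; the gap `g` for these `R`
  -- and `δ` finally fixes `ε₁`, the required closeness to the infimum.
  set η := η₀ / (16 * K) with hη
  have hη0 : 0 < η := by positivity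
  set ρ : E n → ℝ := fun x => (η * a x) ^ (-1 / (q - 1)) with hρ
  have hρi : IntegrableOn ρ (cube n) := by
    refine (haw.const_mul (η ^ (-1 / (q - 1)))).congr ?_
    filter_upwards [hae] with x hx
    simp only [hρ, Real.mul_rpow hη0.le hx.le]
  obtain ⟨R, hR⟩ := ((tendsto_integral_indicator_Ioi hρi).eventually_lt_const
    (show (0 : ℝ) < η₀ / 8 by positivity)).exists
  set δ := η₀ / (4 * (V + 1)) with hδ
  have hδ0 : 0 < δ := by positivity
  obtain ⟨g, hg0, hgap⟩ := hLc.exists_gap hL R hδ0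
  set ε₁ := η₀ * g / (8 * (R + 1)) with hε₁
  have hε₁0 : 0 < ε₁ := by positivity
  have hev : ∀ᶠ k in atTop, ∫ x in cube n, integrand L a s q x (D k x) < I + min ε₁ 1 :=
    hI.eventually_lt_const (by linarith [lt_min hε₁0 one_pos])
  obtain ⟨N, hN⟩ := eventually_atTop.1 hev
  refine ⟨N, fun k hk l hl => ?_⟩
  have hJk := hN k hk
  have hJl := hN l hl
  obtain ⟨ik, bk⟩ := integrable_mul_norm_rpow hLb ha ha0 (by linarith) (hi k) (hD k).1
  obtain ⟨il, bl⟩ := integrable_mul_norm_rpow hLb ha ha0 (by linarith) (hi l) (hD l).1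
  have hm := integrable_integrand_midpoint hL hLc hLb ha ha0 hq.le (hi k) (hi l) (hD k).1 (hD l).1
  have itail : IntegrableOn (fun x => (Ioi (R : ℝ)).indicator id (ρ x)) (cube n) := by
    refine Integrable.mono hρi ((measurable_id.indicator measurableSet_Ioi).comp_aemeasurable
      hρi.1.aemeasurable).aestronglyMeasurable (Eventually.of_forall fun x => ?_)
    unfold indicator; split_ifs <;> simp
  have hdi : IntegrableOn (fun x => (integrand L a s q x (D k x) + integrand L a s q x (D l x)) / 2
      - integrand L a s q x ((1 / 2 : ℝ) • (D k x + D l x))) (cube n) :=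
    (((hi k).add (hi l)).div_const 2).sub hm
  -- Both energies are within `ε₁` of `I` and the midpoint cannot have energy below `I`, so the
  -- integrated defect is at most `ε₁`.
  have hdv : ∫ x in cube n, ((integrand L a s q x (D k x) + integrand L a s q x (D l x)) / 2
      - integrand L a s q x ((1 / 2 : ℝ) • (D k x + D l x))) ≤ ε₁ := by
    have e1 := integral_sub (μ := volume.restrict (cube n)) (((hi k).add (hi l)).div_const 2) hm
    have e2 := integral_add (μ := volume.restrict (cube n)) (hi k) (hi l)
    simp only [Pi.add_apply] at e1
    rw [e1, integral_div, e2]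
    linarith [hmid k l, min_le_left ε₁ 1]
  have hbound : ∀ᵐ x ∂volume.restrict (cube n), ‖D k x - D l x‖ ≤
      2 * η * (a x * ‖D k x‖ ^ q + a x * ‖D l x‖ ^ q)
      + 2 * (Ioi (R : ℝ)).indicator id (ρ x) + δ
      + 2 * R / g * ((integrand L a s q x (D k x) + integrand L a s q x (D l x)) / 2
      - integrand L a s q x ((1 / 2 : ℝ) • (D k x + D l x))) := by
    filter_upwards [hae, ae_restrict_mem isOpen_cube.measurableSet] with x hx hxc
    have h1 := norm_sub_le_energy_add_tail_add_defect hLc hq hη0 (Nat.cast_nonneg R) hδ0 hg0 hgap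
      hx (D k x) (D l x)
    have h2 := defect_le_integrand_defect (L := L) (s := s) hq.le (ha0 x hxc) (D k x) (D l x)
    have h3 : 0 ≤ 2 * (R : ℝ) / g := by positivity
    linarith [mul_le_mul_of_nonneg_left h2 h3]
  have i1 : IntegrableOn (fun x => 2 * η * (a x * ‖D k x‖ ^ q + a x * ‖D l x‖ ^ q)) (cube n) :=
    (ik.add il).const_mul _
  have i2 : IntegrableOn (fun x => 2 * (Ioi (R : ℝ)).indicator id (ρ x)) (cube n) :=
    itail.const_mul _
  have i3 := hdi.const_mul (2 * R / g)
  have hδi : IntegrableOn (fun _ : E n => δ) (cube n) := integrable_const _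
  refine (integral_mono_ae (memLp_one_iff_integrable.1 ((hD k).sub (hD l))).norm
    (((i1.add i2).add hδi).add i3) hbound).trans ?_
  have e1 := integral_add (μ := volume.restrict (cube n)) ((i1.add i2).add hδi) i3
  have e2 := integral_add (μ := volume.restrict (cube n)) (i1.add i2) hδi
  have e3 := integral_add (μ := volume.restrict (cube n)) i1 i2
  have e4 := integral_add (μ := volume.restrict (cube n)) ik il
  simp only [Pi.add_apply] at e1 e2 e3 e4
  simp only [Pi.add_apply]
  rw [e1, e2, e3, integral_const_mul, integral_const_mul, integral_const_mul, e4]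
  have hcV : c * V ≤ |c| * V := by gcongr; exact le_abs_self c
  have t1 : 2 * η * ((∫ x in cube n, a x * ‖D k x‖ ^ q) + ∫ x in cube n, a x * ‖D l x‖ ^ q)
      ≤ η₀ / 4 := by
    have : (∫ x in cube n, a x * ‖D k x‖ ^ q) + ∫ x in cube n, a x * ‖D l x‖ ^ q ≤ 2 * K := by
      linarith [min_le_right ε₁ 1, le_abs_self I]
    calc _ ≤ 2 * η * (2 * K) := by gcongr
      _ = η₀ / 4 := by rw [hη]; field_simp; ring
  have t3 : ∫ _x in cube n, δ ≤ η₀ / 4 := by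
    rw [setIntegral_const, smul_eq_mul, ← hV, hδ, mul_div_assoc', div_le_div_iff₀ (by positivity)
      (by norm_num)]
    nlinarith
  have t4 : 2 * R / g * ∫ x in cube n, ((integrand L a s q x (D k x)
      + integrand L a s q x (D l x)) / 2
      - integrand L a s q x ((1 / 2 : ℝ) • (D k x + D l x))) ≤ η₀ / 4 := by
    calc _ ≤ 2 * R / g * ε₁ := by gcongr
      _ = η₀ / 4 * (R / (R + 1)) := by rw [hε₁]; field_simp; ring
      _ ≤ η₀ / 4 * 1 := by
        gcongr
        rw [div_le_one (by positivity)]; linarith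
      _ = η₀ / 4 := mul_one _
  linarith

end Existence

/-! ### Existence of minimizers by the direct method -/

section Minimizer

variable {n : ℕ}

theorem exists_tendsto_lintegral_of_cauchy {X F : Type*} [MeasurableSpace X] {μ : Measure X}
    [NormedAddCommGroup F] [CompleteSpace F] {f : ℕ → X → F} (hf : ∀ k, MemLp (f k) 1 μ)
    (hC : ∀ η : ℝ≥0∞, η ≠ 0 → ∃ N, ∀ k ≥ N, ∀ l ≥ N, ∫⁻ x, ‖f k x - f l x‖ₑ ∂μ ≤ η) :
    ∃ g, MemLp g 1 μ ∧ Tendsto (fun k => ∫⁻ x, ‖f k x - g x‖ₑ ∂μ) atTop (𝓝 0) := by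
  have hcs : CauchySeq fun k => (hf k).toLp (f k) := by
    refine EMetric.cauchySeq_iff.2 fun η hη => ?_
    obtain ⟨η', h0, h1⟩ := exists_between hη
    obtain ⟨N, hN⟩ := hC η' h0.ne'
    refine ⟨N, fun k hk l hl => ?_⟩
    rw [Lp.edist_toLp_toLp, eLpNorm_one_eq_lintegral_enorm]
    exact (hN k hk l hl).trans_lt h1
  obtain ⟨g, hg⟩ := cauchySeq_tendsto_of_complete hcs
  refine ⟨g, Lp.memLp g, ?_⟩
  have h1 := (tendsto_iff_edist_tendsto_0).1 hg
  refine h1.congr fun k => ?_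
  rw [Lp.edist_def, eLpNorm_one_eq_lintegral_enorm]
  refine lintegral_congr_ae ?_
  filter_upwards [(hf k).coeFn_toLp] with x hx
  simp [hx]

/-- The functions `u₀ + φ` with `φ ∈ C_c^∞(Ω)`. -/
abbrev shiftedTestFunctions (Ω : Set (E n)) (u₀ : E n → ℝ) : Set (E n → ℝ) :=
  {ψ | ∃ φ, IsTestFunction Ω φ ∧ ψ = fun x => u₀ x + φ x}

theorem contDiff_of_mem_shiftedTestFunctions {Ω : Set (E n)} {u₀ : E n → ℝ}
    (hu₀ : ContDiff ℝ 1 u₀) {ψ : E n → ℝ} (hψ : ψ ∈ shiftedTestFunctions Ω u₀) :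
    ContDiff ℝ 1 ψ := by
  obtain ⟨φ, hφ, rfl⟩ := hψ
  exact hu₀.add hφ.contDiff_one

variable {L a : E n → ℝ} {s q : ℝ} {u₀ : E n → ℝ}

-- `energy` uses a chosen weak gradient. By uniqueness up to null sets it may be computed with the
-- gradient produced by any `L¹` approximation.
open Classical in
theorem energy_eq (hu₀ : ContDiff ℝ 1 u₀) {w : E n → ℝ} {D : E n → E n}
    (h : IsL1Limit (shiftedTestFunctions (cube n) u₀) (cube n) w D) :
    energy L a s q (cube n) w = if IntegrableOn (fun x => integrand L a s q x (D x)) (cube n) then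
      ((∫ x in cube n, integrand L a s q x (D x) : ℝ) : EReal) else ⊤ := by
  have hw := h.hasWeakGradient fun ψ hψ => contDiff_of_mem_shiftedTestFunctions hu₀ hψ
  have hae := (weakGradient_spec hw).ae_eq isOpen_cube hw
  have h1 : (fun x => integrand L a s q x (weakGradient (cube n) w x))
      =ᵐ[volume.restrict (cube n)] fun x => integrand L a s q x (D x) := by
    filter_upwards [hae] with x hx
    rw [hx]
  unfold energy
  rw [integral_congr_ae h1]
  congr 1
  exact propext (integrable_congr h1)

/-- Existence of a minimizer in the Dirichlet class, without any superlinear growth of `L`: the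
weight `a` alone makes gradients of bounded energy equiintegrable. -/
theorem exists_isDirichletMinimizer (hn : 2 ≤ n) (hL : Continuous L)
    (hLc : StrictMidpointConvex L) {c : ℝ}
    (hLb : ∀ z, -c ≤ L z) (ha : Continuous a) (ha0 : ∀ x ∈ cube n, 0 ≤ a x) (hq : 1 < q)
    (hae : ∀ᵐ x ∂volume.restrict (cube n), 0 < a x)
    (haw : IntegrableOn (fun x => a x ^ (-1 / (q - 1))) (cube n))
    (hu₀ : ContDiff ℝ 1 u₀) {v : E n → ℝ} {G : E n → E n}
    (hv : IsL1Limit (testFunctions (cube n)) (cube n) v G)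
    (hfin : IntegrableOn (fun x => integrand L a s q x (gradient u₀ x + G x)) (cube n)) :
    ∃ u D, Measurable u ∧ Measurable D ∧
      IsL1Limit (shiftedTestFunctions (cube n) u₀) (cube n) u D ∧
      IsDirichletMinimizer L a s q (cube n) u₀ u ∧
      IntegrableOn (fun x => integrand L a s q x (D x)) (cube n) ∧
      ∫ x in cube n, integrand L a s q x (D x)
        ≤ ∫ x in cube n, integrand L a s q x (gradient u₀ x + G x) := by
  set μ := volume.restrict (cube n) with hμ
  have hq0 : 0 < q := by linarith
  have hgu₀ : MemLp (gradient u₀) 1 μ := memLp_one_cube_of_continuous (continuous_gradient hu₀)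
  have hmu₀ : MemLp u₀ 1 μ := memLp_one_cube_of_continuous hu₀.continuous
  set J : (E n → E n) → ℝ :=
    fun G => ∫ x in cube n, integrand L a s q x (gradient u₀ x + G x) with hJ
  -- The minimization is carried out over gradients of `W₀^{1,1}` functions, which form a vector
  -- space. The sublevel of finite energy is closed under midpoints.
  set adm : Set (E n → E n) := {G | (∃ v, IsL1Limit (testFunctions (cube n)) (cube n) v G) ∧
    IntegrableOn (fun x => integrand L a s q x (gradient u₀ x + G x)) (cube n)} with hadm
  have hGadm : G ∈ adm := ⟨⟨v, hv⟩, hfin⟩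
  have hlow : ∀ G ∈ adm, -(c * volume.real (cube n)) ≤ J G := by
    rintro G ⟨⟨v, hv⟩, hi⟩
    have := (integrable_mul_norm_rpow hLb ha ha0 hq0 hi (hgu₀.1.add hv.2.1.1)).2
    have h0 : 0 ≤ ∫ x in cube n, a x * ‖gradient u₀ x + G x‖ ^ q :=
      setIntegral_nonneg isOpen_cube.measurableSet fun x hx =>
        mul_nonneg (ha0 x hx) (Real.rpow_nonneg (norm_nonneg _) _)
    simp only [hJ]
    linarith
  set I := sInf (J '' adm) with hI
  have hbdd : BddBelow (J '' adm) :=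
    ⟨_, by rintro _ ⟨G, hG, rfl⟩; exact hlow G hG⟩
  have hIle : ∀ G ∈ adm, I ≤ J G := fun G hG => csInf_le hbdd ⟨G, hG, rfl⟩
  have hseq : ∀ k : ℕ, ∃ G ∈ adm, J G < I + 1 / ((k : ℝ) + 1) := by
    intro k
    obtain ⟨_, ⟨G, hG, rfl⟩, h⟩ := exists_lt_of_csInf_lt (s := J '' adm) ⟨_, G, hGadm, rfl⟩
      (show I < I + 1 / ((k : ℝ) + 1) by linarith [Nat.one_div_pos_of_nat (α := ℝ) (n := k)])
    exact ⟨G, hG, h⟩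
  choose H hH hHJ using hseq
  choose V hV using fun k => (hH k).1
  have hJt : Tendsto (fun k => J (H k)) atTop (𝓝 I) := by
    refine tendsto_of_tendsto_of_tendsto_of_le_of_le tendsto_const_nhds ?_
      (fun k => hIle _ (hH k)) (fun k => (hHJ k).le)
    simpa using (tendsto_const_nhds (x := I)).add
      (tendsto_one_div_add_atTop_nhds_zero_nat (𝕜 := ℝ))
  have hDm : ∀ k, MemLp (fun x => gradient u₀ x + H k x) 1 μ := fun k => hgu₀.add (hV k).2.1
  have hmid : ∀ k l, I ≤ ∫ x in cube n, integrand L a s q x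
      ((1 / 2 : ℝ) • ((gradient u₀ x + H k x) + (gradient u₀ x + H l x))) := by
    intro k l
    have e : ∀ x, (1 / 2 : ℝ) • ((gradient u₀ x + H k x) + (gradient u₀ x + H l x))
        = gradient u₀ x + ((1 / 2 : ℝ) • H k x + (1 / 2 : ℝ) • H l x) := fun x => by module
    have hm := integrable_integrand_midpoint hL hLc hLb ha ha0 hq.le (hH k).2 (hH l).2
      (hDm k).1 (hDm l).1
    simp_rw [e] at hm ⊢
    exact hIle _ ⟨⟨_, (hV k).linear_comb (hV l) (1 / 2) (1 / 2)⟩, hm⟩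
  have hHc : ∀ η : ℝ≥0∞, η ≠ 0 → ∃ N, ∀ k ≥ N, ∀ l ≥ N, ∫⁻ x, ‖H k x - H l x‖ₑ ∂μ ≤ η := by
    intro η hη
    obtain ⟨η', h0, h1⟩ := ENNReal.lt_iff_exists_nnreal_btwn.1 (pos_iff_ne_zero.2 hη)
    have hη' : 0 < (η' : ℝ) := by exact_mod_cast h0
    obtain ⟨N, hN⟩ := exists_integral_norm_sub_le hL hLc hLb ha ha0 hq hae haw hDm
      (fun k => (hH k).2) hmid hJt hη'
    refine ⟨N, fun k hk l hl => le_trans ?_ h1.le⟩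
    have := hN k hk l hl
    simp only [add_sub_add_left_eq_sub] at this
    have h2 := ofReal_integral_norm_eq_lintegral_enorm (μ := μ)
      (memLp_one_iff_integrable.1 ((hV k).2.1.sub (hV l).2.1))
    simp only [Pi.sub_apply] at h2
    rw [← h2]
    exact (ENNReal.ofReal_le_ofReal this).trans (by simp)
  obtain ⟨C, hC⟩ := exists_poincare hn
  -- The Poincaré inequality transfers the Cauchy property from the gradients to the functions.
  have hVc : ∀ η : ℝ≥0∞, η ≠ 0 → ∃ N, ∀ k ≥ N, ∀ l ≥ N, ∫⁻ x, ‖V k x - V l x‖ₑ ∂μ ≤ η := by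
    intro η hη
    have hC1 : (C : ℝ≥0∞) + 1 ≠ ⊤ := by simp
    obtain ⟨N, hN⟩ := hHc (η / (C + 1)) (by simp [ENNReal.div_eq_zero_iff, hη])
    refine ⟨N, fun k hk l hl => ?_⟩
    have := hC _ _ ((hV k).linear_comb (hV l) 1 (-1))
    simp only [one_mul, neg_mul, ← sub_eq_add_neg, one_smul, neg_smul] at this
    calc _ ≤ C * ∫⁻ x, ‖H k x - H l x‖ₑ ∂μ := this
      _ ≤ (C + 1) * (η / (C + 1)) := by
        gcongr
        · exact le_self_add
        · exact hN k hk l hl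
      _ = η := ENNReal.mul_div_cancel (by simp) hC1
  obtain ⟨G', hG'm, hG't⟩ := exists_tendsto_lintegral_of_cauchy (fun k => (hV k).2.1) hHc
  obtain ⟨v', hv'm, hv't⟩ := exists_tendsto_lintegral_of_cauchy (fun k => (hV k).1) hVc
  have hlim : IsL1Limit (testFunctions (cube n)) (cube n) v' G' := by
    refine IsL1Limit.of_approx hv'm hG'm fun δ hδ => ?_
    have hpos := pos_iff_ne_zero.2 hδ
    obtain ⟨k, k1, k2⟩ :=
      ((hv't.eventually_le_const hpos).and (hG't.eventually_le_const hpos)).exists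
    refine ⟨V k, H k, hV k, ?_, ?_⟩
    · simpa only [enorm_sub_rev (v' _)] using k1
    · simpa only [enorm_sub_rev (G' _)] using k2
  have hmeas : TendstoInMeasure μ H atTop G' := by
    refine tendstoInMeasure_of_tendsto_eLpNorm one_ne_zero (fun k => (hV k).2.1.1) hG'm.1 ?_
    simp only [eLpNorm_one_eq_lintegral_enorm, Pi.sub_apply]
    exact hG't
  obtain ⟨ns, hns, hnst⟩ := hmeas.exists_seq_tendsto_ae
  have hmG' : AEStronglyMeasurable (fun x => gradient u₀ x + G' x) μ := hgu₀.1.add hG'm.1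
  set F : (E n → E n) → E n → ℝ≥0∞ :=
    fun G x => ENNReal.ofReal (integrand L a s q x (gradient u₀ x + G x) + c) with hF
  have hnn : ∀ G : E n → E n, ∀ x ∈ cube n,
      0 ≤ integrand L a s q x (gradient u₀ x + G x) + c := fun G x hx =>
    (mul_nonneg (ha0 x hx) (Real.rpow_nonneg (norm_nonneg _) _)).trans
      (mul_norm_rpow_le_integrand hLb hq0 (ha0 x hx) _)
  have hnn' : ∀ G : E n → E n, 0 ≤ᵐ[μ] fun x =>
      integrand L a s q x (gradient u₀ x + G x) + c := fun G =>
    (ae_restrict_iff' isOpen_cube.measurableSet).2 (Eventually.of_forall fun x hx => hnn G x hx)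
  have hintg : ∀ G, IntegrableOn (fun x => integrand L a s q x (gradient u₀ x + G x)) (cube n) →
      ∫⁻ x, F G x ∂μ = ENNReal.ofReal (J G + c * volume.real (cube n)) := by
    intro G hG
    have hGc : Integrable (fun x => integrand L a s q x (gradient u₀ x + G x) + c) μ :=
      Integrable.add hG (integrable_const c)
    rw [hF, ← ofReal_integral_eq_lintegral_ofReal hGc (hnn' G)]
    rw [integral_add hG (integrable_const c)]
    simp [hJ, mul_comm]
  have hFm : ∀ G : E n → E n, AEStronglyMeasurable (fun x => gradient u₀ x + G x) μ →
      AEMeasurable (F G) μ := fun G hG =>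
    ((aestronglyMeasurable_integrand hL ha hq0 hG).aemeasurable.add_const c).ennreal_ofReal
  -- Strong `L¹` convergence gives almost everywhere convergence of a subsequence of gradients, so
  -- Fatou's lemma for the integrand shifted by `c ≥ -inf L` replaces weak lower semicontinuity.
  have hfatou : ∫⁻ x, F G' x ∂μ ≤ ENNReal.ofReal (I + c * volume.real (cube n)) := by
    calc ∫⁻ x, F G' x ∂μ = ∫⁻ x, liminf (fun k => F (H (ns k)) x) atTop ∂μ := by
          refine lintegral_congr_ae ?_
          filter_upwards [hnst] with x hx
          refine (Tendsto.liminf_eq ?_).symm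
          refine ENNReal.tendsto_ofReal ?_
          have hc := (continuous_uncurry_integrand (s := s) hL ha hq0).tendsto
            (x, gradient u₀ x + G' x)
          have := hc.comp ((tendsto_const_nhds (x := x)).prodMk_nhds (hx.const_add (gradient u₀ x)))
          exact this.add_const c
      _ ≤ liminf (fun k => ∫⁻ x, F (H (ns k)) x ∂μ) atTop :=
          lintegral_liminf_le' fun k => hFm _ (hDm _).1
      _ = ENNReal.ofReal (I + c * volume.real (cube n)) := by
          refine Tendsto.liminf_eq ?_
          simp_rw [fun k => hintg (H (ns k)) (hH _).2]
          exact ENNReal.tendsto_ofReal ((hJt.comp hns.tendsto_atTop).add_const _)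
  have hi' : IntegrableOn (fun x => integrand L a s q x (gradient u₀ x + G' x)) (cube n) := by
    have h1 : Integrable (fun x => integrand L a s q x (gradient u₀ x + G' x) + c) μ := by
      refine ⟨(aestronglyMeasurable_integrand hL ha hq0 hmG').add_const c, ?_⟩
      rw [hasFiniteIntegral_iff_ofReal (hnn' G')]
      exact hfatou.trans_lt ENNReal.ofReal_lt_top
    refine (h1.sub (integrable_const c)).congr (Eventually.of_forall fun x => ?_)
    simp
  have hG'adm : G' ∈ adm := ⟨⟨v', hlim⟩, hi'⟩
  have hJG' : J G' = I := by
    refine le_antisymm ?_ (hIle _ hG'adm)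
    rw [hintg G' hi'] at hfatou
    have h0 : 0 ≤ I + c * volume.real (cube n) := by
      linarith [le_csInf (s := J '' adm) ⟨_, G, hGadm, rfl⟩
        (by rintro _ ⟨G, hG, rfl⟩; exact hlow G hG)]
    have := (ENNReal.ofReal_le_ofReal_iff h0).1 hfatou
    linarith
  have hsh := hlim.const_add hu₀ hmu₀ hgu₀
  -- Genuinely measurable representatives are taken because `u` and `D` will be integrated along
  -- rays, through compositions with maps into the cube.
  obtain ⟨u, hum, hu⟩ := hsh.1.1
  obtain ⟨D, hDm', hD⟩ := hsh.2.1.1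
  have hsh' := hsh.congr hu hD
  have hDint : IntegrableOn (fun x => integrand L a s q x (D x)) (cube n) :=
    hi'.congr (by filter_upwards [hD] with x hx; rw [hx])
  have hDJ : ∫ x in cube n, integrand L a s q x (D x) = I := by
    rw [← hJG']
    exact integral_congr_ae (by filter_upwards [hD] with x hx; rw [hx])
  refine ⟨u, D, hum.measurable, hDm'.measurable, hsh', ⟨?_, ?_, ?_⟩, hDint, ?_⟩
  · refine memW011_iff.2 ⟨G', hlim.congr ?_ EventuallyEq.rfl⟩
    filter_upwards [hu] with x hx
    simp [← hx]
  · rw [energy_eq hu₀ hsh', if_pos hDint]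
    exact EReal.coe_ne_top _
  · intro w hw
    obtain ⟨Gw, hGw⟩ := memW011_iff.1 hw
    have hw' := hGw.const_add hu₀ hmu₀ hgu₀
    simp only [add_sub_cancel] at hw'
    rw [energy_eq hu₀ hsh', if_pos hDint, energy_eq hu₀ hw']
    split_ifs with hiw
    · rw [hDJ]
      exact EReal.coe_le_coe_iff.2 (hIle Gw ⟨⟨_, hGw⟩, hiw⟩)
    · exact le_top
  · rw [hDJ]
    exact hIle G hGadm

end Minimizer

/-! ### Convexity and growth of `L` -/

section Integrand

variable {n : ℕ} {Λ μ : ℝ} {g : ℝ → ℝ} {L : E n → ℝ}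

theorem strictMono_of_deriv_pos_of_ne {f : ℝ → ℝ} (hf : Continuous f) (t₀ : ℝ)
    (h : ∀ t, t ≠ t₀ → 0 < deriv f t) : StrictMono f := by
  have h1 : StrictMonoOn f (Iic t₀) := by
    refine strictMonoOn_of_deriv_pos (convex_Iic _) hf.continuousOn fun t ht => h t ?_
    rw [interior_Iic] at ht; exact ne_of_lt ht
  have h2 : StrictMonoOn f (Ici t₀) := by
    refine strictMonoOn_of_deriv_pos (convex_Ici _) hf.continuousOn fun t ht => h t ?_
    rw [interior_Ici] at ht; exact ne_of_gt ht
  exact h1.Iic_union_Ici h2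

/-- `L` need not be twice differentiable at the origin, but a line meets the origin at most once.
Along it the derivative is continuous and strictly increasing on either side of that point, hence
strictly increasing. -/
theorem IsAdmissibleIntegrand.strictMidpointConvex (hΛ : 0 < Λ)
    (hL : IsAdmissibleIntegrand Λ μ g L) : StrictMidpointConvex L := by
  intro z₁ z₂ hne
  set ξ := z₂ - z₁ with hξ
  have hξ0 : ξ ≠ 0 := sub_ne_zero.2 hne.symm
  set γ : ℝ → E n := fun t => z₁ + t • ξ with hγ
  have hγd : ∀ t, HasDerivAt γ ξ t := fun t => by
    have := ((hasDerivAt_id t).smul_const ξ).const_add z₁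
    rwa [one_smul] at this
  have hγc : Continuous γ := by fun_prop
  set f : ℝ → ℝ := fun t => L (γ t) with hf
  set f' : ℝ → ℝ := fun t => fderiv ℝ L (γ t) ξ with hf'
  have hfd : ∀ t, HasDerivAt f (f' t) t := fun t =>
    ((hL.contDiff_one.differentiable one_ne_zero (γ t)).hasFDerivAt).comp_hasDerivAt t (hγd t)
  have hf'c : Continuous f' :=
    ((hL.contDiff_one.continuous_fderiv one_ne_zero).comp hγc).clm_apply continuous_const
  have hpos : ∀ t, γ t ≠ 0 → 0 < deriv f' t := by
    intro t ht
    have h2 : ContDiffAt ℝ 2 L (γ t) :=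
      hL.contDiffOn_two.contDiffAt (isOpen_compl_singleton.mem_nhds ht)
    have h3 : DifferentiableAt ℝ (fderiv ℝ L) (γ t) :=
      (h2.fderiv_right (m := 1) (by norm_num)).differentiableAt one_ne_zero
    have h4 : HasDerivAt (fun t => fderiv ℝ L (γ t)) (fderiv ℝ (fderiv ℝ L) (γ t) ξ) t :=
      h3.hasFDerivAt.comp_hasDerivAt t (hγd t)
    have h5 : HasDerivAt f' (fderiv ℝ (fderiv ℝ L) (γ t) ξ ξ) t := by
      simpa using h4.clm_apply (hasDerivAt_const t ξ)
    rw [h5.deriv]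
    refine lt_of_lt_of_le ?_ (hL.lower_ellipticity (γ t) ht ξ)
    have : 0 < ‖ξ‖ := norm_pos_iff.2 hξ0
    positivity
  have hmono : StrictMono f' := by
    by_cases hex : ∃ t₀, γ t₀ = 0
    · obtain ⟨t₀, ht₀⟩ := hex
      refine strictMono_of_deriv_pos_of_ne hf'c t₀ fun t ht => hpos t fun h0 => ht ?_
      have : (t - t₀) • ξ = 0 := by
        have : γ t - γ t₀ = (t - t₀) • ξ := by simp only [hγ]; module
        rw [← this, h0, ht₀, sub_zero]
      exact sub_eq_zero.1 ((smul_eq_zero.1 this).resolve_right hξ0)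
    · push Not at hex
      exact strictMono_of_deriv_pos_of_ne hf'c 0 fun t _ => hpos t (hex t)
  have hder : deriv f = f' := funext fun t => (hfd t).deriv
  have hconv : StrictConvexOn ℝ univ f := by
    refine StrictMono.strictConvexOn_univ_of_deriv ?_ (by rwa [hder])
    exact hL.contDiff_one.continuous.comp hγc
  have hhalf : (0 : ℝ) < 1 / 2 := by norm_num
  have := hconv.2 (mem_univ 0) (mem_univ 1) zero_ne_one hhalf hhalf (by norm_num)
  have e0 : γ 0 = z₁ := by simp [hγ]
  have e1 : γ 1 = z₂ := by simp [hγ, hξ]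
  have e2 : γ (1 / 2) = (1 / 2 : ℝ) • (z₁ + z₂) := by simp only [hγ, hξ]; module
  simp only [smul_eq_mul, mul_zero, zero_add, mul_one] at this
  simp only [hf, e0, e1, e2] at this
  linarith

theorem exists_forall_nonneg_of_le (hg : IsNearlyLinear g ∨ ∀ t : ℝ, 0 ≤ t → g t = 1) :
    ∃ T : ℝ, ∀ t, 0 ≤ t → T ≤ t → 0 ≤ g t := by
  rcases hg with hg | hg
  · have := hg.unbounded
    rw [not_bddAbove_iff] at this
    obtain ⟨_, ⟨T, hT, rfl⟩, h⟩ := this 0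
    exact ⟨T, fun t ht hTt => h.le.trans (hg.monotoneOn hT ht hTt)⟩
  · exact ⟨0, fun t ht _ => by rw [hg t ht]; norm_num⟩

/-- `g` may be negative near `0`, so the growth condition is used only for large `|z|`, where `g ≥
0`; compactness handles the remaining ball. -/
theorem IsAdmissibleIntegrand.exists_lower_bound (hΛ : 0 < Λ)
    (hg : IsNearlyLinear g ∨ ∀ t : ℝ, 0 ≤ t → g t = 1) (hL : IsAdmissibleIntegrand Λ μ g L) :
    ∃ c : ℝ, ∀ z, -c ≤ L z := by
  obtain ⟨T, hT⟩ := exists_forall_nonneg_of_le hg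
  obtain ⟨C, hC⟩ := (isCompact_closedBall (0 : E n) T).exists_bound_of_continuousOn
    hL.contDiff_one.continuous.continuousOn
  refine ⟨max |C| |L 0|, fun z => ?_⟩
  by_cases hz : z = 0
  · subst hz
    linarith [neg_abs_le (L 0), le_max_right |C| |L 0|]
  · rcases le_total ‖z‖ T with h | h
    · have := hC z (by simpa using h)
      rw [Real.norm_eq_abs] at this
      linarith [neg_abs_le (L z), le_max_left |C| |L 0|, le_abs_self C]
    · have h1 := hT ‖z‖ (norm_nonneg _) h
      have h2 := hL.lower_growth z hz
      have : 0 ≤ 1 / Λ * (‖z‖ * g ‖z‖) := by positivity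
      linarith [le_max_left |C| |L 0|, abs_nonneg C]

theorem exists_growth_bound (hg : IsNearlyLinear g ∨ ∀ t : ℝ, 0 ≤ t → g t = 1) {δ : ℝ}
    (hδ : 0 < δ) : ∃ c : ℝ, 0 ≤ c ∧ ∀ t, 0 ≤ t → g t ≤ c * (1 + t ^ δ) := by
  rcases hg with hg | hg
  · obtain ⟨c, hc⟩ := hg.growth δ hδ
    refine ⟨|c|, abs_nonneg _, fun t ht => (hc t ht).trans ?_⟩
    gcongr
    exact le_abs_self c
  · refine ⟨1, zero_le_one, fun t ht => ?_⟩
    rw [hg t ht]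
    have := Real.rpow_nonneg ht δ
    linarith

/-- Since `g` grows more slowly than every positive power, `L` is dominated by every power above
one. Only this power bound is used to estimate the competitor. -/
theorem IsAdmissibleIntegrand.exists_upper_bound (hΛ : 0 < Λ)
    (hg : IsNearlyLinear g ∨ ∀ t : ℝ, 0 ≤ t → g t = 1) (hL : IsAdmissibleIntegrand Λ μ g L)
    {δ : ℝ} (hδ : 0 < δ) :
    ∃ c : ℝ, 0 ≤ c ∧ ∀ z, L z ≤ c * (1 + ‖z‖ ^ (1 + δ)) := by
  obtain ⟨c, hc0, hc⟩ := exists_growth_bound hg hδ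
  refine ⟨2 * Λ * c + Λ + |L 0|, by positivity, fun z => ?_⟩
  set t := ‖z‖ with ht
  have ht0 : 0 ≤ t := norm_nonneg z
  have hp : 0 ≤ t ^ (1 + δ) := Real.rpow_nonneg ht0 _
  by_cases hz : z = 0
  · subst hz
    have h1 : 0 ≤ 2 * Λ * c + Λ := by positivity
    have h2 := le_abs_self (L 0)
    nlinarith [abs_nonneg (L 0)]
  · have h1 := hL.upper_growth z hz
    have h2 : t * t ^ δ = t ^ (1 + δ) := by
      rw [Real.rpow_add (norm_pos_iff.2 hz), Real.rpow_one]
    have h3 : t ≤ 1 + t ^ (1 + δ) := by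
      rcases le_total t 1 with h | h
      · linarith
      · have := Real.rpow_le_rpow_of_exponent_le h (show (1 : ℝ) ≤ 1 + δ by linarith)
        rw [Real.rpow_one] at this
        linarith
    have h4 : t * g t ≤ c * (2 * (1 + t ^ (1 + δ))) := by
      calc t * g t ≤ t * (c * (1 + t ^ δ)) := by gcongr; exact hc t ht0
        _ = c * (t + t * t ^ δ) := by ring
        _ ≤ c * (2 * (1 + t ^ (1 + δ))) := by
          rw [h2]; gcongr; linarith
    have h5 : Λ * (t * g t) ≤ Λ * (c * (2 * (1 + t ^ (1 + δ)))) := by gcongr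
    nlinarith [abs_nonneg (L 0), mul_nonneg (abs_nonneg (L 0)) hp, mul_nonneg hΛ.le hp]

end Integrand

/-! ### The Cantor set, its parametrization and cutoffs to its generations -/

section Cantor

/-- The contraction ratio `lam` of a two-branch Cantor set in `[-1/2, 1/2]`, and the relative
width `w` of the neighbourhoods of its generations. -/
structure CantorScale where
  lam : ℝ
  w : ℝ
  lam_pos : 0 < lam
  lam_lt : lam < 1 / 2
  w_pos : 0 < w
  w_lt : w < 1 / 4
  sep : 2 * lam * (1 + w) < 1

namespace CantorScale

variable (S : CantorScale)

/-- The centre of the right branch. -/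
def ctr : ℝ := (1 - S.lam) / 2

/-- Half the distance between neighbourhoods of the two branches. -/
def gap : ℝ := S.ctr - S.lam * (1 / 2 + S.w)

/-- `sep` says exactly that the neighbourhoods of half-width `lam * (1/2 + w)` about `±ctr` are
disjoint. -/
theorem gap_pos : 0 < S.gap := by
  have := S.sep
  unfold gap ctr
  linarith

/-- The doubling map. -/
def dbl (x : ℝ) : ℝ := Int.fract (2 * x)

/-- The leading binary digit, normalized to `∓1/2`. -/
def dig (x : ℝ) : ℝ := if x < 1 / 2 then -1 / 2 else 1 / 2

theorem abs_dig (x : ℝ) : |dig x| = 1 / 2 := by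
  unfold dig; split_ifs <;> norm_num [abs_div, abs_neg]

theorem dbl_mem (x : ℝ) : dbl x ∈ Ico (0 : ℝ) 1 := ⟨Int.fract_nonneg _, Int.fract_lt_one _⟩

theorem dbl_of_lt {x : ℝ} (hx : x ∈ Ico (0 : ℝ) 1) (h : x < 1 / 2) : dbl x = 2 * x := by
  unfold dbl
  rw [Int.fract_eq_self]
  exact ⟨by linarith [hx.1], by linarith⟩

theorem dbl_of_ge {x : ℝ} (hx : x ∈ Ico (0 : ℝ) 1) (h : 1 / 2 ≤ x) : dbl x = 2 * x - 1 := by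
  unfold dbl
  rw [Int.fract_eq_iff]
  exact ⟨by linarith, by linarith [hx.2], 1, by simp⟩

/-- The parametrization of the Cantor set by binary digits. -/
def phi (x : ℝ) : ℝ := ∑' k : ℕ, (1 - S.lam) * S.lam ^ k * dig (dbl^[k] x)

theorem summable_phi (x : ℝ) :
    Summable fun k : ℕ => (1 - S.lam) * S.lam ^ k * dig (dbl^[k] x) := by
  have hg : Summable fun k : ℕ => (1 - S.lam) * S.lam ^ k * (1 / 2) :=
    ((summable_geometric_of_lt_one S.lam_pos.le (by linarith [S.lam_lt])).mul_left _).mul_right _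
  refine Summable.of_norm_bounded hg fun k => ?_
  have h1 : 0 ≤ 1 - S.lam := by linarith [S.lam_lt]
  have h2 := S.lam_pos
  rw [norm_mul, Real.norm_eq_abs, Real.norm_eq_abs, abs_dig, abs_of_nonneg (by positivity)]

theorem phi_eq (x : ℝ) : S.phi x = (1 - S.lam) * dig x + S.lam * S.phi (dbl x) := by
  unfold phi
  rw [(S.summable_phi x).tsum_eq_zero_add, ← tsum_mul_left]
  congr 1
  · simp
  · refine tsum_congr fun k => ?_
    rw [Function.iterate_succ_apply, pow_succ]
    ring

theorem phi_of_lt {x : ℝ} (h : x < 1 / 2) : S.phi x = -S.ctr + S.lam * S.phi (dbl x) := by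
  rw [phi_eq, dig, if_pos h, ctr]; ring

theorem phi_of_ge {x : ℝ} (h : 1 / 2 ≤ x) : S.phi x = S.ctr + S.lam * S.phi (dbl x) := by
  rw [phi_eq, dig, if_neg (not_lt.2 h), ctr]; ring

theorem abs_phi_le (x : ℝ) : |S.phi x| ≤ 1 / 2 := by
  have h1 : 0 < 1 - S.lam := by linarith [S.lam_lt]
  have h2 := S.lam_pos
  have hg := ((hasSum_geometric_of_lt_one S.lam_pos.le (by linarith [S.lam_lt])).mul_left
    (1 - S.lam)).mul_right (1 / 2)
  rw [mul_inv_cancel₀ h1.ne', one_mul] at hg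
  rw [← Real.norm_eq_abs]
  refine tsum_of_norm_bounded hg fun k => ?_
  rw [norm_mul, Real.norm_eq_abs, Real.norm_eq_abs, abs_dig, abs_of_nonneg (by positivity)]

theorem measurable_phi : Measurable S.phi := by
  have hd : Measurable dbl := by
    unfold dbl; exact (measurable_id.const_mul 2).fract
  have hdig : Measurable dig :=
    Measurable.ite measurableSet_Iio measurable_const measurable_const
  refine measurable_of_tendsto_metrizable
    (f := fun N x => ∑ k ∈ Finset.range N, (1 - S.lam) * S.lam ^ k * dig (dbl^[k] x)) ?_ ?_
  · intro N
    refine Finset.measurable_fun_sum _ fun k _ => ?_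
    exact (hdig.comp (hd.iterate k)).const_mul _
  · rw [tendsto_pi_nhds]
    exact fun x => (S.summable_phi x).hasSum.tendsto_sum_nat

/-- Points of the Cantor set in the same generation have parameters in the same dyadic interval. -/
theorem abs_sub_le_of_abs_phi_sub_lt (k : ℕ) {x y : ℝ} (hx : x ∈ Ico (0 : ℝ) 1)
    (hy : y ∈ Ico (0 : ℝ) 1) (h : |S.phi x - S.phi y| < (1 - 2 * S.lam) * S.lam ^ k) :
    |x - y| ≤ (1 / 2) ^ (k + 1) := by
  have hl := S.lam_pos
  have hl2 := S.lam_lt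
  induction k generalizing x y with
  | zero =>
    rw [pow_zero, mul_one] at h
    -- The two branches lie at distance at least `2 * ctr - lam = 1 - 2 * lam`, so parameters whose
    -- images are closer share their leading binary digit. Iterating after rescaling by `lam`,
    -- further digits agree.
    have ax := abs_le.1 (S.abs_phi_le (dbl x))
    have ay := abs_le.1 (S.abs_phi_le (dbl y))
    rw [abs_lt] at h
    rcases lt_or_ge x (1 / 2) with h1 | h1 <;> rcases lt_or_ge y (1 / 2) with h2 | h2
    · rw [abs_le]; constructor <;> norm_num <;> linarith [hx.1, hy.1]
    · rw [S.phi_of_lt h1, S.phi_of_ge h2, ctr] at h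
      nlinarith
    · rw [S.phi_of_ge h1, S.phi_of_lt h2, ctr] at h
      nlinarith
    · rw [abs_le]; constructor <;> norm_num <;> linarith [hx.2, hy.2]
  | succ k ih =>
    have hle : (1 - 2 * S.lam) * S.lam ^ (k + 1) ≤ 1 - 2 * S.lam := by
      have : S.lam ^ (k + 1) ≤ 1 := pow_le_one₀ hl.le (by linarith)
      nlinarith
    have ax := abs_le.1 (S.abs_phi_le (dbl x))
    have ay := abs_le.1 (S.abs_phi_le (dbl y))
    have key : S.phi x - S.phi y = S.lam * (S.phi (dbl x) - S.phi (dbl y)) →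
        dbl x - dbl y = 2 * (x - y) → |x - y| ≤ (1 / 2) ^ (k + 1 + 1) := by
      intro h1 h2
      rw [h1, abs_mul, abs_of_pos hl, pow_succ] at h
      have h3 := ih (dbl_mem x) (dbl_mem y) (by nlinarith)
      rw [h2, abs_mul, abs_two] at h3
      rw [pow_succ]
      linarith
    rcases lt_or_ge x (1 / 2) with h1 | h1 <;> rcases lt_or_ge y (1 / 2) with h2 | h2
    · refine key ?_ ?_
      · rw [S.phi_of_lt h1, S.phi_of_lt h2]; ring
      · rw [dbl_of_lt hx h1, dbl_of_lt hy h2]; ring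
    · have h' := (abs_lt.1 (h.trans_le hle))
      rw [S.phi_of_lt h1, S.phi_of_ge h2, ctr] at h'
      nlinarith
    · have h' := (abs_lt.1 (h.trans_le hle))
      rw [S.phi_of_ge h1, S.phi_of_lt h2, ctr] at h'
      nlinarith
    · refine key ?_ ?_
      · rw [S.phi_of_ge h1, S.phi_of_ge h2]; ring
      · rw [dbl_of_ge hx h1, dbl_of_ge hy h2]; ring

/-- A cutoff equal to `1` on `|x| ≤ 1/2 + lam * w` and vanishing for `|x| ≥ 1/2 + w`. -/
def bump (x : ℝ) : ℝ :=
  Real.smoothTransition (((1 / 2 + S.w) ^ 2 - x ^ 2)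
    / ((1 / 2 + S.w) ^ 2 - (1 / 2 + S.lam * S.w) ^ 2))

theorem bump_den_pos : 0 < (1 / 2 + S.w) ^ 2 - (1 / 2 + S.lam * S.w) ^ 2 := by
  have h1 := S.lam_pos
  have h2 := S.lam_lt
  have h3 := S.w_pos
  have h4 : S.lam * S.w < S.w := by nlinarith
  have h5 : 0 < S.lam * S.w := by positivity
  nlinarith

theorem contDiff_bump : ContDiff ℝ ∞ S.bump := by
  unfold bump
  exact Real.smoothTransition.contDiff.comp (by fun_prop)

theorem bump_nonneg (x : ℝ) : 0 ≤ S.bump x := Real.smoothTransition.nonneg _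

theorem bump_le_one (x : ℝ) : S.bump x ≤ 1 := Real.smoothTransition.le_one _

theorem bump_eq_one {x : ℝ} (hx : |x| ≤ 1 / 2 + S.lam * S.w) : S.bump x = 1 := by
  refine Real.smoothTransition.one_of_one_le ?_
  rw [one_le_div S.bump_den_pos]
  have := sq_abs x
  nlinarith [abs_nonneg x]

theorem bump_eq_zero {x : ℝ} (hx : 1 / 2 + S.w ≤ |x|) : S.bump x = 0 := by
  refine Real.smoothTransition.zero_of_nonpos ?_
  refine div_nonpos_of_nonpos_of_nonneg ?_ S.bump_den_pos.le
  have := sq_abs x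
  have h3 := S.w_pos
  nlinarith [abs_nonneg x]

/-- The cutoff to the `k`-th generation of the Cantor set. -/
def chi : ℕ → ℝ → ℝ
  | 0 => S.bump
  | k + 1 => fun x => chi k ((x - S.ctr) / S.lam) + chi k ((x + S.ctr) / S.lam)

theorem contDiff_chi (k : ℕ) : ContDiff ℝ ∞ (S.chi k) := by
  induction k with
  | zero => exact S.contDiff_bump
  | succ k ih =>
    unfold chi
    exact (ih.comp (by fun_prop)).add (ih.comp (by fun_prop))

theorem chi_eq_zero (k : ℕ) {x : ℝ} (hx : 1 / 2 + S.w ≤ |x|) : S.chi k x = 0 := by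
  induction k generalizing x with
  | zero => exact S.bump_eq_zero hx
  | succ k ih =>
    have h1 := S.lam_pos
    have h2 := S.lam_lt
    have h3 := S.w_pos
    have hc : S.ctr = (1 - S.lam) / 2 := rfl
    have hb : ∀ y, (1 / 2 + S.w) - S.ctr ≤ |y| → S.chi k (y / S.lam) = 0 := by
      intro y hy
      refine ih ?_
      rw [abs_div, abs_of_pos h1, le_div_iff₀ h1]
      nlinarith
    have hc0 : 0 < S.ctr := by rw [hc]; linarith
    unfold chi
    rw [hb, hb, add_zero]
    · have := abs_sub_abs_le_abs_sub x (-S.ctr)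
      rw [abs_neg, abs_of_pos hc0, sub_neg_eq_add] at this
      linarith
    · have := abs_sub_abs_le_abs_sub x S.ctr
      rw [abs_of_pos hc0] at this
      linarith

theorem chi_left_eq_zero (k : ℕ) {x : ℝ} (hx : -S.gap ≤ x) :
    S.chi k ((x + S.ctr) / S.lam) = 0 := by
  refine S.chi_eq_zero k ?_
  rw [abs_div, abs_of_pos S.lam_pos, le_div_iff₀ S.lam_pos]
  refine le_trans ?_ (le_abs_self _)
  unfold gap at hx
  linarith

theorem chi_right_eq_zero (k : ℕ) {x : ℝ} (hx : x ≤ S.gap) :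
    S.chi k ((x - S.ctr) / S.lam) = 0 := by
  refine S.chi_eq_zero k ?_
  rw [abs_div, abs_of_pos S.lam_pos, le_div_iff₀ S.lam_pos]
  refine le_trans ?_ (neg_le_abs _)
  unfold gap at hx
  linarith

/-- On each side only one branch of the recursion survives. The half-lines `x ≥ -gap` and `x ≤ gap`
overlap, so every point has a neighbourhood inside one of them and derivatives can be computed on a
single branch. -/
theorem chi_succ_of_ge (k : ℕ) {x : ℝ} (hx : -S.gap ≤ x) :
    S.chi (k + 1) x = S.chi k ((x - S.ctr) / S.lam) := by
  conv_lhs => unfold chi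
  rw [S.chi_left_eq_zero k hx, add_zero]

theorem chi_succ_of_le (k : ℕ) {x : ℝ} (hx : x ≤ S.gap) :
    S.chi (k + 1) x = S.chi k ((x + S.ctr) / S.lam) := by
  conv_lhs => unfold chi
  rw [S.chi_right_eq_zero k hx, zero_add]

/-- Locally, `chi k` is a rescaled translate of the fixed bump. -/
theorem chi_locally_eq (k : ℕ) (x : ℝ) :
    ∃ e, S.chi k =ᶠ[𝓝 x] fun y => S.bump ((y - e) / S.lam ^ k) := by
  have hl := S.lam_pos.ne'
  induction k generalizing x with
  | zero => exact ⟨0, by simp [chi, EventuallyEq.refl]⟩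
  | succ k ih =>
    rcases lt_or_ge (-S.gap) x with h | h
    · obtain ⟨e, he⟩ := ih ((x - S.ctr) / S.lam)
      have hc : ContinuousAt (fun y : ℝ => (y - S.ctr) / S.lam) x := by fun_prop
      refine ⟨S.ctr + S.lam * e, ?_⟩
      filter_upwards [hc.eventually he, Ioi_mem_nhds h] with y h1 h2
      rw [S.chi_succ_of_ge k (le_of_lt h2), h1]
      congr 1
      rw [pow_succ]; field_simp; ring
    · have h' : x < S.gap := by linarith [S.gap_pos]
      obtain ⟨e, he⟩ := ih ((x + S.ctr) / S.lam)
      have hc : ContinuousAt (fun y : ℝ => (y + S.ctr) / S.lam) x := by fun_prop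
      refine ⟨-S.ctr + S.lam * e, ?_⟩
      filter_upwards [hc.eventually he, Iio_mem_nhds h'] with y h1 h2
      rw [S.chi_succ_of_le k (le_of_lt h2), h1]
      congr 1
      rw [pow_succ]; field_simp; ring

theorem chi_nonneg (k : ℕ) (x : ℝ) : 0 ≤ S.chi k x := by
  obtain ⟨e, he⟩ := S.chi_locally_eq k x
  rw [he.eq_of_nhds]; exact S.bump_nonneg _

theorem chi_le_one (k : ℕ) (x : ℝ) : S.chi k x ≤ 1 := by
  obtain ⟨e, he⟩ := S.chi_locally_eq k x
  rw [he.eq_of_nhds]; exact S.bump_le_one _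

/-- Nesting of the generations: the support of `chi 1` ends at `ctr + lam * (1/2 + w) = 1/2 + lam *
w`, exactly where `bump` stops being `1`. Self-similarity carries this to all generations. -/
theorem chi_eq_one_of_succ_ne_zero (k : ℕ) {x : ℝ} (hx : S.chi (k + 1) x ≠ 0) :
    S.chi k x = 1 := by
  have hl := S.lam_pos
  induction k generalizing x with
  | zero =>
    refine S.bump_eq_one ?_
    have hb : ∀ y, S.bump (y / S.lam) ≠ 0 → |y| < S.lam * (1 / 2 + S.w) := by
      intro y hy
      by_contra h0
      refine hy (S.bump_eq_zero ?_)
      rw [abs_div, abs_of_pos hl, le_div_iff₀ hl]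
      linarith
    have hc : S.ctr = (1 - S.lam) / 2 := rfl
    rcases le_total 0 x with h | h
    · rw [S.chi_succ_of_ge 0 (by linarith [S.gap_pos])] at hx
      have := abs_lt.1 (hb _ hx)
      rw [abs_of_nonneg h]
      linarith
    · rw [S.chi_succ_of_le 0 (by linarith [S.gap_pos])] at hx
      have := abs_lt.1 (hb _ hx)
      rw [abs_of_nonpos h]
      linarith
  | succ k ih =>
    rcases le_total 0 x with h | h
    · have hg : -S.gap ≤ x := by linarith [S.gap_pos]
      rw [S.chi_succ_of_ge _ hg] at hx ⊢
      exact ih hx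
    · have hg : x ≤ S.gap := by linarith [S.gap_pos]
      rw [S.chi_succ_of_le _ hg] at hx ⊢
      exact ih hx

/-- Zooming in `k` times multiplies the distance by `lam^(-k)`, leaving at most `w * lam`, the width
of the collar on which `bump` is still `1`. -/
theorem chi_eq_one_near_phi (k : ℕ) (x : ℝ) {z : ℝ}
    (hz : |z - S.phi x| ≤ S.w * S.lam ^ (k + 1)) : S.chi k z = 1 := by
  have hl := S.lam_pos
  have hl2 := S.lam_lt
  have hw := S.w_pos
  induction k generalizing x z with
  | zero =>
    refine S.bump_eq_one ?_
    have h1 := abs_sub_abs_le_abs_sub z (S.phi x)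
    have h2 := S.abs_phi_le x
    rw [zero_add, pow_one] at hz
    linarith
  | succ k ih =>
    have hp : S.w * S.lam ^ (k + 1 + 1) ≤ S.lam * S.w := by
      have : S.lam ^ (k + 1) ≤ 1 := pow_le_one₀ hl.le (by linarith)
      rw [pow_succ]
      nlinarith [mul_pos hl hw]
    have hpp := abs_le.1 (S.abs_phi_le (dbl x))
    have hz' := abs_le.1 hz
    rcases lt_or_ge x (1 / 2) with h | h
    · rw [S.phi_of_lt h] at hz hz'
      have hg : z ≤ S.gap := by
        have : z ≤ -S.gap := by unfold gap; nlinarith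
        linarith [S.gap_pos]
      rw [S.chi_succ_of_le _ hg]
      refine ih (dbl x) ?_
      have e : z - (-S.ctr + S.lam * S.phi (dbl x))
          = S.lam * ((z + S.ctr) / S.lam - S.phi (dbl x)) := by field_simp; ring
      rw [e, abs_mul, abs_of_pos hl, pow_succ] at hz
      nlinarith
    · rw [S.phi_of_ge h] at hz hz'
      have hg : -S.gap ≤ z := by
        have : S.gap ≤ z := by unfold gap; nlinarith
        linarith [S.gap_pos]
      rw [S.chi_succ_of_ge _ hg]
      refine ih (dbl x) ?_
      have e : z - (S.ctr + S.lam * S.phi (dbl x))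
          = S.lam * ((z - S.ctr) / S.lam - S.phi (dbl x)) := by field_simp; ring
      rw [e, abs_mul, abs_of_pos hl, pow_succ] at hz
      nlinarith

/-- Each generation doubles the number of pieces and shrinks them by `lam`; the first has length at
most `1 + 2 * w < 2`. -/
theorem volume_support_chi_le (k : ℕ) :
    volume {x | S.chi k x ≠ 0} ≤ ENNReal.ofReal (2 * (2 * S.lam) ^ k) := by
  have hl := S.lam_pos
  induction k with
  | zero =>
    have : {x | S.chi 0 x ≠ 0} ⊆ Ioo (-(1 / 2 + S.w)) (1 / 2 + S.w) := by
      intro x hx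
      by_contra h0
      refine hx (S.chi_eq_zero 0 ?_)
      by_contra h1
      exact h0 (abs_lt.1 (not_le.1 h1))
    refine (measure_mono this).trans ?_
    rw [Real.volume_Ioo]
    refine ENNReal.ofReal_le_ofReal ?_
    have := S.w_lt
    simp only [pow_zero, mul_one]
    linarith
  | succ k ih =>
    set A := {x | S.chi k x ≠ 0} with hA
    have hsub : {x | S.chi (k + 1) x ≠ 0} ⊆
        ((fun x => x + -S.ctr) ⁻¹' ((fun x => x * S.lam⁻¹) ⁻¹' A))
          ∪ ((fun x => x + S.ctr) ⁻¹' ((fun x => x * S.lam⁻¹) ⁻¹' A)) := by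
      intro x hx
      by_contra h0
      simp only [mem_union, mem_preimage, not_or, hA, mem_ofPred_eq, not_not] at h0
      refine hx ?_
      unfold chi
      simp only [div_eq_mul_inv, sub_eq_add_neg]
      rw [h0.1, h0.2, add_zero]
    refine (measure_mono hsub).trans ((measure_union_le _ _).trans ?_)
    rw [measure_preimage_add_right, measure_preimage_add_right,
      Real.volume_preimage_mul_right (inv_ne_zero hl.ne'), inv_inv, abs_of_pos hl]
    calc _ ≤ ENNReal.ofReal S.lam * ENNReal.ofReal (2 * (2 * S.lam) ^ k)
          + ENNReal.ofReal S.lam * ENNReal.ofReal (2 * (2 * S.lam) ^ k) := by gcongr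
      _ = ENNReal.ofReal (2 * (2 * S.lam) ^ (k + 1)) := by
        rw [← ENNReal.ofReal_mul hl.le, ← ENNReal.ofReal_add (by positivity) (by positivity)]
        congr 1
        rw [pow_succ]; ring

end CantorScale

end Cantor

/-! ### Hölder regularity of sums of rescaled functions -/

section Holder

/-- All derivatives are bounded. -/
def HasBoundedDerivs {V : Type*} [NormedAddCommGroup V] [NormedSpace ℝ V] (F : V → ℝ) : Prop :=
  ContDiff ℝ ∞ F ∧ ∀ j : ℕ, ∃ C : ℝ, ∀ x, ‖iteratedFDeriv ℝ j F x‖ ≤ C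

section

variable {V W : Type*} [NormedAddCommGroup V] [NormedSpace ℝ V] [NormedAddCommGroup W]
  [NormedSpace ℝ W]

theorem HasBoundedDerivs.of_hasCompactSupport {F : V → ℝ} (hF : ContDiff ℝ ∞ F)
    (hc : HasCompactSupport F) : HasBoundedDerivs F := by
  refine ⟨hF, fun j => ?_⟩
  exact (hF.continuous_iteratedFDeriv (by exact_mod_cast le_top)).bounded_above_of_compact_support
    (hc.iteratedFDeriv j)

theorem HasBoundedDerivs.mul {F G : V → ℝ} (hF : HasBoundedDerivs F) (hG : HasBoundedDerivs G) :
    HasBoundedDerivs fun x => F x * G x := by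
  refine ⟨hF.1.mul hG.1, fun j => ?_⟩
  choose C hC using hF.2
  choose D hD using hG.2
  refine ⟨∑ i ∈ Finset.range (j + 1), (j.choose i : ℝ) * C i * D (j - i), fun x => ?_⟩
  refine (norm_iteratedFDeriv_mul_le hF.1 hG.1 x (n := j) (by exact_mod_cast le_top)).trans ?_
  refine Finset.sum_le_sum fun i _ => ?_
  have := (norm_nonneg _).trans (hC i x)
  gcongr
  · exact hC i x
  · exact hD _ x

theorem hasBoundedDerivs_const (c : ℝ) : HasBoundedDerivs fun _ : V => c := by
  refine ⟨contDiff_const, fun j => ?_⟩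
  cases j with
  | zero => exact ⟨‖c‖, fun x => by simp⟩
  | succ j => exact ⟨0, fun x => by rw [iteratedFDeriv_const_of_ne (by simp)]; simp⟩

theorem HasBoundedDerivs.prod {ι : Type*} (s : Finset ι) {F : ι → V → ℝ}
    (hF : ∀ i ∈ s, HasBoundedDerivs (F i)) : HasBoundedDerivs fun x => ∏ i ∈ s, F i x := by
  classical
  induction s using Finset.induction_on with
  | empty => simpa using hasBoundedDerivs_const 1
  | insert i s hi ih =>
    simp_rw [Finset.prod_insert hi]
    exact (hF i (by simp)).mul (ih fun j hj => hF j (by simp [hj]))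

theorem HasBoundedDerivs.comp_clm {F : W → ℝ} (hF : HasBoundedDerivs F) (g : V →L[ℝ] W) :
    HasBoundedDerivs fun x => F (g x) := by
  refine ⟨hF.1.comp g.contDiff, fun j => ?_⟩
  obtain ⟨C, hC⟩ := hF.2 j
  refine ⟨C * ∏ _i : Fin j, ‖g‖, fun x => ?_⟩
  have := g.iteratedFDeriv_comp_right hF.1 x (i := j) (by exact_mod_cast le_top)
  rw [Function.comp_def] at this
  rw [this]
  refine (ContinuousMultilinearMap.norm_compContinuousLinearMap_le _ _).trans ?_
  gcongr
  exact hC _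

/-- `f k` is locally a translate of `(lam ^ k) ^ β * F (· / lam ^ k)`. -/
def IsScaledFamily (lam β : ℝ) (F : V → ℝ) (f : ℕ → V → ℝ) : Prop :=
  ∀ k x, ∃ e, f k =ᶠ[𝓝 x] fun y => (lam ^ k) ^ β * F ((lam ^ k)⁻¹ • (y - e))

variable {lam β : ℝ} {F : V → ℝ} {f : ℕ → V → ℝ}

theorem IsScaledFamily.contDiff (h : IsScaledFamily lam β F f) (hF : HasBoundedDerivs F) (k : ℕ) :
    ContDiff ℝ ∞ (f k) := by
  refine contDiff_iff_contDiffAt.2 fun x => ?_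
  obtain ⟨e, he⟩ := h k x
  refine ContDiffAt.congr_of_eventuallyEq ?_ he
  have h1 : ContDiff ℝ ∞ fun y : V => (lam ^ k)⁻¹ • (y - e) := by fun_prop
  exact (contDiff_const.mul (hF.1.comp h1)).contDiffAt

/-- Each derivative costs one factor `lam^(-k)`, and derivatives at a point only see the local form
of `f k`, so no disjointness of supports is needed. -/
theorem IsScaledFamily.norm_iteratedFDeriv_le (h : IsScaledFamily lam β F f)
    (hF : HasBoundedDerivs F) (hlam : 0 < lam) {j : ℕ} {C : ℝ}
    (hC : ∀ x, ‖iteratedFDeriv ℝ j F x‖ ≤ C) (k : ℕ) (x : V) :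
    ‖iteratedFDeriv ℝ j (f k) x‖ ≤ C * (lam ^ k) ^ (β - j) := by
  obtain ⟨e, he⟩ := h k x
  have hr : 0 < lam ^ k := by positivity
  rw [(he.iteratedFDeriv ℝ j).eq_of_nhds]
  have hFj : ContDiff ℝ j F := hF.1.of_le (by exact_mod_cast le_top)
  have h1 : ContDiff ℝ j fun y : V => F ((lam ^ k)⁻¹ • y) :=
    hFj.comp (contDiff_const_smul _)
  have h2 : ContDiff ℝ j fun y : V => F ((lam ^ k)⁻¹ • (y - e)) :=
    hFj.comp ((contDiff_id.sub contDiff_const).const_smul _)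
  have h3 : iteratedFDeriv ℝ j (fun y => (lam ^ k) ^ β * F ((lam ^ k)⁻¹ • (y - e))) x
      = (lam ^ k) ^ β • iteratedFDeriv ℝ j (fun y => F ((lam ^ k)⁻¹ • (y - e))) x :=
    iteratedFDeriv_const_smul_apply' (𝕜 := ℝ) (a := (lam ^ k) ^ β) h2.contDiffAt
  have h4 : iteratedFDeriv ℝ j (fun y => F ((lam ^ k)⁻¹ • (y - e))) x
      = (lam ^ k)⁻¹ ^ j • iteratedFDeriv ℝ j F ((lam ^ k)⁻¹ • (x - e)) := by
    rw [iteratedFDeriv_comp_sub (f := fun y : V => F ((lam ^ k)⁻¹ • y)),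
      iteratedFDeriv_comp_const_smul _ hFj]
  rw [h3, h4, norm_smul, norm_smul, Real.norm_of_nonneg (by positivity),
    Real.norm_of_nonneg (by positivity), Real.rpow_sub hr, Real.rpow_natCast, inv_pow]
  calc _ ≤ (lam ^ k) ^ β * (((lam ^ k) ^ j)⁻¹ * C) := by gcongr; exact hC _
    _ = _ := by ring

theorem summable_pow_rpow (hlam : 0 < lam) (hlam1 : lam < 1) {γ : ℝ} (hγ : 0 < γ) (C : ℝ) :
    Summable fun k : ℕ => C * (lam ^ k) ^ γ := by
  have h1 : ∀ k : ℕ, (lam ^ k) ^ γ = (lam ^ γ) ^ k := fun k => by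
    rw [← Real.rpow_natCast, ← Real.rpow_natCast, ← Real.rpow_mul hlam.le,
      ← Real.rpow_mul hlam.le, mul_comm]
  simp_rw [h1]
  exact (summable_geometric_of_lt_one (Real.rpow_nonneg hlam.le _)
    (Real.rpow_lt_one hlam.le hlam1 hγ)).mul_left C

/-- Interpolation between a supremum bound, better for `d ≥ r`, and a Lipschitz bound, better for `d
≤ r`. Both endpoints `γ = 0` and `γ = 1` are included, the former serving integer `α`. -/
theorem min_le_mul_rpow {A B r d γ : ℝ} (hA : 0 ≤ A) (hB : 0 ≤ B) (hr : 0 < r) (hd : 0 ≤ d)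
    (hγ0 : 0 ≤ γ) (hγ1 : γ ≤ 1) : min (2 * A) (B / r * d) ≤ (2 * A + B) * (d / r) ^ γ := by
  have h0 : 0 ≤ d / r := by positivity
  rcases le_total d r with h | h
  · have h1 : d / r ≤ 1 := (div_le_one hr).2 h
    have h2 : d / r ≤ (d / r) ^ γ := by
      simpa using Real.rpow_le_rpow_of_exponent_ge' h0 h1 hγ0 hγ1
    calc min (2 * A) (B / r * d) ≤ B * (d / r) := (min_le_right _ _).trans (by
          rw [div_mul_eq_mul_div, mul_div_assoc])
      _ ≤ (2 * A + B) * (d / r) ^ γ := by gcongr; linarith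
  · have h1 : 1 ≤ (d / r) ^ γ := Real.one_le_rpow ((one_le_div hr).2 h) hγ0
    calc min (2 * A) (B / r * d) ≤ 2 * A := min_le_left _ _
      _ ≤ (2 * A + B) * 1 := by linarith
      _ ≤ _ := by gcongr

theorem IsScaledFamily.contDiff_tsum (h : IsScaledFamily lam β F f) (hF : HasBoundedDerivs F)
    (hlam : 0 < lam) (hlam1 : lam < 1) {N : ℕ} (hN : (N : ℝ) < β) :
    ContDiff ℝ N fun x => ∑' k, f k x := by
  choose C hC using hF.2
  refine _root_.contDiff_tsum (N := N) (v := fun j k => C j * (lam ^ k) ^ (β - j))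
    (fun k => (h.contDiff hF k).of_le (by exact_mod_cast le_top)) (fun j hj => ?_)
    (fun j k x _ => h.norm_iteratedFDeriv_le hF hlam (hC j) k x)
  have : (j : ℝ) ≤ N := by exact_mod_cast hj
  exact summable_pow_rpow hlam hlam1 (by linarith) _

/-- The Hölder estimate for the derivative of order `N` of a sum of scaled functions. -/
theorem IsScaledFamily.exists_holder (h : IsScaledFamily lam β F f) (hF : HasBoundedDerivs F)
    (hlam : 0 < lam) (hlam1 : lam < 1) {N : ℕ} {α : ℝ} (hN : (N : ℝ) ≤ α) (hN1 : α ≤ N + 1)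
    (hα : α < β) : ∃ C : ℝ, 0 ≤ C ∧ ∀ x y,
      ‖iteratedFDeriv ℝ N (fun x => ∑' k, f k x) x - iteratedFDeriv ℝ N (fun x => ∑' k, f k x) y‖
        ≤ C * ‖x - y‖ ^ (α - N) := by
  choose C hC using hF.2
  have hC0 : ∀ j, 0 ≤ C j := fun j => (norm_nonneg _).trans (hC j 0)
  have hsum : ∀ j : ℕ, (j : ℕ∞) ≤ N → Summable fun k : ℕ => C j * (lam ^ k) ^ (β - j) := by
    intro j hj
    have : (j : ℝ) ≤ N := by exact_mod_cast hj
    exact summable_pow_rpow hlam hlam1 (by linarith) _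
  have hts := iteratedFDeriv_tsum (N := N) (v := fun j k => C j * (lam ^ k) ^ (β - j))
    (fun k => (h.contDiff hF k).of_le (by exact_mod_cast le_top)) hsum
    (fun j k x _ => h.norm_iteratedFDeriv_le hF hlam (hC j) k x) (k := N) le_rfl
  set B := 2 * C N + C (N + 1) with hB
  have hB0 : 0 ≤ B := by have := hC0 N; have := hC0 (N + 1); positivity
  -- The bounds for the derivatives of orders `N` and `N + 1` are interpolated at scale `lam^k`. The
  -- surplus factor `(lam^k)^(β - α)` makes the series over `k` converge.
  have hterm : ∀ k x y, ‖iteratedFDeriv ℝ N (f k) x - iteratedFDeriv ℝ N (f k) y‖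
      ≤ B * (lam ^ k) ^ (β - α) * ‖x - y‖ ^ (α - N) := by
    intro k x y
    have hr : 0 < lam ^ k := by positivity
    have b0 := h.norm_iteratedFDeriv_le hF hlam (hC N) k
    have b1 := h.norm_iteratedFDeriv_le hF hlam (hC (N + 1)) k
    have c0 : ‖iteratedFDeriv ℝ N (f k) x - iteratedFDeriv ℝ N (f k) y‖
        ≤ 2 * (C N * (lam ^ k) ^ (β - N)) :=
      (norm_sub_le _ _).trans (by linarith [b0 x, b0 y])
    have hd : Differentiable ℝ (iteratedFDeriv ℝ N (f k)) :=
      (h.contDiff hF k).differentiable_iteratedFDeriv (by exact_mod_cast ENat.natCast_lt_top N)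
    have c1 : ‖iteratedFDeriv ℝ N (f k) x - iteratedFDeriv ℝ N (f k) y‖
        ≤ C (N + 1) * (lam ^ k) ^ (β - N) / lam ^ k * ‖x - y‖ := by
      refine Convex.norm_image_sub_le_of_norm_fderiv_le (𝕜 := ℝ) (s := univ)
        (fun z _ => hd z) (fun z _ => ?_) convex_univ (mem_univ _) (mem_univ _)
      rw [norm_fderiv_iteratedFDeriv]
      refine (b1 z).trans (le_of_eq ?_)
      rw [mul_div_assoc, ← Real.rpow_sub_one hr.ne']
      congr 2; push_cast; ring
    have hp : 0 ≤ (lam ^ k) ^ (β - N) := by positivity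
    refine (le_min c0 c1).trans ((min_le_mul_rpow (mul_nonneg (hC0 N) hp)
      (mul_nonneg (hC0 (N + 1)) hp) hr (norm_nonneg _) (sub_nonneg.2 hN)
      (by linarith : α - N ≤ 1)).trans (le_of_eq ?_))
    rw [Real.div_rpow (norm_nonneg _) hr.le]
    have : (lam ^ k) ^ (β - α) = (lam ^ k) ^ (β - N) / (lam ^ k) ^ (α - N) := by
      rw [← Real.rpow_sub hr]; congr 1; ring
    rw [this, hB]; ring
  have hsB : Summable fun k : ℕ => B * (lam ^ k) ^ (β - α) :=
    summable_pow_rpow hlam hlam1 (by linarith) B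
  refine ⟨∑' k : ℕ, B * (lam ^ k) ^ (β - α), tsum_nonneg fun k => by positivity, fun x y => ?_⟩
  have hs : ∀ x, Summable fun k => iteratedFDeriv ℝ N (f k) x := fun x =>
    Summable.of_norm_bounded (hsum N le_rfl) fun k => h.norm_iteratedFDeriv_le hF hlam (hC N) k x
  rw [hts]
  simp only
  rw [← (hs x).tsum_sub (hs y), ← tsum_mul_right]
  exact tsum_of_norm_bounded (hsB.mul_right _).hasSum fun k => hterm k x y

end

variable {n : ℕ}

theorem convex_closedCube : Convex ℝ (closedCube n) := by
  intro x hx y hy a b ha hb hab i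
  have := convex_Icc (-1 : ℝ) 1 (hx i) (hy i) ha hb hab
  simpa using this

theorem uniqueDiffOn_closedCube : UniqueDiffOn ℝ (closedCube n) := by
  refine uniqueDiffOn_convex convex_closedCube ⟨0, ?_⟩
  rw [mem_interior]
  exact ⟨cube n, cube_subset_closedCube, isOpen_cube, fun i => by simp⟩

theorem memHolderClass_of_holder {α : ℝ} {f : E n → ℝ} (hf : ContDiff ℝ (⌊α⌋₊ : ℕ) f) (hα : 0 ≤ α)
    {C : ℝ} (hC : 0 ≤ C)
    (h : ∀ x y, ‖iteratedFDeriv ℝ ⌊α⌋₊ f x - iteratedFDeriv ℝ ⌊α⌋₊ f y‖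
      ≤ C * ‖x - y‖ ^ (α - ⌊α⌋₊)) : MemHolderClass α (closedCube n) f := by
  refine ⟨hf.contDiffOn, C.toNNReal, fun x hx y hy => ?_⟩
  have e : ∀ z ∈ closedCube n, iteratedFDerivWithin ℝ ⌊α⌋₊ f (closedCube n) z
      = iteratedFDeriv ℝ ⌊α⌋₊ f z := fun z hz =>
    iteratedFDerivWithin_eq_iteratedFDeriv uniqueDiffOn_closedCube hf.contDiffAt hz
  have hγ : 0 ≤ α - ⌊α⌋₊ := sub_nonneg.2 (Nat.floor_le hα)
  rw [e x hx, e y hy, edist_dist, edist_dist, dist_eq_norm, dist_eq_norm, Real.coe_toNNReal _ hγ,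
    ENNReal.ofReal_rpow_of_nonneg (norm_nonneg _) hγ]
  refine (ENNReal.ofReal_le_ofReal (h x y)).trans ?_
  rw [ENNReal.ofReal_mul hC]
  rfl

end Holder

/-! ### Vertical profiles and windows of scales -/

section Profiles

namespace CantorScale

variable (S : CantorScale)

theorem lam_lt_one : S.lam < 1 := by linarith [S.lam_lt]

theorem lam_pow_pos (k : ℕ) : 0 < S.lam ^ k := pow_pos S.lam_pos k

/-- An odd smooth step, vanishing for `|t| ≤ lam` and equal to the sign for `|t| ≥ 2 lam`. -/
def stp (t : ℝ) : ℝ :=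
  Real.smoothTransition (t / S.lam - 1) - Real.smoothTransition (-t / S.lam - 1)

theorem contDiff_stp : ContDiff ℝ ∞ S.stp := by
  unfold stp
  exact (Real.smoothTransition.contDiff.comp (by fun_prop)).sub
    (Real.smoothTransition.contDiff.comp (by fun_prop))

theorem stp_eq_zero {t : ℝ} (ht : |t| ≤ S.lam) : S.stp t = 0 := by
  have h := abs_le.1 ht
  have hl := S.lam_pos
  unfold stp
  rw [Real.smoothTransition.zero_of_nonpos, Real.smoothTransition.zero_of_nonpos, sub_zero]
  · rw [sub_nonpos, div_le_one hl]; linarith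
  · rw [sub_nonpos, div_le_one hl]; linarith

theorem stp_eq_one {t : ℝ} (ht : 2 * S.lam ≤ t) : S.stp t = 1 := by
  have hl := S.lam_pos
  unfold stp
  rw [Real.smoothTransition.one_of_one_le, Real.smoothTransition.zero_of_nonpos, sub_zero]
  · rw [sub_nonpos, div_le_one hl]; linarith
  · rw [le_sub_iff_add_le, le_div_iff₀ hl]; linarith

theorem stp_neg (t : ℝ) : S.stp (-t) = -S.stp t := by
  unfold stp; rw [neg_neg]; ring

theorem stp_eq_neg_one {t : ℝ} (ht : t ≤ -(2 * S.lam)) : S.stp t = -1 := by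
  rw [← neg_neg t, stp_neg, S.stp_eq_one (by linarith)]

theorem abs_stp_le (t : ℝ) : |S.stp t| ≤ 1 := by
  unfold stp
  have h1 := Real.smoothTransition.le_one (t / S.lam - 1)
  have h2 := Real.smoothTransition.le_one (-t / S.lam - 1)
  have h3 := Real.smoothTransition.nonneg (t / S.lam - 1)
  have h4 := Real.smoothTransition.nonneg (-t / S.lam - 1)
  rw [abs_le]; constructor <;> linarith

/-- The profile in the vertical variable of the building blocks. -/
def prof (t : ℝ) : ℝ := S.stp t - S.stp (S.lam * t)

theorem contDiff_prof : ContDiff ℝ ∞ S.prof := by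
  unfold prof
  exact S.contDiff_stp.sub (S.contDiff_stp.comp (by fun_prop))

theorem prof_eq_zero_of_le {t : ℝ} (ht : |t| ≤ S.lam) : S.prof t = 0 := by
  unfold prof
  rw [S.stp_eq_zero ht, S.stp_eq_zero, sub_zero]
  rw [abs_mul, abs_of_pos S.lam_pos]
  nlinarith [abs_nonneg t, S.lam_pos, S.lam_lt_one]

theorem prof_eq_zero_of_ge {t : ℝ} (ht : 2 ≤ |t|) : S.prof t = 0 := by
  have hl := S.lam_pos
  have hl1 := S.lam_lt_one
  unfold prof
  rcases le_abs.1 ht with h | h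
  · rw [S.stp_eq_one (by linarith), S.stp_eq_one (by nlinarith), sub_self]
  · rw [S.stp_eq_neg_one (by linarith), S.stp_eq_neg_one (by nlinarith), sub_self]

theorem abs_prof_le (t : ℝ) : |S.prof t| ≤ 2 := by
  unfold prof
  have := abs_sub (S.stp t) (S.stp (S.lam * t))
  linarith [S.abs_stp_le t, S.abs_stp_le (S.lam * t)]

theorem prof_one : S.prof 1 = 1 := by
  unfold prof
  rw [S.stp_eq_one (by linarith [S.lam_lt]), S.stp_eq_zero, sub_zero]
  rw [mul_one, abs_of_pos S.lam_pos]

theorem prof_neg (t : ℝ) : S.prof (-t) = -S.prof t := by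
  unfold prof
  rw [stp_neg, mul_neg, stp_neg]; ring

/-- Profiles are differences of one step function at consecutive scales, so they telescope. For `|t|
≤ 1` the last term vanishes and the sum is `sign t` away from a thin layer. -/
theorem sum_prof (N : ℕ) (t : ℝ) :
    ∑ k ∈ Finset.range (N + 1), S.prof (t / S.lam ^ k) = S.stp (t / S.lam ^ N)
      - S.stp (S.lam * t) := by
  have hl := S.lam_pos.ne'
  induction N with
  | zero => simp [prof]
  | succ N ih =>
    rw [Finset.sum_range_succ, ih, prof]
    have : S.lam * (t / S.lam ^ (N + 1)) = t / S.lam ^ N := by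
      rw [pow_succ]; field_simp
    rw [this]; ring

/-- A cutoff equal to `1` for `lam ≤ |t| ≤ 1` and vanishing unless `lam² < |t| < 2`. -/
def psi (t : ℝ) : ℝ :=
  Real.smoothTransition ((t ^ 2 - S.lam ^ 4) / (S.lam ^ 2 - S.lam ^ 4))
    * Real.smoothTransition ((4 - t ^ 2) / 3)

theorem psi_den_pos : 0 < S.lam ^ 2 - S.lam ^ 4 := by
  have h := S.lam_pos
  have h1 := S.lam_lt_one
  have h2 : S.lam ^ 2 < 1 := by nlinarith
  have h3 : 0 < S.lam ^ 2 := by positivity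
  nlinarith

theorem contDiff_psi : ContDiff ℝ ∞ S.psi := by
  unfold psi
  exact (Real.smoothTransition.contDiff.comp (by fun_prop)).mul
    (Real.smoothTransition.contDiff.comp (by fun_prop))

theorem psi_nonneg (t : ℝ) : 0 ≤ S.psi t :=
  mul_nonneg (Real.smoothTransition.nonneg _) (Real.smoothTransition.nonneg _)

theorem psi_le_one (t : ℝ) : S.psi t ≤ 1 :=
  mul_le_one₀ (Real.smoothTransition.le_one _) (Real.smoothTransition.nonneg _)
    (Real.smoothTransition.le_one _)

theorem psi_eq_one {t : ℝ} (h1 : S.lam ≤ |t|) (h2 : |t| ≤ 1) : S.psi t = 1 := by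
  have hs := sq_abs t
  unfold psi
  rw [Real.smoothTransition.one_of_one_le, Real.smoothTransition.one_of_one_le, one_mul]
  · rw [le_div_iff₀ (by norm_num)]
    nlinarith [abs_nonneg t]
  · rw [le_div_iff₀ S.psi_den_pos]
    nlinarith [S.lam_pos]

theorem lt_abs_of_psi_ne_zero {t : ℝ} (h : S.psi t ≠ 0) : S.lam ^ 2 < |t| := by
  by_contra h0
  push Not at h0
  refine h (mul_eq_zero_of_left (Real.smoothTransition.zero_of_nonpos ?_) _)
  refine div_nonpos_of_nonpos_of_nonneg ?_ S.psi_den_pos.le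
  have : t ^ 2 ≤ (S.lam ^ 2) ^ 2 := by
    rw [← sq_abs t]; exact pow_le_pow_left₀ (abs_nonneg t) h0 2
  nlinarith

theorem abs_lt_of_psi_ne_zero {t : ℝ} (h : S.psi t ≠ 0) : |t| < 2 := by
  by_contra h0
  push Not at h0
  refine h (mul_eq_zero_of_right _ (Real.smoothTransition.zero_of_nonpos ?_))
  have hs := sq_abs t
  nlinarith

theorem hasBoundedDerivs_of_eq_zero {f : ℝ → ℝ} (hf : ContDiff ℝ ∞ f)
    (h : ∀ t, 2 ≤ |t| → f t = 0) : HasBoundedDerivs f := by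
  refine HasBoundedDerivs.of_hasCompactSupport hf ?_
  refine HasCompactSupport.intro (isCompact_Icc (a := (-2 : ℝ)) (b := 2)) fun t ht => h t ?_
  by_contra h0
  exact ht (abs_le.1 (not_le.1 h0).le)

theorem hasBoundedDerivs_prof : HasBoundedDerivs S.prof :=
  hasBoundedDerivs_of_eq_zero S.contDiff_prof fun _ ht => S.prof_eq_zero_of_ge ht

theorem hasBoundedDerivs_psi : HasBoundedDerivs S.psi :=
  hasBoundedDerivs_of_eq_zero S.contDiff_psi fun t ht => by
    by_contra h0
    linarith [S.abs_lt_of_psi_ne_zero h0]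

theorem hasBoundedDerivs_bump : HasBoundedDerivs S.bump :=
  hasBoundedDerivs_of_eq_zero S.contDiff_bump fun t ht =>
    S.bump_eq_zero (by linarith [S.w_lt])

/-- `k` is one of the scales at which `|t|` is of size `lam ^ k`. -/
def InWindow (k : ℕ) (t : ℝ) : Prop := S.lam ^ (k + 2) ≤ |t| ∧ |t| ≤ 2 * S.lam ^ k

theorem exists_scale {t : ℝ} (h0 : t ≠ 0) (h1 : |t| ≤ 1) :
    ∃ k : ℕ, S.lam ^ (k + 1) < |t| ∧ |t| ≤ S.lam ^ k :=
  exists_nat_pow_near_of_lt_one (abs_pos.2 h0) h1 S.lam_pos S.lam_lt_one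

theorem mem_Icc_of_inWindow {t : ℝ} {j k : ℕ} (h1 : S.lam ^ (k + 1) < |t|)
    (h2 : |t| ≤ S.lam ^ k) (h : S.InWindow j t) : j ∈ Finset.Icc (k - 2) (k + 1) := by
  have hl := S.lam_pos
  rw [Finset.mem_Icc]
  constructor
  · have h3 : S.lam ^ (j + 2) ≤ S.lam ^ k := h.1.trans h2
    have := (pow_le_pow_iff_right_of_lt_one₀ hl S.lam_lt_one).1 h3
    omega
  · have h3 : S.lam ^ (k + 1) < 2 * S.lam ^ j := h1.trans_le h.2
    have h4 : S.lam ^ (k + 2) < S.lam ^ j := by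
      have : S.lam ^ (k + 2) = S.lam ^ (k + 1) * S.lam := by rw [pow_succ]
      have h5 := S.lam_lt
      have h6 := S.lam_pow_pos (k + 1)
      nlinarith
    have := (pow_lt_pow_iff_right_of_lt_one₀ hl S.lam_lt_one).1 h4
    omega

theorem not_inWindow_zero (k : ℕ) : ¬ S.InWindow k 0 := by
  intro h
  have := h.1
  rw [abs_zero] at this
  linarith [S.lam_pow_pos (k + 2)]

/-- At each height at most four scales are active. -/
theorem exists_window_finset {t : ℝ} (h1 : |t| ≤ 1) :
    ∃ s : Finset ℕ, s.card ≤ 4 ∧ ∀ k, S.InWindow k t → k ∈ s := by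
  by_cases h0 : t = 0
  · refine ⟨∅, by simp, fun k hk => ?_⟩
    subst h0
    exact (S.not_inWindow_zero k hk).elim
  · obtain ⟨k, hk1, hk2⟩ := S.exists_scale h0 h1
    refine ⟨Finset.Icc (k - 2) (k + 1), ?_, fun j hj => S.mem_Icc_of_inWindow hk1 hk2 hj⟩
    rw [Nat.card_Icc]; omega

theorem inWindow_of_psi_ne_zero {k : ℕ} {t : ℝ} (h : S.psi (t / S.lam ^ k) ≠ 0) :
    S.InWindow k t := by
  have hk := S.lam_pow_pos k
  have h1 := S.lt_abs_of_psi_ne_zero h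
  have h2 := S.abs_lt_of_psi_ne_zero h
  rw [abs_div, abs_of_pos hk] at h1 h2
  rw [lt_div_iff₀ hk] at h1
  rw [div_lt_iff₀ hk] at h2
  refine ⟨?_, h2.le⟩
  rw [pow_add, mul_comm]; exact h1.le

theorem inWindow_of_prof_ne_zero {k : ℕ} {t : ℝ} (h : S.prof (t / S.lam ^ k) ≠ 0) :
    S.lam ^ (k + 1) < |t| ∧ |t| < 2 * S.lam ^ k := by
  have hk := S.lam_pow_pos k
  have h1 : S.lam < |t / S.lam ^ k| := by
    by_contra h0
    exact h (S.prof_eq_zero_of_le (not_lt.1 h0))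
  have h2 : |t / S.lam ^ k| < 2 := by
    by_contra h0
    exact h (S.prof_eq_zero_of_ge (not_lt.1 h0))
  rw [abs_div, abs_of_pos hk] at h1 h2
  rw [lt_div_iff₀ hk] at h1
  rw [div_lt_iff₀ hk] at h2
  refine ⟨?_, h2⟩
  rw [pow_succ, mul_comm]; exact h1

end CantorScale

end Profiles

/-! ### Building blocks of the competitor -/

section Blocks

namespace CantorScale

variable (S : CantorScale) {m : ℕ}

/-- The cutoff in the horizontal variables to the `k`-th generation of the product Cantor set. -/
def hcut (k : ℕ) (z : E (m + 1)) : ℝ := ∏ i : Fin m, S.chi k (z i.succ)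

theorem contDiff_hcut (k : ℕ) : ContDiff ℝ ∞ (S.hcut k : E (m + 1) → ℝ) := by
  unfold hcut
  exact contDiff_prod fun i _ => (S.contDiff_chi k).comp (by fun_prop)

theorem hcut_nonneg (k : ℕ) (z : E (m + 1)) : 0 ≤ S.hcut k z :=
  Finset.prod_nonneg fun _ _ => S.chi_nonneg k _

theorem hcut_le_one (k : ℕ) (z : E (m + 1)) : S.hcut k z ≤ 1 :=
  Finset.prod_le_one (fun _ _ => S.chi_nonneg k _) fun _ _ => S.chi_le_one k _

theorem chi_ne_zero_of_hcut_ne_zero {k : ℕ} {z : E (m + 1)} (h : S.hcut k z ≠ 0) (i : Fin m) :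
    S.chi k (z i.succ) ≠ 0 := Finset.prod_ne_zero_iff.1 h i (Finset.mem_univ i)

theorem hcut_eq_one_of_succ_ne_zero {k : ℕ} {z : E (m + 1)} (h : S.hcut (k + 1) z ≠ 0) :
    S.hcut k z = 1 :=
  Finset.prod_eq_one fun i _ =>
    S.chi_eq_one_of_succ_ne_zero k (S.chi_ne_zero_of_hcut_ne_zero h i)

theorem hcut_eq_one_of_lt {j k : ℕ} (hjk : j < k) {z : E (m + 1)} (h : S.hcut k z ≠ 0) :
    S.hcut j z = 1 := by
  induction k with
  | zero => omega
  | succ k ih =>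
    have h1 := S.hcut_eq_one_of_succ_ne_zero h
    rcases Nat.lt_succ_iff_lt_or_eq.1 hjk with h2 | h2
    · exact ih h2 (by rw [h1]; exact one_ne_zero)
    · rw [h2]; exact h1

theorem hcut_locally_eq (k : ℕ) (z : E (m + 1)) : ∃ e : E (m + 1), e 0 = 0 ∧
    S.hcut k =ᶠ[𝓝 z] fun y => ∏ i : Fin m, S.bump ((y i.succ - e i.succ) / S.lam ^ k) := by
  choose e he using fun i : Fin m => S.chi_locally_eq k (z i.succ)
  refine ⟨WithLp.toLp 2 (Fin.cons 0 e), by simp, ?_⟩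
  have h1 : ∀ i : Fin m, ∀ᶠ y : E (m + 1) in 𝓝 z,
      S.chi k (y i.succ) = S.bump ((y i.succ - e i) / S.lam ^ k) := fun i => by
    have hc : ContinuousAt (fun y : E (m + 1) => y i.succ) z := by fun_prop
    exact hc.eventually (he i)
  filter_upwards [eventually_all.2 h1] with y hy
  unfold hcut
  refine Finset.prod_congr rfl fun i _ => ?_
  rw [hy i]
  simp

/-- The building blocks of the singular function. -/
def block (k : ℕ) (z : E (m + 1)) : ℝ := S.hcut k z * S.prof (z 0 / S.lam ^ k)

/-- The terms of the coefficient that penalizes oscillation over the Cantor set. -/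
def outTerm (β : ℝ) (k : ℕ) (z : E (m + 1)) : ℝ :=
  (S.lam ^ k) ^ β * (S.psi (z 0 / S.lam ^ k) * S.hcut (k + 3) z)

/-- The terms of the coefficient that makes gradients equiintegrable. -/
def inTerm (β : ℝ) (k : ℕ) (z : E (m + 1)) : ℝ := (S.lam ^ k) ^ β * S.psi (z 0 / S.lam ^ k)

theorem hasBoundedDerivs_coord {f : ℝ → ℝ} (hf : HasBoundedDerivs f) (c : ℝ) (i : Fin (m + 1)) :
    HasBoundedDerivs fun z : E (m + 1) => f (c * z i) := by
  exact hf.comp_clm (c • (EuclideanSpace.proj i : E (m + 1) →L[ℝ] ℝ))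

theorem hasBoundedDerivs_hprod (c : ℝ) :
    HasBoundedDerivs fun z : E (m + 1) => ∏ i : Fin m, S.bump (c * z i.succ) :=
  HasBoundedDerivs.prod _ fun i _ => hasBoundedDerivs_coord S.hasBoundedDerivs_bump c i.succ

theorem isScaledFamily_block : IsScaledFamily S.lam 0
    (fun z : E (m + 1) => (∏ i : Fin m, S.bump (1 * z i.succ)) * S.prof (1 * z 0)) S.block := by
  intro k z
  obtain ⟨e, he0, he⟩ := S.hcut_locally_eq k z
  refine ⟨e, ?_⟩
  filter_upwards [he] with y hy
  unfold block
  rw [hy]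
  simp [he0, div_eq_inv_mul]

theorem isScaledFamily_outTerm (β : ℝ) : IsScaledFamily S.lam β
    (fun z : E (m + 1) => S.psi (1 * z 0) * ∏ i : Fin m, S.bump ((S.lam ^ 3)⁻¹ * z i.succ))
    (S.outTerm β) := by
  intro k z
  obtain ⟨e, he0, he⟩ := S.hcut_locally_eq (k + 3) z
  refine ⟨e, ?_⟩
  filter_upwards [he] with y hy
  unfold outTerm
  rw [hy]
  simp only [one_mul, PiLp.smul_apply, PiLp.sub_apply, he0, sub_zero, smul_eq_mul,
    div_eq_inv_mul, pow_add, mul_inv, ← mul_assoc]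
  simp only [mul_comm ((S.lam ^ 3)⁻¹)]

theorem isScaledFamily_inTerm (β : ℝ) : IsScaledFamily S.lam β
    (fun z : E (m + 1) => S.psi (1 * z 0)) (S.inTerm β) := by
  intro k z
  refine ⟨0, Eventually.of_forall fun y => ?_⟩
  simp [inTerm, div_eq_inv_mul]

theorem hasBoundedDerivs_blockModel : HasBoundedDerivs
    (fun z : E (m + 1) => (∏ i : Fin m, S.bump (1 * z i.succ)) * S.prof (1 * z 0)) :=
  (S.hasBoundedDerivs_hprod 1).mul (hasBoundedDerivs_coord S.hasBoundedDerivs_prof 1 0)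

theorem hasBoundedDerivs_outModel : HasBoundedDerivs
    (fun z : E (m + 1) => S.psi (1 * z 0) * ∏ i : Fin m, S.bump ((S.lam ^ 3)⁻¹ * z i.succ)) :=
  (hasBoundedDerivs_coord S.hasBoundedDerivs_psi 1 0).mul (S.hasBoundedDerivs_hprod _)

theorem hasBoundedDerivs_inModel : HasBoundedDerivs (fun z : E (m + 1) => S.psi (1 * z 0)) :=
  hasBoundedDerivs_coord S.hasBoundedDerivs_psi 1 0

theorem contDiff_block (k : ℕ) : ContDiff ℝ ∞ (S.block k : E (m + 1) → ℝ) :=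
  S.isScaledFamily_block.contDiff S.hasBoundedDerivs_blockModel k

theorem contDiff_one_block (k : ℕ) : ContDiff ℝ 1 (S.block k : E (m + 1) → ℝ) :=
  (S.contDiff_block k).of_le (by exact_mod_cast le_top)

theorem exists_norm_gradient_block_le :
    ∃ C : ℝ, 0 ≤ C ∧ ∀ k (z : E (m + 1)), ‖gradient (S.block k) z‖ ≤ C * (S.lam ^ k)⁻¹ := by
  obtain ⟨C, hC⟩ := (S.hasBoundedDerivs_blockModel (m := m)).2 1
  refine ⟨C, (norm_nonneg _).trans (hC 0), fun k z => ?_⟩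
  have := S.isScaledFamily_block.norm_iteratedFDeriv_le S.hasBoundedDerivs_blockModel S.lam_pos
    hC k z
  rw [norm_gradient_eq_norm_fderiv, ← norm_iteratedFDeriv_one]
  refine this.trans (le_of_eq ?_)
  simp [Real.rpow_neg_one]

theorem abs_block_le (k : ℕ) (z : E (m + 1)) : |S.block k z| ≤ 2 := by
  unfold block
  rw [abs_mul, abs_of_nonneg (S.hcut_nonneg k z)]
  have h1 := S.hcut_le_one k z
  have h2 := S.abs_prof_le (z 0 / S.lam ^ k)
  have h3 := S.hcut_nonneg k z
  nlinarith [abs_nonneg (S.prof (z 0 / S.lam ^ k))]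

/-- The set carrying the `k`-th block. -/
def slab (k : ℕ) : Set (E (m + 1)) := {z | S.InWindow k (z 0) ∧ S.hcut k z ≠ 0}

theorem block_eq_zero {k : ℕ} {z : E (m + 1)} (hz : z ∉ S.slab k) : S.block k z = 0 := by
  by_contra h0
  refine hz ⟨?_, fun h => h0 (by simp [block, h])⟩
  have h1 := S.inWindow_of_prof_ne_zero (k := k) (t := z 0) (fun h => h0 (by simp [block, h]))
  refine ⟨le_trans ?_ h1.1.le, h1.2.le⟩
  exact pow_le_pow_of_le_one S.lam_pos.le S.lam_lt_one.le (by omega)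

/-- `slab` is not closed, so vanishing of the block outside it is not enough. Where `hcut` vanishes
it attains its minimum, so its differential vanishes as well and the product rule kills the
gradient. Outside the closed window of heights the block vanishes in a neighbourhood. -/
theorem gradient_block_eq_zero {k : ℕ} {z : E (m + 1)} (hz : z ∉ S.slab k) :
    gradient (S.block k) z = 0 := by
  have hcont : Continuous fun y : E (m + 1) => |y 0| := by fun_prop
  have hwin : S.InWindow k (z 0) ∨ S.block k =ᶠ[𝓝 z] 0 := by
    by_cases h1 : S.lam ^ (k + 2) ≤ |z 0|
    · by_cases h2 : |z 0| ≤ 2 * S.lam ^ k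
      · exact Or.inl ⟨h1, h2⟩
      · right
        filter_upwards [hcont.continuousAt.eventually (Ioi_mem_nhds (not_le.1 h2))] with y hy
        exact S.block_eq_zero fun h => absurd h.1.2 (not_le.2 hy)
    · right
      filter_upwards [hcont.continuousAt.eventually (Iio_mem_nhds (not_le.1 h1))] with y hy
      exact S.block_eq_zero fun h => absurd h.1.1 (not_le.2 hy)
  rcases hwin with hw | hw
  · have h0 : S.hcut k z = 0 := by
      by_contra h0
      exact hz ⟨hw, h0⟩
    have hmin : IsLocalMin (S.hcut k) z := Eventually.of_forall fun y => by
      rw [h0]; exact S.hcut_nonneg k y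
    have hd := hmin.fderiv_eq_zero
    have d1 : HasFDerivAt (S.hcut k) (0 : E (m + 1) →L[ℝ] ℝ) z := by
      rw [← hd]
      exact ((S.contDiff_hcut k).differentiable (by simp) z).hasFDerivAt
    have hp : ContDiff ℝ ∞ fun y : E (m + 1) => S.prof (y 0 / S.lam ^ k) :=
      S.contDiff_prof.comp (by fun_prop)
    have d2 := (hp.differentiable (by simp) z).hasFDerivAt
    have d3 := d1.mul d2
    rw [h0, zero_smul, smul_zero, add_zero] at d3
    unfold gradient
    have : fderiv ℝ (S.block k) z = 0 := d3.fderiv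
    rw [this, map_zero]
  · rw [hw.gradient_eq]
    unfold gradient
    simp

/-- The part of the strip of height comparable to `lam ^ k` over the `k`-th generation. -/
def thick (k : ℕ) : Set (E (m + 1)) := {z | |z 0| ≤ 2 * S.lam ^ k ∧ S.hcut k z ≠ 0}

theorem slab_subset_thick (k : ℕ) : (S.slab k : Set (E (m + 1))) ⊆ S.thick k :=
  fun _ hz => ⟨hz.1.2, hz.2⟩

theorem volume_thick_le (k : ℕ) : volume (S.thick k : Set (E (m + 1))) ≤
    ENNReal.ofReal (4 * S.lam ^ k * (2 * (2 * S.lam) ^ k) ^ m) := by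
  set B : Fin (m + 1) → Set ℝ := Fin.cons (Icc (-(2 * S.lam ^ k)) (2 * S.lam ^ k))
    (fun _ => {x | S.chi k x ≠ 0}) with hB
  have hBm : ∀ i, MeasurableSet (B i) := by
    refine Fin.cases ?_ fun i => ?_
    · exact measurableSet_Icc
    · simp only [hB, Fin.cons_succ]
      exact (isOpen_ne_fun (S.contDiff_chi k).continuous continuous_const).measurableSet
  have hsub : (S.thick k : Set (E (m + 1))) ⊆ WithLp.ofLp ⁻¹' (Set.pi univ B) := by
    intro z hz i _
    refine Fin.cases ?_ (fun i => ?_) i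
    · exact abs_le.1 hz.1
    · exact S.chi_ne_zero_of_hcut_ne_zero hz.2 i
  refine (measure_mono hsub).trans ?_
  have hl := S.lam_pow_pos k
  have hl0 := S.lam_pos
  rw [(PiLp.volume_preserving_ofLp (Fin (m + 1))).measure_preimage
    (MeasurableSet.univ_pi hBm).nullMeasurableSet, volume_pi_pi, Fin.prod_univ_succ]
  simp only [hB, Fin.cons_zero, Fin.cons_succ, Real.volume_Icc, Finset.prod_const,
    Finset.card_univ, Fintype.card_fin]
  rw [ENNReal.ofReal_mul (by positivity), ENNReal.ofReal_pow (by positivity)]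
  gcongr
  · linarith
  · exact S.volume_support_chi_le k

/-- For `k ≥ 1` the height `2 * lam^k` stays below `1`. The block of index `0` reaches the top and
bottom faces and serves as the boundary datum. -/
theorem isTestFunction_block {k : ℕ} (hk : 1 ≤ k) :
    IsTestFunction (cube (m + 1)) (S.block k) := by
  set K : Set (E (m + 1)) := {z | |z 0| ≤ 2 * S.lam ^ k ∧ ∀ i : Fin m, |z i.succ| ≤ 1 / 2 + S.w}
    with hK
  have hlk : 2 * S.lam ^ k < 1 := by
    have : S.lam ^ k ≤ S.lam ^ 1 := pow_le_pow_of_le_one S.lam_pos.le S.lam_lt_one.le hk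
    rw [pow_one] at this
    linarith [S.lam_lt]
  have hKc : IsClosed K := by
    have h1 : IsClosed {z : E (m + 1) | |z 0| ≤ 2 * S.lam ^ k} :=
      isClosed_le (by fun_prop) (by fun_prop)
    have h2 : IsClosed {z : E (m + 1) | ∀ i : Fin m, |z i.succ| ≤ 1 / 2 + S.w} := by
      simp only [ofPred_forall]
      exact isClosed_iInter fun i => isClosed_le (by fun_prop) (by fun_prop)
    exact h1.inter h2
  have hKsub : K ⊆ cube (m + 1) := by
    intro z hz i
    refine Fin.cases ?_ (fun i => ?_) i
    · exact abs_lt.1 (hz.1.trans_lt hlk)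
    · exact abs_lt.1 ((hz.2 i).trans_lt (by linarith [S.w_lt]))
  have hKcomp : IsCompact K :=
    isCompact_closedCube.of_isClosed_subset hKc (hKsub.trans cube_subset_closedCube)
  have hsupp : Function.support (S.block k : E (m + 1) → ℝ) ⊆ K := by
    intro z hz
    have hz' : z ∈ S.slab k := by
      by_contra h0
      exact hz (S.block_eq_zero h0)
    refine ⟨hz'.1.2, fun i => ?_⟩
    by_contra h0
    exact S.chi_ne_zero_of_hcut_ne_zero hz'.2 i (S.chi_eq_zero k (not_le.1 h0).le)
  refine ⟨S.contDiff_block k, HasCompactSupport.of_support_subset_isCompact hKcomp hsupp, ?_⟩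
  exact (closure_minimal hsupp hKc).trans hKsub

end CantorScale

end Blocks

/-! ### The two coefficients and the gradient of the competitor -/

section Coefficients

namespace CantorScale

variable (S : CantorScale) {m : ℕ}

/-- The coefficient that penalizes oscillation over the Cantor set. -/
def aOut (β : ℝ) (z : E (m + 1)) : ℝ := ∑' k, S.outTerm β k z

/-- The coefficient that makes gradients equiintegrable, comparable to `|t| ^ β`. -/
def aIn (β : ℝ) (z : E (m + 1)) : ℝ := ∑' k, S.inTerm β k z

theorem outTerm_nonneg (β : ℝ) (k : ℕ) (z : E (m + 1)) : 0 ≤ S.outTerm β k z :=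
  mul_nonneg (Real.rpow_nonneg (S.lam_pow_pos k).le _)
    (mul_nonneg (S.psi_nonneg _) (S.hcut_nonneg _ _))

theorem inTerm_nonneg (β : ℝ) (k : ℕ) (z : E (m + 1)) : 0 ≤ S.inTerm β k z :=
  mul_nonneg (Real.rpow_nonneg (S.lam_pow_pos k).le _) (S.psi_nonneg _)

theorem aOut_nonneg (β : ℝ) (z : E (m + 1)) : 0 ≤ S.aOut β z :=
  tsum_nonneg fun k => S.outTerm_nonneg β k z

theorem aIn_nonneg (β : ℝ) (z : E (m + 1)) : 0 ≤ S.aIn β z :=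
  tsum_nonneg fun k => S.inTerm_nonneg β k z

theorem inWindow_of_inTerm_ne_zero {β : ℝ} {k : ℕ} {z : E (m + 1)} (h : S.inTerm β k z ≠ 0) :
    S.InWindow k (z 0) := S.inWindow_of_psi_ne_zero fun h0 => h (by simp [inTerm, h0])

theorem outTerm_le_inTerm (β : ℝ) (k : ℕ) (z : E (m + 1)) :
    S.outTerm β k z ≤ S.inTerm β k z := by
  unfold outTerm inTerm
  have h1 : 0 ≤ (S.lam ^ k) ^ β := Real.rpow_nonneg (S.lam_pow_pos k).le _
  gcongr
  exact mul_le_of_le_one_right (S.psi_nonneg _) (S.hcut_le_one _ _)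

theorem summable_inTerm (β : ℝ) {z : E (m + 1)} (hz : |z 0| ≤ 1) :
    Summable fun k => S.inTerm β k z := by
  obtain ⟨s, -, hs⟩ := S.exists_window_finset hz
  exact summable_of_ne_finset_zero (s := s) fun k hk => by
    by_contra h0
    exact hk (hs k (S.inWindow_of_inTerm_ne_zero h0))

theorem summable_outTerm (β : ℝ) {z : E (m + 1)} (hz : |z 0| ≤ 1) :
    Summable fun k => S.outTerm β k z :=
  Summable.of_nonneg_of_le (fun k => S.outTerm_nonneg β k z) (fun k => S.outTerm_le_inTerm β k z)
    (S.summable_inTerm β hz)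

theorem aOut_le_aIn (β : ℝ) {z : E (m + 1)} (hz : |z 0| ≤ 1) : S.aOut β z ≤ S.aIn β z :=
  (S.summable_outTerm β hz).tsum_le_tsum (fun k => S.outTerm_le_inTerm β k z)
    (S.summable_inTerm β hz)

/-- At most four terms are nonzero at a given height, and a nonzero one has `lam^k ≤ |t| / lam^2`.
-/
theorem aIn_le {β : ℝ} (hβ : 0 ≤ β) {z : E (m + 1)} (hz : |z 0| ≤ 1) :
    S.aIn β z ≤ 4 * (|z 0| / S.lam ^ 2) ^ β := by
  have hl := S.lam_pos
  obtain ⟨s, hc, hs⟩ := S.exists_window_finset hz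
  have hb : ∀ k, S.inTerm β k z ≤ (|z 0| / S.lam ^ 2) ^ β := by
    intro k
    by_cases h0 : S.inTerm β k z = 0
    · rw [h0]; positivity
    · have hw := (S.inWindow_of_inTerm_ne_zero h0).1
      have h1 : S.lam ^ k ≤ |z 0| / S.lam ^ 2 := by
        rw [le_div_iff₀ (by positivity), ← pow_add]; exact hw
      calc S.inTerm β k z ≤ (S.lam ^ k) ^ β * 1 := by
            unfold inTerm; gcongr; exact S.psi_le_one _
        _ ≤ _ := by rw [mul_one]; exact Real.rpow_le_rpow (S.lam_pow_pos k).le h1 hβ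
  unfold aIn
  rw [tsum_eq_sum (s := s) fun k hk => by
    by_contra h0
    exact hk (hs k (S.inWindow_of_inTerm_ne_zero h0))]
  refine (Finset.sum_le_card_nsmul s _ _ fun k _ => hb k).trans ?_
  rw [nsmul_eq_mul]
  gcongr
  exact_mod_cast hc

theorem aIn_le_const {β : ℝ} (hβ : 0 ≤ β) {z : E (m + 1)} (hz : |z 0| ≤ 1) :
    S.aIn β z ≤ 4 * (1 / S.lam ^ 2) ^ β := by
  have hl := S.lam_pos
  refine (S.aIn_le hβ hz).trans ?_
  gcongr

theorem rpow_le_aIn {β : ℝ} (hβ : 0 ≤ β) {z : E (m + 1)} (h0 : z 0 ≠ 0) (hz : |z 0| ≤ 1) :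
    |z 0| ^ β ≤ S.aIn β z := by
  obtain ⟨k, hk1, hk2⟩ := S.exists_scale h0 hz
  have hlk := S.lam_pow_pos k
  refine le_trans ?_ ((S.summable_inTerm β hz).le_tsum k fun j _ => S.inTerm_nonneg β j z)
  unfold inTerm
  rw [S.psi_eq_one, mul_one]
  · exact Real.rpow_le_rpow (abs_nonneg _) hk2 hβ
  · rw [abs_div, abs_of_pos hlk, le_div_iff₀ hlk, mul_comm, ← pow_succ]; exact hk1.le
  · rw [abs_div, abs_of_pos hlk, div_le_one hlk]; exact hk2

theorem rpow_le_aOut {β : ℝ} (hβ : 0 ≤ β) {z : E (m + 1)} {k : ℕ} (hk1 : S.lam ^ (k + 1) ≤ |z 0|)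
    (hk2 : |z 0| ≤ S.lam ^ k) (h : S.hcut (k + 3) z = 1) : |z 0| ^ β ≤ S.aOut β z := by
  have hlk := S.lam_pow_pos k
  have hz : |z 0| ≤ 1 := hk2.trans (pow_le_one₀ S.lam_pos.le S.lam_lt_one.le)
  refine le_trans ?_ ((S.summable_outTerm β hz).le_tsum k fun j _ => S.outTerm_nonneg β j z)
  unfold outTerm
  rw [S.psi_eq_one, h, mul_one, mul_one]
  · exact Real.rpow_le_rpow (abs_nonneg _) hk2 hβ
  · rw [abs_div, abs_of_pos hlk, le_div_iff₀ hlk, mul_comm, ← pow_succ]; exact hk1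
  · rw [abs_div, abs_of_pos hlk, div_le_one hlk]; exact hk2

theorem continuous_aOut {β : ℝ} (hβ : 0 < β) : Continuous (S.aOut β : E (m + 1) → ℝ) :=
  ((S.isScaledFamily_outTerm β).contDiff_tsum S.hasBoundedDerivs_outModel S.lam_pos S.lam_lt_one
    (N := 0) (by simpa using hβ)).continuous

theorem continuous_aIn {β : ℝ} (hβ : 0 < β) : Continuous (S.aIn β : E (m + 1) → ℝ) :=
  ((S.isScaledFamily_inTerm β).contDiff_tsum S.hasBoundedDerivs_inModel S.lam_pos S.lam_lt_one
    (N := 0) (by simpa using hβ)).continuous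

theorem memHolderClass_coefficient {α β γ : ℝ} (hα : 0 ≤ α) (hβ : α < β) (hγ : α < γ) (θ : ℝ) :
    MemHolderClass α (closedCube (m + 1)) fun z => S.aOut β z + θ * S.aIn γ z := by
  have hN : (⌊α⌋₊ : ℝ) ≤ α := Nat.floor_le hα
  have hN1 : α ≤ ⌊α⌋₊ + 1 := (Nat.lt_floor_add_one α).le
  have c1 : ContDiff ℝ (⌊α⌋₊ : ℕ) (S.aOut β : E (m + 1) → ℝ) :=
    (S.isScaledFamily_outTerm β).contDiff_tsum S.hasBoundedDerivs_outModel
      S.lam_pos S.lam_lt_one (N := ⌊α⌋₊) (by linarith)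
  have c2 : ContDiff ℝ (⌊α⌋₊ : ℕ) (S.aIn γ : E (m + 1) → ℝ) :=
    (S.isScaledFamily_inTerm γ).contDiff_tsum S.hasBoundedDerivs_inModel
      S.lam_pos S.lam_lt_one (N := ⌊α⌋₊) (by linarith)
  obtain ⟨C₁, hC₁, b1⟩ := (S.isScaledFamily_outTerm (m := m) β).exists_holder
    S.hasBoundedDerivs_outModel S.lam_pos S.lam_lt_one hN hN1 hβ
  obtain ⟨C₂, hC₂, b2⟩ := (S.isScaledFamily_inTerm (m := m) γ).exists_holder
    S.hasBoundedDerivs_inModel S.lam_pos S.lam_lt_one hN hN1 hγ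
  have c3 : ContDiff ℝ (⌊α⌋₊ : ℕ) (fun z => θ * S.aIn γ z : E (m + 1) → ℝ) :=
    contDiff_const.mul c2
  refine memHolderClass_of_holder (c1.add c3) hα (C := C₁ + |θ| * C₂) (by positivity)
    fun x y => ?_
  have e : ∀ x, iteratedFDeriv ℝ ⌊α⌋₊ (fun z : E (m + 1) => S.aOut β z + θ * S.aIn γ z) x
      = iteratedFDeriv ℝ ⌊α⌋₊ (S.aOut β) x + θ • iteratedFDeriv ℝ ⌊α⌋₊ (S.aIn γ) x := by
    intro x
    have h1 := iteratedFDeriv_add_apply (x := x) c1.contDiffAt c3.contDiffAt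
    have h2 : iteratedFDeriv ℝ ⌊α⌋₊ (fun z : E (m + 1) => θ * S.aIn γ z) x
        = θ • iteratedFDeriv ℝ ⌊α⌋₊ (S.aIn γ) x :=
      iteratedFDeriv_const_smul_apply' (𝕜 := ℝ) (a := θ) c2.contDiffAt
    rw [← h2, ← h1]
    rfl
  have e' : ∀ A B A' B' : ContinuousMultilinearMap ℝ (fun _ : Fin ⌊α⌋₊ => E (m + 1)) ℝ,
      A + θ • B - (A' + θ • B') = (A - A') + θ • (B - B') := fun A B A' B' => by module
  rw [e, e, e', add_mul]
  refine (norm_add_le _ _).trans (add_le_add (b1 x y) ?_)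
  rw [norm_smul, Real.norm_eq_abs, mul_assoc]
  exact mul_le_mul_of_nonneg_left (b2 x y) (abs_nonneg θ)

/-- The gradient of the singular function. -/
def gstar (z : E (m + 1)) : E (m + 1) := ∑' k, gradient (S.block k) z

theorem gradient_block_ne_zero {k : ℕ} {z : E (m + 1)} (h : gradient (S.block k) z ≠ 0) :
    z ∈ S.slab k := by
  by_contra h0
  exact h (S.gradient_block_eq_zero h0)

theorem summable_gradient_block {z : E (m + 1)} (hz : |z 0| ≤ 1) :
    Summable fun k => gradient (S.block k) z := by
  obtain ⟨s, -, hs⟩ := S.exists_window_finset hz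
  exact summable_of_ne_finset_zero (s := s) fun k hk => by
    by_contra h0
    exact hk (hs k (S.gradient_block_ne_zero h0).1)

theorem summable_block {z : E (m + 1)} (hz : |z 0| ≤ 1) : Summable fun k => S.block k z := by
  obtain ⟨s, -, hs⟩ := S.exists_window_finset hz
  exact summable_of_ne_finset_zero (s := s) fun k hk => by
    by_contra h0
    refine hk (hs k ?_)
    by_contra h1
    exact h0 (S.block_eq_zero fun h => h1 h.1)

theorem gradient_sum {ι : Type*} (s : Finset ι) {n : ℕ} {f : ι → E n → ℝ}
    (hf : ∀ i ∈ s, ContDiff ℝ 1 (f i)) (x : E n) :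
    gradient (fun y => ∑ i ∈ s, f i y) x = ∑ i ∈ s, gradient (f i) x := by
  unfold gradient
  rw [fderiv_fun_sum fun i hi => (hf i hi).differentiable one_ne_zero x, map_sum]

/-- The singular function is locally constant where the penalizing coefficient is positive. -/
theorem gstar_eq_zero {β : ℝ} {z : E (m + 1)} (hz : |z 0| < 1) (h : S.aOut β z ≠ 0) :
    S.gstar z = 0 := by
  obtain ⟨k, hk⟩ : ∃ k, S.outTerm β k z ≠ 0 := by
    by_contra h0
    push Not at h0
    exact h (by simp [aOut, h0])
  have hl := S.lam_pos
  have hpsi : S.psi (z 0 / S.lam ^ k) ≠ 0 := fun h0 => hk (by simp [outTerm, h0])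
  have hcut : S.hcut (k + 3) z ≠ 0 := fun h0 => hk (by simp [outTerm, h0])
  have hlow : S.lam ^ (k + 2) < |z 0| := by
    have := S.lt_abs_of_psi_ne_zero hpsi
    rw [abs_div, abs_of_pos (S.lam_pow_pos k), lt_div_iff₀ (S.lam_pow_pos k)] at this
    rw [pow_add, mul_comm]; exact this
  -- The term of index `k` lives at heights above `lam^(k+2)`, and `2 * lam < 1` puts all blocks of
  -- index at least `k + 3` strictly below. This is why `outTerm` uses the cutoff of generation `k +
  -- 3`.
  have hzero : ∀ j ∉ Finset.range (k + 3), gradient (S.block j) z = 0 := by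
    intro j hj
    by_contra h0
    have h1 := (S.gradient_block_ne_zero h0).1.2
    have hj' : k + 3 ≤ j := by simpa using hj
    have h2 : S.lam ^ j ≤ S.lam ^ (k + 3) := pow_le_pow_of_le_one hl.le S.lam_lt_one.le hj'
    have h3 : S.lam ^ (k + 3) = S.lam ^ (k + 2) * S.lam := pow_succ _ _
    nlinarith [S.lam_lt, S.lam_pow_pos (k + 2)]
  unfold gstar
  rw [tsum_eq_sum hzero, ← gradient_sum _ fun j _ => S.contDiff_one_block j]
  -- Near `z` the cutoff of generation `k + 3` is nonzero, so by nesting all cutoffs of the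
  -- remaining blocks equal `1`. Their sum telescopes and is locally the constant `sign t`.
  have hev : (fun y : E (m + 1) => ∑ j ∈ Finset.range (k + 3), S.block j y)
      =ᶠ[𝓝 z] fun _ => if 0 < z 0 then 1 else -1 := by
    have hco : Continuous fun y : E (m + 1) => y 0 := by fun_prop
    have hca : Continuous fun y : E (m + 1) => |y 0| := by fun_prop
    have hsign : ∀ᶠ y : E (m + 1) in 𝓝 z, (0 < y 0 ↔ 0 < z 0) := by
      have hne : z 0 ≠ 0 := fun h0 => by
        rw [h0, abs_zero] at hlow
        linarith [S.lam_pow_pos (k + 2)]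
      rcases lt_or_gt_of_ne hne with h1 | h1
      · filter_upwards [hco.continuousAt.eventually (Iio_mem_nhds h1)] with y hy
        exact ⟨fun h => absurd h (not_lt.2 (le_of_lt hy)), fun h => absurd h (not_lt.2 h1.le)⟩
      · filter_upwards [hco.continuousAt.eventually (Ioi_mem_nhds h1)] with y hy
        exact ⟨fun _ => h1, fun _ => hy⟩
    filter_upwards [hsign, hca.continuousAt.eventually (Ioi_mem_nhds hlow),
      hca.continuousAt.eventually (Iio_mem_nhds hz),
      (S.contDiff_hcut (k + 3)).continuous.continuousAt.eventually_ne hcut] with y h1 h2 h3 h4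
    have h2 : S.lam ^ (k + 2) < |y 0| := h2
    have h3 : |y 0| < 1 := h3
    have e1 : ∀ j ∈ Finset.range (k + 3), S.block j y = S.prof (y 0 / S.lam ^ j) := by
      intro j hj
      unfold block
      rw [S.hcut_eq_one_of_lt (by simpa using hj) h4, one_mul]
    rw [Finset.sum_congr rfl e1, S.sum_prof (k + 2)]
    have e2 : S.stp (S.lam * y 0) = 0 := by
      refine S.stp_eq_zero ?_
      rw [abs_mul, abs_of_pos hl]
      nlinarith
    rw [e2, sub_zero]
    have hlk := S.lam_pow_pos (k + 2)
    have hl2 := S.lam_lt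
    split_ifs with hs
    · have hy := h1.2 hs
      refine S.stp_eq_one ?_
      rw [abs_of_pos hy] at h2
      rw [le_div_iff₀ hlk]; nlinarith
    · have hy : y 0 ≤ 0 := not_lt.1 fun h => hs (h1.1 h)
      refine S.stp_eq_neg_one ?_
      rw [abs_of_nonpos hy] at h2
      rw [div_le_iff₀ hlk]; nlinarith
  rw [hev.gradient_eq]
  unfold gradient
  simp

end CantorScale

end Coefficients

/-! ### Series of test functions -/

section SeriesLimits

variable {n : ℕ} {F : Type*} [NormedAddCommGroup F]

/-- The remainder is dominated by the tail of the convergent series of norms. -/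
theorem tendsto_lintegral_tsum_sub_sum {Ω : Set (E n)} (hΩ : MeasurableSet Ω) {f : ℕ → E n → F}
    (hf : ∀ k, AEStronglyMeasurable (f k) (volume.restrict Ω))
    (hs : ∀ x ∈ Ω, Summable fun k => f k x) (h : ∑' k, ∫⁻ x in Ω, ‖f k x‖ₑ ≠ ⊤) :
    Tendsto (fun N => ∫⁻ x in Ω, ‖(∑' k, f k x) - ∑ k ∈ Finset.range N, f k x‖ₑ) atTop (𝓝 0) := by
  refine tendsto_of_tendsto_of_tendsto_of_le_of_le tendsto_const_nhds
    (ENNReal.tendsto_sum_nat_add _ h) (fun _ => zero_le) fun N => ?_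
  show _ ≤ ∑' k, ∫⁻ x in Ω, ‖f (k + N) x‖ₑ
  rw [← lintegral_tsum fun k => (hf (k + N)).enorm]
  refine setLIntegral_mono_ae' hΩ (Eventually.of_forall fun x hx => ?_)
  rw [← (hs x hx).sum_add_tsum_nat_add N, add_sub_cancel_left]
  exact enorm_tsum_le_tsum_enorm

theorem aestronglyMeasurable_tsum {Ω : Set (E n)} (hΩ : MeasurableSet Ω) {f : ℕ → E n → F}
    (hf : ∀ k, AEStronglyMeasurable (f k) (volume.restrict Ω))
    (hs : ∀ x ∈ Ω, Summable fun k => f k x) :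
    AEStronglyMeasurable (fun x => ∑' k, f k x) (volume.restrict Ω) := by
  refine aestronglyMeasurable_of_tendsto_ae atTop
    (f := fun N x => ∑ k ∈ Finset.range N, f k x) (fun N => ?_) ?_
  · exact Finset.aestronglyMeasurable_fun_sum _ fun k _ => hf k
  · filter_upwards [ae_restrict_mem hΩ] with x hx
    exact (hs x hx).hasSum.tendsto_sum_nat

theorem memLp_one_tsum {Ω : Set (E n)} (hΩ : MeasurableSet Ω) {f : ℕ → E n → F}
    (hf : ∀ k, AEStronglyMeasurable (f k) (volume.restrict Ω))
    (hs : ∀ x ∈ Ω, Summable fun k => f k x) (h : ∑' k, ∫⁻ x in Ω, ‖f k x‖ₑ ≠ ⊤) :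
    MemLp (fun x => ∑' k, f k x) 1 (volume.restrict Ω) := by
  refine ⟨aestronglyMeasurable_tsum hΩ hf hs, ?_⟩
  rw [eLpNorm_one_eq_lintegral_enorm]
  refine lt_of_le_of_lt ?_ (lt_top_iff_ne_top.2 h)
  rw [← lintegral_tsum fun k => (hf k).enorm]
  exact lintegral_mono fun x => enorm_tsum_le_tsum_enorm

theorem IsTestFunction.sum {Ω : Set (E n)} {f : ℕ → E n → ℝ} (hf : ∀ k, IsTestFunction Ω (f k))
    (N : ℕ) : IsTestFunction Ω fun x => ∑ k ∈ Finset.range N, f k x := by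
  induction N with
  | zero => simpa using (hf 0).linear_comb (hf 0) 0 0
  | succ N ih => simpa [Finset.sum_range_succ] using ih.linear_comb (hf N) 1 1

theorem IsL1Limit.tsum {Ω : Set (E n)} (hΩ : MeasurableSet Ω) {f : ℕ → E n → ℝ}
    (hf : ∀ k, IsTestFunction Ω (f k)) (hs : ∀ x ∈ Ω, Summable fun k => f k x)
    (hs' : ∀ x ∈ Ω, Summable fun k => gradient (f k) x)
    (h : ∑' k, ∫⁻ x in Ω, ‖f k x‖ₑ ≠ ⊤) (h' : ∑' k, ∫⁻ x in Ω, ‖gradient (f k) x‖ₑ ≠ ⊤) :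
    IsL1Limit (testFunctions Ω) Ω (fun x => ∑' k, f k x) fun x => ∑' k, gradient (f k) x := by
  have m1 : ∀ k, AEStronglyMeasurable (f k) (volume.restrict Ω) := fun k =>
    (hf k).1.continuous.aestronglyMeasurable
  have m2 : ∀ k, AEStronglyMeasurable (gradient (f k)) (volume.restrict Ω) := fun k =>
    (continuous_gradient (hf k).contDiff_one).aestronglyMeasurable
  refine ⟨memLp_one_tsum hΩ m1 hs h, memLp_one_tsum hΩ m2 hs' h', fun δ hδ => ?_⟩
  have e1 := (tendsto_lintegral_tsum_sub_sum hΩ m1 hs h).eventually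
    (Iic_mem_nhds (pos_iff_ne_zero.2 hδ))
  have e2 := (tendsto_lintegral_tsum_sub_sum hΩ m2 hs' h').eventually
    (Iic_mem_nhds (pos_iff_ne_zero.2 hδ))
  obtain ⟨N, h1, h2⟩ := (e1.and e2).exists
  refine ⟨_, IsTestFunction.sum hf N, h1, ?_⟩
  simp_rw [CantorScale.gradient_sum _ fun k _ => (hf k).contDiff_one]
  exact h2

end SeriesLimits

/-! ### Integrability of the competitor -/

section SingularFunction

namespace CantorScale

variable (S : CantorScale) {m : ℕ} {e : ℝ}

theorem measurableSet_slab (k : ℕ) : MeasurableSet (S.slab k : Set (E (m + 1))) := by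
  have h0 : Measurable fun z : E (m + 1) => |z 0| := by fun_prop
  have h1 : MeasurableSet {z : E (m + 1) | S.lam ^ (k + 2) ≤ |z 0|} :=
    measurableSet_le measurable_const h0
  have h2 : MeasurableSet {z : E (m + 1) | |z 0| ≤ 2 * S.lam ^ k} :=
    measurableSet_le h0 measurable_const
  have h3 : MeasurableSet {z : E (m + 1) | S.hcut k z ≠ 0} :=
    (isOpen_ne_fun (S.contDiff_hcut k).continuous continuous_const).measurableSet
  exact (h1.inter h2).inter h3

/-- The relation `he` encodes the dimension `m - e` of the Cantor product: its neighbourhood at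
scale `r = lam^k` has horizontal volume of order `r^e`, and the height contributes one more factor
`r`. -/
theorem volume_thick_le_rpow (he : (2 * S.lam) ^ m = S.lam ^ e) (k : ℕ) :
    volume (S.thick k : Set (E (m + 1))) ≤ ENNReal.ofReal (4 * 2 ^ m * (S.lam ^ k) ^ (1 + e)) := by
  refine (S.volume_thick_le k).trans (le_of_eq ?_)
  congr 1
  have hk := S.lam_pow_pos k
  have h1 : ((2 * S.lam) ^ k) ^ m = (S.lam ^ k) ^ e := by
    rw [← pow_mul, mul_comm k m, pow_mul, he, ← Real.rpow_natCast, ← Real.rpow_mul S.lam_pos.le,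
      ← Real.rpow_natCast, ← Real.rpow_mul S.lam_pos.le, mul_comm]
  rw [mul_pow, h1, Real.rpow_add hk, Real.rpow_one]
  ring

theorem volume_slab_le_rpow (he : (2 * S.lam) ^ m = S.lam ^ e) (k : ℕ) :
    volume (S.slab k : Set (E (m + 1))) ≤ ENNReal.ofReal (4 * 2 ^ m * (S.lam ^ k) ^ (1 + e)) :=
  (measure_mono (S.slab_subset_thick k)).trans (S.volume_thick_le_rpow he k)

theorem abs_lt_of_mem_cube {z : E (m + 1)} (hz : z ∈ cube (m + 1)) : |z 0| < 1 := abs_lt.2 (hz 0)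

/-- Power mean inequality for a sum with at most four nonzero terms. -/
theorem enorm_gstar_rpow_le {p : ℝ} (hp : 1 ≤ p) {z : E (m + 1)} (hz : |z 0| ≤ 1) :
    ‖S.gstar z‖ₑ ^ p ≤ 4 ^ (p - 1) * ∑' k, ‖gradient (S.block k) z‖ₑ ^ p := by
  obtain ⟨s, hc, hs⟩ := S.exists_window_finset hz
  have hp0 : 0 ≤ p := by linarith
  unfold gstar
  rw [tsum_eq_sum (s := s) fun k hk => by
    by_contra h0
    exact hk (hs k (S.gradient_block_ne_zero h0).1)]
  calc ‖∑ k ∈ s, gradient (S.block k) z‖ₑ ^ p ≤ (∑ k ∈ s, ‖gradient (S.block k) z‖ₑ) ^ p := by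
        gcongr; exact enorm_sum_le _ _
    _ ≤ (s.card : ℝ≥0∞) ^ (p - 1) * ∑ k ∈ s, ‖gradient (S.block k) z‖ₑ ^ p :=
        ENNReal.rpow_sum_le_const_mul_sum_rpow _ _ hp
    _ ≤ _ := by
        gcongr
        · exact_mod_cast hc
        · exact ENNReal.sum_le_tsum s

/-- At scale `r` the weight is of order `r^β`, the gradient `r^(-1)` and the volume `r^(1+e)`. The
series is geometric with exponent `β - p + 1 + e`, positive by `hpe`. -/
theorem exists_tsum_lintegral_gradient_block (he : (2 * S.lam) ^ m = S.lam ^ e) {β p : ℝ}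
    (hβ : 0 ≤ β) (hp : 1 ≤ p) (hpe : p < β + 1 + e) :
    ∑' k, ∫⁻ z in cube (m + 1), ENNReal.ofReal (|z 0| ^ β) * ‖gradient (S.block k) z‖ₑ ^ p
      ≠ ⊤ := by
  obtain ⟨C, hC, hb⟩ := S.exists_norm_gradient_block_le (m := m)
  have hp0 : 0 ≤ p := by linarith
  have hl0 := S.lam_pos
  have key : ∀ k, ∫⁻ z in cube (m + 1), ENNReal.ofReal (|z 0| ^ β) *
      ‖gradient (S.block k) z‖ₑ ^ p ≤
      ENNReal.ofReal ((2 ^ β * C ^ p * (4 * 2 ^ m)) * (S.lam ^ k) ^ (β - p + (1 + e))) := by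
    intro k
    have hk := S.lam_pow_pos k
    calc _ ≤ ∫⁻ z : E (m + 1), (S.slab k).indicator
          (fun _ => ENNReal.ofReal ((2 * S.lam ^ k) ^ β * (C * (S.lam ^ k)⁻¹) ^ p)) z := by
          refine (setLIntegral_le_lintegral _ _).trans (lintegral_mono fun z => ?_)
          by_cases hz : z ∈ S.slab k
          · rw [indicator_of_mem hz, ENNReal.ofReal_mul (by positivity)]
            gcongr
            · exact hz.1.2
            · rw [← ofReal_norm, ENNReal.ofReal_rpow_of_nonneg (norm_nonneg _) hp0]
              exact ENNReal.ofReal_le_ofReal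
                (Real.rpow_le_rpow (norm_nonneg _) (hb k z) hp0)
          · rw [S.gradient_block_eq_zero hz, enorm_zero, ENNReal.zero_rpow_of_pos (by linarith),
              mul_zero]
            exact zero_le
      _ = ENNReal.ofReal ((2 * S.lam ^ k) ^ β * (C * (S.lam ^ k)⁻¹) ^ p)
          * volume (S.slab k : Set (E (m + 1))) := by
          rw [lintegral_indicator (S.measurableSet_slab k), setLIntegral_const]
      _ ≤ ENNReal.ofReal ((2 * S.lam ^ k) ^ β * (C * (S.lam ^ k)⁻¹) ^ p)
          * ENNReal.ofReal (4 * 2 ^ m * (S.lam ^ k) ^ (1 + e)) := by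
          gcongr; exact S.volume_slab_le_rpow he k
      _ = _ := by
          rw [← ENNReal.ofReal_mul (by positivity)]
          congr 1
          have h1 : (S.lam ^ k) ^ (β - p + (1 + e)) =
              (S.lam ^ k) ^ β * (S.lam ^ k) ^ (-p) * (S.lam ^ k) ^ (1 + e) := by
            rw [← Real.rpow_add hk, ← Real.rpow_add hk, sub_eq_add_neg]
          rw [Real.mul_rpow (by norm_num) hk.le, Real.mul_rpow hC (by positivity),
            Real.inv_rpow hk.le, ← Real.rpow_neg hk.le, h1]
          ring
  refine ne_top_of_le_ne_top ?_ (ENNReal.tsum_le_tsum key)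
  exact (summable_pow_rpow S.lam_pos S.lam_lt_one (by linarith) _).tsum_ofReal_ne_top

theorem aestronglyMeasurable_gstar :
    AEStronglyMeasurable (S.gstar : E (m + 1) → E (m + 1)) (volume.restrict (cube (m + 1))) :=
  aestronglyMeasurable_tsum isOpen_cube.measurableSet
    (fun k => (continuous_gradient (S.contDiff_one_block k)).aestronglyMeasurable)
    fun _ hz => S.summable_gradient_block (abs_lt_of_mem_cube hz).le

theorem integrableOn_rpow_mul_gstar (he : (2 * S.lam) ^ m = S.lam ^ e) {β p : ℝ}
    (hβ : 0 ≤ β) (hp : 1 ≤ p) (hpe : p < β + 1 + e) :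
    IntegrableOn (fun z : E (m + 1) => |z 0| ^ β * ‖S.gstar z‖ ^ p) (cube (m + 1)) := by
  have hp0 : 0 ≤ p := by linarith
  have hw : Continuous fun z : E (m + 1) => |z 0| ^ β := by
    have : Continuous fun z : E (m + 1) => |z 0| := by fun_prop
    exact this.rpow_const fun _ => Or.inr hβ
  have hr : Continuous fun x : ℝ => x ^ p := Real.continuous_rpow_const hp0
  refine ⟨hw.aestronglyMeasurable.mul
    (hr.comp_aestronglyMeasurable S.aestronglyMeasurable_gstar.norm), ?_⟩
  have h1 : ∀ᵐ z ∂volume.restrict (cube (m + 1)), ‖|z 0| ^ β * ‖S.gstar z‖ ^ p‖ₑ ≤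
      4 ^ (p - 1) * ∑' k, ENNReal.ofReal (|z 0| ^ β) * ‖gradient (S.block k) z‖ₑ ^ p := by
    filter_upwards [ae_restrict_mem isOpen_cube.measurableSet] with z hz
    have := S.enorm_gstar_rpow_le hp (abs_lt_of_mem_cube hz).le
    rw [ENNReal.tsum_mul_left, ← mul_assoc, mul_comm (4 ^ (p - 1)), mul_assoc,
      Real.enorm_of_nonneg (by positivity), ENNReal.ofReal_mul (by positivity)]
    gcongr
    rwa [← ENNReal.ofReal_rpow_of_nonneg (norm_nonneg _) hp0, ofReal_norm]
  refine lt_of_le_of_lt (lintegral_mono_ae h1) ?_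
  have hm : ∀ k, AEMeasurable (fun z : E (m + 1) => ENNReal.ofReal (|z 0| ^ β) *
      ‖gradient (S.block k) z‖ₑ ^ p) (volume.restrict (cube (m + 1))) := fun k => by
    have := (continuous_gradient (S.contDiff_one_block (m := m) k)).measurable
    have h2 := hw.measurable
    exact (h2.ennreal_ofReal.mul (this.enorm.pow_const p)).aemeasurable
  rw [lintegral_const_mul'', lintegral_tsum hm]
  · refine ENNReal.mul_lt_top ?_
      (lt_top_iff_ne_top.2 (S.exists_tsum_lintegral_gradient_block he hβ hp hpe))
    exact ENNReal.rpow_lt_top_of_nonneg (by linarith) (by norm_num)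
  · exact AEMeasurable.tsum hm

/-- The tail of the series defining the singular function belongs to `W₀^{1,1}`. -/
theorem isL1Limit_tail (he : (2 * S.lam) ^ m = S.lam ^ e) (he0 : 0 < e) :
    IsL1Limit (testFunctions (cube (m + 1))) (cube (m + 1))
      (fun z => ∑' k, S.block (k + 1) z) fun z => ∑' k, gradient (S.block (k + 1)) z := by
  have hl0 := S.lam_pos
  refine IsL1Limit.tsum isOpen_cube.measurableSet (fun k => S.isTestFunction_block (by omega))
    (fun z hz => ?_) (fun z hz => ?_) ?_ ?_
  · exact (summable_nat_add_iff (f := fun k => S.block k z) 1).2 (S.summable_block (abs_lt_of_mem_cube hz).le)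
  · exact (summable_nat_add_iff (f := fun k => gradient (S.block k) z) 1).2
      (S.summable_gradient_block (abs_lt_of_mem_cube hz).le)
  · have key : ∀ k, ∫⁻ z in cube (m + 1), ‖S.block (k + 1) z‖ₑ ≤
        ENNReal.ofReal (2 * (4 * 2 ^ m) * (S.lam ^ (k + 1)) ^ (1 + e)) := fun k => by
      have hk := S.lam_pow_pos (k + 1)
      calc _ ≤ ∫⁻ z : E (m + 1), (S.slab (k + 1)).indicator (fun _ => ENNReal.ofReal 2) z := by
            refine (setLIntegral_le_lintegral _ _).trans (lintegral_mono fun z => ?_)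
            by_cases hz : z ∈ S.slab (k + 1)
            · rw [indicator_of_mem hz, Real.enorm_eq_ofReal_abs]
              exact ENNReal.ofReal_le_ofReal (S.abs_block_le _ _)
            · rw [S.block_eq_zero hz, enorm_zero]
              exact zero_le
        _ = ENNReal.ofReal 2 * volume (S.slab (k + 1) : Set (E (m + 1))) := by
            rw [lintegral_indicator (S.measurableSet_slab (k + 1)), setLIntegral_const]
        _ ≤ _ := by
            rw [mul_assoc, ENNReal.ofReal_mul (by norm_num)]
            gcongr; exact S.volume_slab_le_rpow he (k + 1)
    refine ne_top_of_le_ne_top ?_ (ENNReal.tsum_le_tsum key)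
    have := (summable_nat_add_iff (f := fun k => 2 * (4 * 2 ^ m) * (S.lam ^ k) ^ (1 + e)) 1).2
      (summable_pow_rpow S.lam_pos S.lam_lt_one (by linarith : 0 < 1 + e) (2 * (4 * 2 ^ m)))
    exact this.tsum_ofReal_ne_top
  · have h := S.exists_tsum_lintegral_gradient_block he le_rfl le_rfl (by linarith : 1 < 0 + 1 + e)
    simp only [Real.rpow_zero, ENNReal.ofReal_one, one_mul, ENNReal.rpow_one] at h
    refine ne_top_of_le_ne_top h ?_
    exact ENNReal.tsum_comp_le_tsum_of_injective (add_left_injective 1)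
      fun k => ∫⁻ z in cube (m + 1), ‖gradient (S.block k) z‖ₑ

theorem gradient_block_zero_add_tail {z : E (m + 1)} (hz : z ∈ cube (m + 1)) :
    gradient (S.block 0) z + ∑' k, gradient (S.block (k + 1)) z = S.gstar z :=
  ((S.summable_gradient_block (abs_lt_of_mem_cube hz).le).tsum_eq_zero_add).symm

end CantorScale

end SingularFunction

/-! ### Powers of the height -/

section SingularWeights

variable {m : ℕ}

theorem ae_coord_ne_zero : ∀ᵐ z : E (m + 1), z 0 ≠ 0 := by
  have h := Measure.pi_hyperplane (fun _ : Fin (m + 1) => (volume : Measure ℝ)) 0 0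
  have h1 : ∀ᵐ x : Fin (m + 1) → ℝ, x 0 ≠ 0 := by
    rw [ae_iff, volume_pi]; simpa using h
  exact (PiLp.volume_preserving_ofLp (Fin (m + 1))).quasiMeasurePreserving.ae h1

theorem integrableOn_abs_rpow {r : ℝ} (hr : -1 < r) :
    IntegrableOn (fun t : ℝ => |t| ^ r) (Ioo (-1) 1) := by
  have h1 : IntervalIntegrable (fun t : ℝ => |t| ^ r) volume 0 1 := by
    refine (intervalIntegral.intervalIntegrable_rpow' hr).congr fun t ht => ?_
    rw [uIoc_of_le zero_le_one] at ht
    simp only [abs_of_pos ht.1]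
  have h2 : IntervalIntegrable (fun t : ℝ => |t| ^ r) volume (-1) 0 := by
    have := (IntervalIntegrable.iff_comp_neg (f := fun t : ℝ => |t| ^ r)).1 h1
    simp only [abs_neg, neg_zero] at this
    exact this.symm
  have h3 := (h2.trans h1).1
  exact h3.mono_set Ioo_subset_Ioc_self

theorem integrableOn_coord_rpow {r : ℝ} (hr : -1 < r) :
    IntegrableOn (fun z : E (m + 1) => |z 0| ^ r) (cube (m + 1)) := by
  set f : Fin (m + 1) → ℝ → ℝ := Fin.cons ((Ioo (-1) 1).indicator fun t => |t| ^ r)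
    (fun _ => (Ioo (-1) 1).indicator fun _ => 1) with hf
  have hfi : ∀ i, Integrable (f i) (volume : Measure ℝ) := by
    refine Fin.cases ?_ fun i => ?_
    · exact (integrableOn_abs_rpow hr).integrable_indicator measurableSet_Ioo
    · simp only [hf, Fin.cons_succ]
      exact IntegrableOn.integrable_indicator (by simp) measurableSet_Ioo
  have h1 := Integrable.fintype_prod hfi
  have h2 := (PiLp.volume_preserving_ofLp (Fin (m + 1))).integrable_comp_of_integrable h1
  rw [← integrable_indicator_iff isOpen_cube.measurableSet]
  refine h2.congr (Eventually.of_forall fun z => ?_)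
  simp only [Function.comp, Fin.prod_univ_succ, hf, Fin.cons_zero, Fin.cons_succ]
  by_cases hz : z ∈ cube (m + 1)
  · rw [indicator_of_mem hz, indicator_of_mem (hz 0), Finset.prod_eq_one, mul_one]
    exact fun i _ => indicator_of_mem (hz i.succ) _
  · rw [indicator_of_notMem hz]
    have : ∃ i, z i ∉ Ioo (-1 : ℝ) 1 := by
      by_contra h0
      push Not at h0
      exact hz h0
    obtain ⟨i, hi⟩ := this
    induction i using Fin.cases with
    | zero => rw [indicator_of_notMem hi, zero_mul]
    | succ i =>
      rw [Finset.prod_eq_zero (Finset.mem_univ i) (indicator_of_notMem hi _), mul_zero]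

end SingularWeights

/-! ### Energy of the competitor and of the minimizer -/

section EnergyBound

theorem add_sq_rpow_le {s r q : ℝ} (hs : s ∈ Icc (0 : ℝ) 1) (hr : 0 ≤ r) (hq : 0 ≤ q) :
    (s ^ 2 + r ^ 2) ^ (q / 2) ≤ 2 ^ (q / 2) * (1 + r ^ q) := by
  have hs2 : s ^ 2 ≤ 1 := pow_le_one₀ hs.1 hs.2
  have hr2 : (r ^ 2) ^ (q / 2) = r ^ q := by
    rw [← Real.rpow_natCast r 2, ← Real.rpow_mul hr]; congr 1; push_cast; ring
  have hq2 : 0 ≤ q / 2 := by linarith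
  have h0 : 0 ≤ r ^ q := Real.rpow_nonneg hr q
  rcases le_total (r ^ 2) 1 with h | h
  · calc (s ^ 2 + r ^ 2) ^ (q / 2) ≤ 2 ^ (q / 2) :=
          Real.rpow_le_rpow (by positivity) (by linarith) hq2
      _ ≤ _ := le_mul_of_one_le_right (by positivity) (by linarith)
  · calc (s ^ 2 + r ^ 2) ^ (q / 2) ≤ (2 * r ^ 2) ^ (q / 2) :=
          Real.rpow_le_rpow (by positivity) (by linarith) hq2
      _ = 2 ^ (q / 2) * r ^ q := by rw [Real.mul_rpow (by norm_num) (by positivity), hr2]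
      _ ≤ _ := by gcongr; linarith

namespace CantorScale

variable (S : CantorScale) {m : ℕ} {e : ℝ}

/-- The coefficient of the functional for the boundary values of size `M`. -/
def coef (α' β q M : ℝ) (z : E (m + 1)) : ℝ := S.aOut α' z + M ^ (-q) * S.aIn β z

theorem coef_nonneg {α' β q M : ℝ} (hM : 1 ≤ M) (z : E (m + 1)) : 0 ≤ S.coef α' β q M z :=
  add_nonneg (S.aOut_nonneg _ _)
    (mul_nonneg (Real.rpow_nonneg (by linarith) _) (S.aIn_nonneg _ _))

theorem continuous_coef {α' β q M : ℝ} (hα' : 0 < α') (hβ : 0 < β) :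
    Continuous (S.coef α' β q M : E (m + 1) → ℝ) :=
  (S.continuous_aOut hα').add (continuous_const.mul (S.continuous_aIn hβ))

theorem rpow_le_coef {α' β q M : ℝ} (hM : 1 ≤ M) (hβ : 0 ≤ β) {z : E (m + 1)} (h0 : z 0 ≠ 0)
    (hz : z ∈ cube (m + 1)) : M ^ (-q) * |z 0| ^ β ≤ S.coef α' β q M z := by
  have h1 := S.rpow_le_aIn hβ h0 (abs_lt_of_mem_cube hz).le
  have h2 := S.aOut_nonneg α' z
  have h3 : 0 ≤ M ^ (-q) := Real.rpow_nonneg (by linarith) _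
  unfold coef
  nlinarith

/-- `aIn` keeps the coefficient above a multiple of `|t|^β`, and `|t|^(-β/(q-1))` is integrable
because `β < q - 1`. This is the weight condition behind existence. -/
theorem integrableOn_coef_rpow {α' β q M : ℝ} (hM : 1 ≤ M) (hα' : 0 < α') (hβ : 0 < β)
    (hβq : β < q - 1) :
    IntegrableOn (fun z : E (m + 1) => S.coef α' β q M z ^ (-1 / (q - 1))) (cube (m + 1)) := by
  have hq : 0 < q - 1 := hβ.trans hβq
  have hM0 : 0 < M := by linarith
  have h1 : IntegrableOn (fun z : E (m + 1) => (M ^ (-q)) ^ (-1 / (q - 1)) *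
      |z 0| ^ (β * (-1 / (q - 1)))) (cube (m + 1)) := by
    refine (integrableOn_coord_rpow ?_).const_mul _
    rw [mul_div_assoc', lt_div_iff₀ hq]
    linarith
  refine h1.mono' ?_ ?_
  · exact ((S.continuous_coef hα' hβ).measurable.pow_const _).aestronglyMeasurable
  · filter_upwards [ae_restrict_mem isOpen_cube.measurableSet,
      ae_restrict_of_ae ae_coord_ne_zero] with z hz h0
    have hz0 : 0 < |z 0| := abs_pos.2 h0
    have hc := S.rpow_le_coef (α' := α') (q := q) hM hβ.le h0 hz
    rw [Real.norm_of_nonneg (Real.rpow_nonneg (S.coef_nonneg hM z) _), Real.rpow_mul hz0.le,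
      ← Real.mul_rpow (by positivity) (by positivity)]
    refine Real.rpow_le_rpow_of_nonpos (by positivity) hc ?_
    exact div_nonpos_of_nonpos_of_nonneg (by norm_num) hq.le

/-- The term in `L` carries the power `M^(1+δ)`. The `aOut` term sees no gradient, so only `s ≤ 1`
enters. In the `aIn` term the factor `M^(-q)` cancels the growth `M^q`. -/
theorem integrand_smul_gstar_le {L : E (m + 1) → ℝ} {c δ α' β q s M : ℝ} (hδ : 0 ≤ δ)
    (hc : 0 ≤ c) (hL : ∀ z, L z ≤ c * (1 + ‖z‖ ^ (1 + δ))) (hs : s ∈ Icc (0 : ℝ) 1) (hq : 0 < q)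
    (hα' : 0 ≤ α') (hβ : 0 ≤ β) (hM : 1 ≤ M) {z : E (m + 1)} (hz : z ∈ cube (m + 1)) :
    integrand L (S.coef α' β q M) s q z (M • S.gstar z) ≤ M ^ (1 + δ) *
      (c * (1 + ‖S.gstar z‖ ^ (1 + δ)) + 4 * (1 / S.lam ^ 2) ^ α' +
        2 ^ (q / 2) * (4 * (1 / S.lam ^ 2) ^ β * (1 + |z 0| ^ β * ‖S.gstar z‖ ^ q))) := by
  have hz1 := abs_lt_of_mem_cube hz
  have hM0 : 0 < M := by linarith
  have hl := S.lam_pos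
  have hM1 : 1 ≤ M ^ (1 + δ) := Real.one_le_rpow hM (by linarith)
  set g := S.gstar z with hg
  have hn : ‖M • g‖ = M * ‖g‖ := by rw [norm_smul, Real.norm_of_nonneg hM0.le]
  have b1 : L (M • g) ≤ M ^ (1 + δ) * (c * (1 + ‖g‖ ^ (1 + δ))) := by
    refine (hL _).trans ?_
    rw [hn, Real.mul_rpow hM0.le (norm_nonneg _)]
    have : 0 ≤ ‖g‖ ^ (1 + δ) := by positivity
    calc c * (1 + M ^ (1 + δ) * ‖g‖ ^ (1 + δ))
        ≤ c * (M ^ (1 + δ) + M ^ (1 + δ) * ‖g‖ ^ (1 + δ)) := by gcongr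
      _ = _ := by ring
  have b2 : S.aOut α' z * (s ^ 2 + ‖M • g‖ ^ 2) ^ (q / 2) ≤ 4 * (1 / S.lam ^ 2) ^ α' := by
    have h1 := (S.aOut_le_aIn α' hz1.le).trans (S.aIn_le_const hα' hz1.le)
    by_cases h0 : S.aOut α' z = 0
    · rw [h0, zero_mul]; positivity
    · rw [hg, S.gstar_eq_zero hz1 h0, smul_zero, norm_zero]
      refine (mul_le_of_le_one_right (S.aOut_nonneg _ _) ?_).trans h1
      refine Real.rpow_le_one (by positivity) ?_ (by linarith)
      simpa [abs_of_nonneg hs.1] using hs.2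
  have b3 : M ^ (-q) * S.aIn β z * (s ^ 2 + ‖M • g‖ ^ 2) ^ (q / 2) ≤
      2 ^ (q / 2) * (4 * (1 / S.lam ^ 2) ^ β * (1 + |z 0| ^ β * ‖g‖ ^ q)) := by
    have h1 := add_sq_rpow_le hs (norm_nonneg (M • g)) hq.le
    have h2 : M ^ (-q) * (1 + ‖M • g‖ ^ q) ≤ 1 + ‖g‖ ^ q := by
      rw [hn, Real.mul_rpow hM0.le (norm_nonneg _), Real.rpow_neg hM0.le]
      have h3 : 1 ≤ M ^ q := Real.one_le_rpow hM hq.le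
      rw [mul_add, mul_one, ← mul_assoc, inv_mul_cancel₀ (by positivity), one_mul]
      have := inv_le_one_of_one_le₀ h3
      linarith
    have ha0 := S.aIn_nonneg β z
    have ha1 := S.aIn_le_const hβ hz1.le
    have ha2 : S.aIn β z ≤ 4 * (1 / S.lam ^ 2) ^ β * |z 0| ^ β := by
      refine (S.aIn_le hβ hz1.le).trans (le_of_eq ?_)
      rw [mul_assoc, ← Real.mul_rpow (by positivity) (by positivity)]
      congr 2; ring
    calc _ ≤ M ^ (-q) * S.aIn β z * (2 ^ (q / 2) * (1 + ‖M • g‖ ^ q)) := by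
          gcongr
      _ = 2 ^ (q / 2) * (S.aIn β z * (M ^ (-q) * (1 + ‖M • g‖ ^ q))) := by ring
      _ ≤ 2 ^ (q / 2) * (S.aIn β z * (1 + ‖g‖ ^ q)) := by gcongr
      _ ≤ _ := by
          have h4 : 0 ≤ ‖g‖ ^ q := by positivity
          refine mul_le_mul_of_nonneg_left ?_ (by positivity)
          nlinarith
  have h5 : ∀ X : ℝ, 0 ≤ X → X ≤ M ^ (1 + δ) * X := fun X hX => le_mul_of_one_le_left hX hM1
  have b2' := b2.trans (h5 _ (by positivity))
  have b3' := b3.trans (h5 _ (by positivity))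
  unfold integrand coef
  rw [add_mul, mul_add, mul_add]
  linarith

theorem exists_energy_bound (he : (2 * S.lam) ^ m = S.lam ^ e) {L : E (m + 1) → ℝ}
    {c₀ c δ α' β q s : ℝ} (hLc : Continuous L) (hLb : ∀ z, -c₀ ≤ L z) (hδ : 0 ≤ δ) (hδe : δ < e)
    (hc : 0 ≤ c) (hL : ∀ z, L z ≤ c * (1 + ‖z‖ ^ (1 + δ))) (hs : s ∈ Icc (0 : ℝ) 1) (hq : 1 < q)
    (hα' : 0 < α') (hβ : 0 < β) (hβe : q < β + 1 + e) :
    ∃ C : ℝ, 0 ≤ C ∧ ∀ M : ℝ, 1 ≤ M →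
      IntegrableOn (fun z => integrand L (S.coef α' β q M) s q z (M • S.gstar z)) (cube (m + 1)) ∧
      ∫ z in cube (m + 1), integrand L (S.coef α' β q M) s q z (M • S.gstar z)
        ≤ C * M ^ (1 + δ) := by
  set h : E (m + 1) → ℝ := fun z =>
    c * (1 + ‖S.gstar z‖ ^ (1 + δ)) + 4 * (1 / S.lam ^ 2) ^ α' +
        2 ^ (q / 2) * (4 * (1 / S.lam ^ 2) ^ β * (1 + |z 0| ^ β * ‖S.gstar z‖ ^ q)) with hh
  have hl := S.lam_pos
  have hh0 : ∀ z, 0 ≤ h z := fun z => by simp only [hh]; positivity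
  have i1 : IntegrableOn (fun z : E (m + 1) => ‖S.gstar z‖ ^ (1 + δ)) (cube (m + 1)) := by
    simpa using S.integrableOn_rpow_mul_gstar he le_rfl (by linarith : 1 ≤ 1 + δ) (by linarith)
  have i2 := S.integrableOn_rpow_mul_gstar he hβ.le hq.le hβe
  have hconst : ∀ r : ℝ, IntegrableOn (fun _ : E (m + 1) => r) (cube (m + 1)) := fun r =>
    integrable_const r
  have hi : IntegrableOn h (cube (m + 1)) :=
    ((((hconst 1).add i1).const_mul c).add (hconst _)).add
      ((((hconst 1).add i2).const_mul _).const_mul _)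
  refine ⟨∫ z in cube (m + 1), h z, integral_nonneg hh0, fun M hM => ?_⟩
  have hup : ∀ z ∈ cube (m + 1), integrand L (S.coef α' β q M) s q z (M • S.gstar z)
      ≤ M ^ (1 + δ) * h z := fun z hz =>
    S.integrand_smul_gstar_le hδ hc hL hs (by linarith) hα'.le hβ.le hM hz
  have hlow : ∀ z, -c₀ ≤ integrand L (S.coef α' β q M) s q z (M • S.gstar z) := fun z => by
    unfold integrand
    have := mul_nonneg (S.coef_nonneg (α' := α') (β := β) (q := q) hM z)
      (Real.rpow_nonneg (by positivity : 0 ≤ s ^ 2 + ‖M • S.gstar z‖ ^ 2) (q / 2))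
    linarith [hLb (M • S.gstar z)]
  have hintg : IntegrableOn (fun z => integrand L (S.coef α' β q M) s q z (M • S.gstar z))
      (cube (m + 1)) := by
    refine Integrable.mono' ((hi.const_mul (M ^ (1 + δ))).add (hconst |c₀|)) ?_ ?_
    · exact aestronglyMeasurable_integrand hLc (S.continuous_coef hα' hβ) (by linarith)
        (S.aestronglyMeasurable_gstar.const_smul M)
    · filter_upwards [ae_restrict_mem isOpen_cube.measurableSet] with z hz
      have h1 := hup z hz
      have h2 := hlow z
      have h3 : 0 ≤ M ^ (1 + δ) * h z := mul_nonneg (by positivity) (hh0 z)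
      have h4 := le_abs_self c₀
      simp only [Pi.add_apply, Real.norm_eq_abs]
      rw [abs_le]
      constructor <;> linarith [abs_nonneg c₀]
  refine ⟨hintg, ?_⟩
  calc _ ≤ ∫ z in cube (m + 1), M ^ (1 + δ) * h z :=
        setIntegral_mono_on hintg (hi.const_mul _) isOpen_cube.measurableSet hup
    _ = _ := by rw [integral_const_mul, mul_comm]

/-- The boundary values `M` times the first block have a minimizer whose weighted gradient grows
with `M` only a little faster than linearly. -/
theorem exists_minimizer (hm : 1 ≤ m) (he : (2 * S.lam) ^ m = S.lam ^ e) (he0 : 0 < e)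
    {L : E (m + 1) → ℝ} {c₀ c δ α' β q s : ℝ} (hLc : Continuous L)
    (hLs : StrictMidpointConvex L) (hLb : ∀ z, -c₀ ≤ L z) (hδ : 0 ≤ δ) (hδe : δ < e)
    (hc : 0 ≤ c) (hL : ∀ z, L z ≤ c * (1 + ‖z‖ ^ (1 + δ))) (hs : s ∈ Icc (0 : ℝ) 1) (hq : 1 < q)
    (hα' : 0 < α') (hβ : 0 < β) (hβe : q < β + 1 + e) (hβq : β < q - 1) :
    ∃ C : ℝ, 0 ≤ C ∧ ∀ M : ℝ, 1 ≤ M → ∃ (u : E (m + 1) → ℝ) (D : E (m + 1) → E (m + 1)),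
      Measurable u ∧ Measurable D ∧
      IsL1Limit (shiftedTestFunctions (cube (m + 1)) fun z => M * S.block 0 z) (cube (m + 1)) u D ∧
      IsDirichletMinimizer L (S.coef α' β q M) s q (cube (m + 1)) (fun z => M * S.block 0 z) u ∧
      ∫⁻ z in cube (m + 1), ENNReal.ofReal (S.aOut α' z) * ‖D z‖ₑ ^ q
        ≤ ENNReal.ofReal (C * M ^ (1 + δ)) := by
  obtain ⟨C, hC, hE⟩ := S.exists_energy_bound he hLc hLb hδ hδe hc hL hs hq hα' hβ hβe
  set V := volume.real (cube (m + 1)) with hV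
  refine ⟨C + |c₀| * V, by positivity, fun M hM => ?_⟩
  obtain ⟨hi, hle⟩ := hE M hM
  have hq0 : 0 < q := by linarith
  have hu₀ : ContDiff ℝ 1 fun z : E (m + 1) => M * S.block 0 z :=
    contDiff_const.mul (S.contDiff_one_block 0)
  have ht := S.isL1Limit_tail he he0
  -- The competitor differs from the boundary datum by `M` times the tail; the second summand has
  -- coefficient `0` and only fits the form of `linear_comb`.
  have hv := ht.linear_comb ht M 0
  have hgrad : ∀ z ∈ cube (m + 1), gradient (fun z : E (m + 1) => M * S.block 0 z) z +
      (M • (∑' k, gradient (S.block (k + 1)) z) + (0 : ℝ) • ∑' k, gradient (S.block (k + 1)) z)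
      = M • S.gstar z := fun z hz => by
    have h1 := gradient_linear_comb (S.contDiff_one_block (m := m) 0) (S.contDiff_one_block 0)
      M 0 z
    simp only [zero_mul, add_zero, zero_smul] at h1
    rw [h1, zero_smul, add_zero, ← smul_add, S.gradient_block_zero_add_tail hz]
  have hae : ∀ᵐ z ∂volume.restrict (cube (m + 1)),
      integrand L (S.coef α' β q M) s q z (M • S.gstar z) =
      integrand L (S.coef α' β q M) s q z (gradient (fun z : E (m + 1) => M * S.block 0 z) z +
      (M • (∑' k, gradient (S.block (k + 1)) z) +
        (0 : ℝ) • ∑' k, gradient (S.block (k + 1)) z)) := by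
    filter_upwards [ae_restrict_mem isOpen_cube.measurableSet] with z hz
    rw [hgrad z hz]
  have hpos : ∀ᵐ z ∂volume.restrict (cube (m + 1)), 0 < S.coef α' β q M z := by
    filter_upwards [ae_restrict_mem isOpen_cube.measurableSet,
      ae_restrict_of_ae ae_coord_ne_zero] with z hz h0
    have hz0 : 0 < |z 0| := abs_pos.2 h0
    exact lt_of_lt_of_le (by positivity) (S.rpow_le_coef hM hβ.le h0 hz)
  obtain ⟨u, D, hum, hDm, hlim, hmin, hDi, hDle⟩ := exists_isDirichletMinimizer (s := s) (by omega) hLc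
    hLs hLb (S.continuous_coef (q := q) (M := M) hα' hβ) (fun z _ => S.coef_nonneg hM z) hq hpos
    (S.integrableOn_coef_rpow hM hα' hβ hβq) hu₀ hv (Integrable.congr hi hae)
  refine ⟨u, D, hum, hDm, hlim, hmin, ?_⟩
  rw [← integral_congr_ae hae] at hDle
  obtain ⟨j1, j2⟩ := integrable_mul_norm_rpow hLb (S.continuous_coef (q := q) (M := M) hα' hβ)
    (fun z _ => S.coef_nonneg hM z) hq0 hDi hDm.aestronglyMeasurable
  calc ∫⁻ z in cube (m + 1), ENNReal.ofReal (S.aOut α' z) * ‖D z‖ₑ ^ q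
      ≤ ∫⁻ z in cube (m + 1), ENNReal.ofReal (S.coef α' β q M z * ‖D z‖ ^ q) := by
        refine lintegral_mono fun z => ?_
        rw [ENNReal.ofReal_mul (S.coef_nonneg hM z),
          ← ENNReal.ofReal_rpow_of_nonneg (norm_nonneg _) hq0.le, ofReal_norm]
        gcongr
        exact le_add_of_nonneg_right
          (mul_nonneg (Real.rpow_nonneg (by linarith) _) (S.aIn_nonneg _ _))
    _ = ENNReal.ofReal (∫ z in cube (m + 1), S.coef α' β q M z * ‖D z‖ ^ q) := by
        refine (ofReal_integral_eq_lintegral_ofReal j1 (Eventually.of_forall fun z => ?_)).symm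
        exact mul_nonneg (S.coef_nonneg hM z) (by positivity)
    _ ≤ _ := by
        refine ENNReal.ofReal_le_ofReal (j2.trans ?_)
        have h1 : 1 ≤ M ^ (1 + δ) := Real.one_le_rpow hM (by linarith)
        have h2 : 0 ≤ |c₀| * V := by positivity
        have h3 : c₀ * V ≤ |c₀| * V := by gcongr; exact le_abs_self c₀
        nlinarith

end CantorScale

end EnergyBound

/-! ### Vertical and horizontal coordinates -/

section Coordinates

variable {m : ℕ}

/-- The point with vertical coordinate `t` and horizontal coordinates `y`. -/
def pt (t : ℝ) (y : Fin m → ℝ) : E (m + 1) := WithLp.toLp 2 (Fin.cons t y)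

@[simp] theorem pt_zero (t : ℝ) (y : Fin m → ℝ) : pt t y 0 = t := rfl

@[simp] theorem pt_succ (t : ℝ) (y : Fin m → ℝ) (i : Fin m) : pt t y i.succ = y i := rfl

theorem measurable_pt : Measurable fun p : ℝ × (Fin m → ℝ) => pt p.1 p.2 := by
  refine (PiLp.volume_preserving_toLp (Fin (m + 1))).measurable.comp ?_
  refine measurable_pi_iff.2 (Fin.cases ?_ fun i => ?_)
  · exact measurable_fst
  · exact (measurable_pi_apply i).comp measurable_snd

theorem measurePreserving_pt :
    MeasurePreserving (fun p : ℝ × (Fin m → ℝ) => pt p.1 p.2) (volume.prod volume) volume := by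
  have h1 := (volume_preserving_piFinSuccAbove (fun _ : Fin (m + 1) => ℝ) 0).symm
  have h2 := (PiLp.volume_preserving_toLp (Fin (m + 1))).comp h1
  refine h2.congr measurable_pt (Eventually.of_forall fun p => ?_)
  have : Fin.insertNth (α := fun _ : Fin (m + 1) => ℝ) 0 p.1 p.2 = Fin.cons p.1 p.2 := by
    simp
  exact congrArg (WithLp.toLp 2) this

theorem lintegral_pt {f : E (m + 1) → ℝ≥0∞} (hf : Measurable f) :
    ∫⁻ z, f z = ∫⁻ t, ∫⁻ y, f (pt t y) := by
  rw [← measurePreserving_pt.lintegral_comp hf,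
    lintegral_prod (fun p : ℝ × (Fin m → ℝ) => f (pt p.1 p.2))
      (hf.comp measurable_pt).aemeasurable]

theorem norm_le_of_forall_abs_le {n : ℕ} {v : E n} {b : ℝ} (hb : 0 ≤ b) (h : ∀ i, |v i| ≤ b) :
    ‖v‖ ≤ n * b := by
  rw [EuclideanSpace.norm_eq]
  refine Real.sqrt_le_iff.2 ⟨by positivity, ?_⟩
  have h1 : ∀ i ∈ Finset.univ, ‖v i‖ ^ 2 ≤ b ^ 2 := fun i _ =>
    pow_le_pow_left₀ (norm_nonneg _) (h i) 2
  refine (Finset.sum_le_card_nsmul _ _ _ h1).trans ?_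
  rw [Finset.card_univ, Fintype.card_fin, nsmul_eq_mul, mul_pow]
  have h2 : (n : ℝ) ≤ (n : ℝ) ^ 2 := by exact_mod_cast Nat.le_self_pow (by norm_num) n
  gcongr

/-- The horizontal box of directions. -/
def dirBox (m : ℕ) : Set (Fin m → ℝ) := Set.pi univ fun _ => Icc (-1) 1

/-- The parameter box of the Cantor set. -/
def unitBox (m : ℕ) : Set (Fin m → ℝ) := Set.pi univ fun _ => Ico 0 1

theorem measurableSet_dirBox : MeasurableSet (dirBox m) :=
  MeasurableSet.univ_pi fun _ => measurableSet_Icc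

theorem measurableSet_unitBox : MeasurableSet (unitBox m) :=
  MeasurableSet.univ_pi fun _ => measurableSet_Ico

theorem volume_dirBox : volume (dirBox m) = 2 ^ m := by
  unfold dirBox
  rw [volume_pi_pi]
  norm_num

theorem volume_unitBox : volume (unitBox m) = 1 := by
  unfold unitBox
  rw [volume_pi_pi]
  norm_num

theorem abs_le_one_of_mem_dirBox {σ : Fin m → ℝ} (hσ : σ ∈ dirBox m) (i : Fin m) : |σ i| ≤ 1 :=
  abs_le.2 (hσ i (mem_univ i))

theorem lintegral_dirBox {h : (Fin m → ℝ) → ℝ≥0∞} (hh : Measurable h) (x : Fin m → ℝ) {r : ℝ}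
    (hr : 0 < r) :
    ∫⁻ σ in dirBox m, h (fun i => x i + r * σ i) =
      ENNReal.ofReal (r ^ m)⁻¹ * ∫⁻ y in {y | ∀ i, |y i - x i| ≤ r}, h y := by
  have hset : MeasurableSet {y : Fin m → ℝ | ∀ i, |y i - x i| ≤ r} := by
    simp only [ofPred_forall]
    exact MeasurableSet.iInter fun i => measurableSet_le (by fun_prop) measurable_const
  set g := ({y : Fin m → ℝ | ∀ i, |y i - x i| ≤ r}).indicator h with hg
  have hgm : Measurable g := hh.indicator hset
  have h1 : ∀ σ : Fin m → ℝ, (dirBox m).indicator (fun σ => h (fun i => x i + r * σ i)) σ =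
      g (x + r • σ) := fun σ => by
    have hiff : σ ∈ dirBox m ↔ x + r • σ ∈ {y : Fin m → ℝ | ∀ i, |y i - x i| ≤ r} := by
      simp only [mem_ofPred_eq, Pi.add_apply, Pi.smul_apply, smul_eq_mul, add_sub_cancel_left,
        abs_mul, abs_of_pos hr, dirBox, mem_univ_pi, mem_Icc, ← abs_le]
      exact forall_congr' fun i => (mul_le_iff_le_one_right hr).symm
    by_cases hσ : σ ∈ dirBox m
    · rw [indicator_of_mem hσ, hg, indicator_of_mem (hiff.1 hσ)]
      rfl
    · rw [indicator_of_notMem hσ, hg, indicator_of_notMem fun h0 => hσ (hiff.2 h0)]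
  rw [← lintegral_indicator measurableSet_dirBox, lintegral_congr h1,
    ← lintegral_indicator hset, ← hg]
  have h2 : ∫⁻ σ : Fin m → ℝ, g (x + r • σ) =
      ∫⁻ y, g (x + y) ∂(Measure.map (fun σ : Fin m → ℝ => r • σ) volume) := by
    rw [lintegral_map (by fun_prop) (by fun_prop)]
  rw [h2, Measure.map_addHaar_smul _ hr.ne', lintegral_smul_measure,
    lintegral_add_left_eq_self, Module.finrank_fin_fun, abs_of_pos (by positivity), smul_eq_mul]

end Coordinates

/-! ### Rays over the Cantor set and their occupation density -/

section Occupation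

namespace CantorScale

variable (S : CantorScale) {m : ℕ} {e : ℝ}

/-- The aperture of the cones over the Cantor set. -/
def kap : ℝ := S.w * S.lam ^ 4

theorem kap_pos : 0 < S.kap := mul_pos S.w_pos (pow_pos S.lam_pos 4)

/-- Two points of the Cantor set within `kap * t` of a common point are then close enough to share
binary digits down to scale `t`. -/
theorem two_kap_lt : 2 * S.kap < 1 - 2 * S.lam := by
  have h1 : S.lam ^ 4 ≤ S.lam ^ 1 :=
    pow_le_pow_of_le_one S.lam_pos.le S.lam_lt_one.le (by norm_num)
  have h2 := S.sep
  unfold kap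
  rw [pow_one] at h1
  nlinarith [S.w_pos]

theorem kap_lt : S.kap < 1 / 4 := by
  have h1 : S.lam ^ 4 ≤ 1 := pow_le_one₀ S.lam_pos.le S.lam_lt_one.le
  have h2 := S.w_lt
  unfold kap
  nlinarith [S.w_pos]

/-- Horizontal position at height `t` of the ray over the point of the Cantor set with parameter
`ρ.1` in the direction `ρ.2`. -/
def ray (t : ℝ) (ρ : (Fin m → ℝ) × (Fin m → ℝ)) : Fin m → ℝ :=
  fun i => S.phi (ρ.1 i) + S.kap * t * ρ.2 i

theorem measurable_ray :
    Measurable fun p : ℝ × (Fin m → ℝ) × (Fin m → ℝ) => S.ray p.1 p.2 := by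
  refine measurable_pi_iff.2 fun i => ?_
  have h := S.measurable_phi
  unfold ray
  fun_prop

/-- The measure on the set of rays. -/
def rayMeasure (m : ℕ) : Measure ((Fin m → ℝ) × (Fin m → ℝ)) :=
  (volume.restrict (unitBox m)).prod (volume.restrict (dirBox m))

instance isFiniteMeasure_unitBox : IsFiniteMeasure (volume.restrict (unitBox m)) :=
  ⟨by rw [Measure.restrict_apply_univ, volume_unitBox]; exact ENNReal.one_lt_top⟩

instance isFiniteMeasure_dirBox : IsFiniteMeasure (volume.restrict (dirBox m)) :=
  ⟨by rw [Measure.restrict_apply_univ, volume_dirBox]; exact ENNReal.pow_lt_top (by norm_num)⟩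

instance isFiniteMeasure_rayMeasure : IsFiniteMeasure (rayMeasure m) := by
  unfold rayMeasure; infer_instance

theorem rayMeasure_univ : rayMeasure m univ = 2 ^ m := by
  unfold rayMeasure
  rw [← univ_prod_univ, Measure.prod_prod, Measure.restrict_apply_univ,
    Measure.restrict_apply_univ, volume_unitBox, volume_dirBox, one_mul]

theorem ae_rayMeasure : ∀ᵐ ρ ∂rayMeasure m, ρ.1 ∈ unitBox m ∧ ρ.2 ∈ dirBox m := by
  unfold rayMeasure
  rw [Measure.prod_restrict]
  exact ae_restrict_mem (measurableSet_unitBox.prod measurableSet_dirBox)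

theorem abs_ray_sub_le {t : ℝ} (ht : 0 ≤ t) {ρ : (Fin m → ℝ) × (Fin m → ℝ)}
    (hρ : ρ.2 ∈ dirBox m) (i : Fin m) : |S.ray t ρ i - S.phi (ρ.1 i)| ≤ S.kap * t := by
  unfold ray
  have := abs_le_one_of_mem_dirBox hρ i
  have hk := S.kap_pos
  rw [add_sub_cancel_left, abs_mul, abs_of_nonneg (by positivity)]
  exact mul_le_of_le_one_right (by positivity) this

theorem pt_ray_mem_cube {t τ : ℝ} (ht : 0 ≤ t) (ht1 : t ≤ 1) (hτ : |τ| < 1)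
    {ρ : (Fin m → ℝ) × (Fin m → ℝ)} (hρ : ρ.2 ∈ dirBox m) :
    pt τ (S.ray t ρ) ∈ cube (m + 1) := by
  refine Fin.cases ?_ fun i => ?_
  · exact abs_lt.1 hτ
  · have h1 := S.abs_ray_sub_le ht hρ i
    have h2 := S.abs_phi_le (ρ.1 i)
    have h3 := S.kap_lt
    have h4 := S.kap_pos
    have h5 : S.kap * t ≤ S.kap := mul_le_of_le_one_right h4.le ht1
    rw [pt_succ]
    rw [abs_le] at h1 h2
    constructor <;> linarith [h1.1, h1.2, h2.1, h2.2]

/-- A ray deviates by at most `kap * t ≤ w * lam^(k+4)`, which is the tolerance of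
`chi_eq_one_near_phi` at generation `k + 3`. This determines the exponent `4` in `kap`. -/
theorem hcut_pt_ray {t τ : ℝ} {k : ℕ} (ht : 0 ≤ t) (htk : t ≤ S.lam ^ k)
    {ρ : (Fin m → ℝ) × (Fin m → ℝ)} (hρ : ρ.2 ∈ dirBox m) :
    S.hcut (k + 3) (pt τ (S.ray t ρ)) = 1 := by
  refine Finset.prod_eq_one fun i _ => S.chi_eq_one_near_phi _ (ρ.1 i) ?_
  rw [pt_succ]
  refine (S.abs_ray_sub_le ht hρ i).trans ?_
  have := S.w_pos
  have := S.lam_pos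
  unfold kap
  calc S.w * S.lam ^ 4 * t ≤ S.w * S.lam ^ 4 * S.lam ^ k := by gcongr
    _ = _ := by ring

/-- The admissible parameters agree in their first `k + 1` digits, where `lam^(k+1) < t ≤ lam^k`, so
they fit in a cube of side `2^(-(k+1))`. By `he`, `2^(-m) = lam^(m-e)`. -/
theorem volume_near_le (he : (2 * S.lam) ^ m = S.lam ^ e) (hem : e ≤ m) {t : ℝ} (ht : 0 < t)
    (ht1 : t ≤ 1) (y : Fin m → ℝ) :
    volume {θ ∈ unitBox m | ∀ i, |y i - S.phi (θ i)| ≤ S.kap * t} ≤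
      ENNReal.ofReal (t ^ ((m : ℝ) - e)) := by
  have hl := S.lam_pos
  obtain ⟨k, hk1, hk2⟩ := S.exists_scale ht.ne' (by rwa [abs_of_pos ht])
  rw [abs_of_pos ht] at hk1 hk2
  refine (Real.volume_pi_le_diam_pow _).trans ?_
  have hd : Metric.ediam {θ ∈ unitBox m | ∀ i, |y i - S.phi (θ i)| ≤ S.kap * t} ≤
      ENNReal.ofReal ((1 / 2) ^ (k + 1)) := by
    refine Metric.ediam_le fun θ hθ θ' hθ' => ?_
    rw [edist_dist]
    refine ENNReal.ofReal_le_ofReal ((dist_pi_le_iff (by positivity)).2 fun i => ?_)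
    rw [Real.dist_eq]
    refine S.abs_sub_le_of_abs_phi_sub_lt k (hθ.1 i (mem_univ i)) (hθ'.1 i (mem_univ i)) ?_
    have h1 := hθ.2 i
    have h2 := hθ'.2 i
    have h3 : |S.phi (θ i) - S.phi (θ' i)| ≤ 2 * S.kap * t := by
      rw [abs_le] at h1 h2 ⊢
      constructor <;> linarith [h1.1, h1.2, h2.1, h2.2]
    have h4 := S.two_kap_lt
    have h5 := S.kap_pos
    have h6 := S.lam_pow_pos k
    calc _ ≤ 2 * S.kap * t := h3
      _ ≤ 2 * S.kap * S.lam ^ k := by gcongr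
      _ < _ := by gcongr
  rw [Fintype.card_fin]
  calc Metric.ediam {θ ∈ unitBox m | ∀ i, |y i - S.phi (θ i)| ≤ S.kap * t} ^ m
      ≤ ENNReal.ofReal ((1 / 2) ^ (k + 1)) ^ m := by gcongr
    _ = ENNReal.ofReal (((1 / 2) ^ (k + 1)) ^ m) := (ENNReal.ofReal_pow (by positivity) m).symm
    _ ≤ _ := by
      refine ENNReal.ofReal_le_ofReal ?_
      have h1 : ((1 / 2 : ℝ)) ^ m = S.lam ^ ((m : ℝ) - e) := by
        rw [Real.rpow_sub hl, ← he, Real.rpow_natCast, mul_pow, div_pow, one_pow]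
        field_simp
      have h2 : ((1 / 2 : ℝ) ^ (k + 1)) ^ m = (S.lam ^ (k + 1)) ^ ((m : ℝ) - e) := by
        rw [← pow_mul, mul_comm (k + 1) m, pow_mul, h1, ← Real.rpow_natCast,
          ← Real.rpow_mul hl.le, ← Real.rpow_natCast, ← Real.rpow_mul hl.le, mul_comm]
      rw [h2]
      exact Real.rpow_le_rpow (by positivity) hk1.le (by linarith)

/-- The occupation estimate for the rays at height `t`. -/
theorem lintegral_ray_le (he : (2 * S.lam) ^ m = S.lam ^ e) (hem : e ≤ m) {t : ℝ} (ht : 0 < t)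
    (ht1 : t ≤ 1) {h : (Fin m → ℝ) → ℝ≥0∞} (hh : Measurable h) :
    ∫⁻ ρ, h (S.ray t ρ) ∂rayMeasure m ≤
      ENNReal.ofReal ((S.kap ^ m)⁻¹ * t ^ (-e)) * ∫⁻ y, h y := by
  have hk := S.kap_pos
  have hkt : 0 < S.kap * t := by positivity
  have hrm : Measurable fun ρ : (Fin m → ℝ) × (Fin m → ℝ) => S.ray t ρ :=
    S.measurable_ray.comp (measurable_const.prodMk measurable_id)
  set A : Set ((Fin m → ℝ) × (Fin m → ℝ)) := {p | ∀ i, |p.2 i - S.phi (p.1 i)| ≤ S.kap * t}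
    with hA
  have hAm : MeasurableSet A := by
    simp only [hA, ofPred_forall]
    have hphi := S.measurable_phi
    exact MeasurableSet.iInter fun i => measurableSet_le (by fun_prop) measurable_const
  -- For a fixed vertex the directions at height `t` sweep a box of side comparable to `kap * t`;
  -- the change of variables costs `(kap * t)^(-m)`.
  have e1 : ∀ θ : Fin m → ℝ, ∫⁻ σ in dirBox m, h (S.ray t (θ, σ)) =
      ENNReal.ofReal ((S.kap * t) ^ m)⁻¹ * ∫⁻ y, A.indicator (fun p => h p.2) (θ, y) := by
    intro θ
    have := lintegral_dirBox hh (fun i => S.phi (θ i)) hkt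
    refine this.trans ?_
    congr 1
    have hs : MeasurableSet {y : Fin m → ℝ | ∀ i, |y i - S.phi (θ i)| ≤ S.kap * t} :=
      measurable_prodMk_left hAm
    rw [← lintegral_indicator hs]
    rfl
  have hmeas : Measurable (A.indicator fun p : (Fin m → ℝ) × (Fin m → ℝ) => h p.2) :=
    (hh.comp measurable_snd).indicator hAm
  unfold rayMeasure
  rw [lintegral_prod (fun ρ => h (S.ray t ρ)) (hh.comp hrm).aemeasurable, lintegral_congr e1,
    lintegral_const_mul _ hmeas.lintegral_prod_right']
  rw [lintegral_lintegral_swap (f := fun θ y => A.indicator (fun p => h p.2) (θ, y))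
    hmeas.aemeasurable]
  -- After exchanging the integrals, what remains is the measure of the parameters whose box
  -- contains `y`, at most `t^(m-e)`. Together with `t^(-m)` this gives the density `t^(-e)`.
  have e2 : ∀ y : Fin m → ℝ, ∫⁻ θ in unitBox m, A.indicator (fun p => h p.2) (θ, y) ≤
      ENNReal.ofReal (t ^ ((m : ℝ) - e)) * h y := by
    intro y
    have hs : MeasurableSet {θ : Fin m → ℝ | ∀ i, |y i - S.phi (θ i)| ≤ S.kap * t} :=
      measurable_prodMk_right hAm
    have h1 : ∀ θ, A.indicator (fun p : (Fin m → ℝ) × (Fin m → ℝ) => h p.2) (θ, y) =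
      {θ : Fin m → ℝ | ∀ i, |y i - S.phi (θ i)| ≤ S.kap * t}.indicator (fun _ => h y) θ :=
        fun θ => rfl
    rw [lintegral_congr h1, lintegral_indicator hs, Measure.restrict_restrict hs,
      setLIntegral_const, mul_comm]
    gcongr
    refine le_trans (measure_mono ?_) (S.volume_near_le he hem ht ht1 y)
    exact fun θ hθ => ⟨hθ.2, hθ.1⟩
  refine (mul_le_mul_right (lintegral_mono e2) _).trans ?_
  rw [lintegral_const_mul _ hh, ← mul_assoc, ← ENNReal.ofReal_mul (by positivity)]
  refine le_of_eq ?_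
  congr 2
  rw [Real.rpow_sub ht, Real.rpow_natCast, mul_pow, Real.rpow_neg ht.le]
  field_simp

end CantorScale

end Occupation

/-! ### Line integrals and passage to `L¹` limits -/

section Rays

variable {n : ℕ}

theorem inner_gradient_eq {ψ : E n → ℝ} (x v : E n) :
    inner ℝ (gradient ψ x) v = fderiv ℝ ψ x v := by
  unfold gradient
  exact InnerProductSpace.toDual_symm_apply

theorem enorm_sub_le_lintegral_gradient {ψ : E n → ℝ} (hψ : ContDiff ℝ 1 ψ) (x v : E n) {a b : ℝ}
    (hab : a ≤ b) :
    ‖ψ (x + b • v) - ψ (x + a • v)‖ₑ ≤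
      ‖v‖ₑ * ∫⁻ τ in Ioo a b, ‖gradient ψ (x + τ • v)‖ₑ := by
  have hγ : ContDiff ℝ 1 fun τ : ℝ => x + τ • v := by fun_prop
  have hc : ContDiff ℝ 1 fun τ : ℝ => ψ (x + τ • v) := hψ.comp hγ
  have hg : Continuous fun τ : ℝ => gradient ψ (x + τ • v) :=
    (continuous_gradient hψ).comp hγ.continuous
  refine (enorm_sub_le_lintegral_deriv_of_contDiffOn_Icc hc.contDiffOn hab).trans ?_
  rw [← lintegral_const_mul _ hg.measurable.enorm, restrict_Ioo_eq_restrict_Icc]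
  refine lintegral_mono fun τ => ?_
  have h1 : HasDerivAt (fun τ : ℝ => x + τ • v) v τ := by
    simpa using ((hasDerivAt_id τ).smul_const v).const_add x
  have h2 : HasFDerivAt ψ (fderiv ℝ ψ (x + τ • v)) (x + τ • v) :=
    (hψ.differentiable one_ne_zero _).hasFDerivAt
  have h3 := h2.comp_hasDerivAt τ h1
  have h4 : deriv (fun τ : ℝ => ψ (x + τ • v)) τ = inner ℝ (gradient ψ (x + τ • v)) v := by
    rw [inner_gradient_eq]; exact h3.deriv
  rw [h4, mul_comm, ← ofReal_norm, ← ofReal_norm (gradient ψ _), ← ofReal_norm v,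
    ← ENNReal.ofReal_mul (norm_nonneg _)]
  exact ENNReal.ofReal_le_ofReal (norm_inner_le_norm _ _)

theorem le_of_forall_le_add_mul {a b C : ℝ≥0∞} (hC : C ≠ ⊤)
    (h : ∀ δ : ℝ≥0∞, δ ≠ 0 → a ≤ b + C * δ) : a ≤ b := by
  have h1 : Tendsto (fun δ : ℝ≥0∞ => b + C * δ) (𝓝[≠] 0) (𝓝 (b + C * 0)) := by
    refine Tendsto.mono_left ?_ nhdsWithin_le_nhds
    exact tendsto_const_nhds.add (ENNReal.Tendsto.const_mul tendsto_id (Or.inr hC))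
  rw [mul_zero, add_zero] at h1
  exact ge_of_tendsto h1 (eventually_nhdsWithin_of_forall fun δ hδ => h δ hδ)

/-- An inequality between functionals that are Lipschitz for the `L¹` distances extends from a
class of smooth functions to its limits. -/
theorem IsL1Limit.functional_le {𝒜 : Set (E n → ℝ)} {Ω : Set (E n)} {u : E n → ℝ} {D : E n → E n}
    (h : IsL1Limit 𝒜 Ω u D) {J : (E n → ℝ) → ℝ≥0∞} {B : (E n → E n) → ℝ≥0∞} {c C₁ C₂ : ℝ≥0∞}
    (hc : c ≠ ⊤) (hC₁ : C₁ ≠ ⊤) (hC₂ : C₂ ≠ ⊤)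
    (hJ : ∀ ψ ∈ 𝒜, J u ≤ J ψ + C₁ * ∫⁻ x in Ω, ‖u x - ψ x‖ₑ)
    (hB : ∀ ψ ∈ 𝒜, B (gradient ψ) ≤ B D + C₂ * ∫⁻ x in Ω, ‖D x - gradient ψ x‖ₑ)
    (hJB : ∀ ψ ∈ 𝒜, J ψ ≤ c * B (gradient ψ)) : J u ≤ c * B D := by
  refine le_of_forall_le_add_mul (C := c * C₂ + C₁)
    (ENNReal.add_ne_top.2 ⟨ENNReal.mul_ne_top hc hC₂, hC₁⟩) fun δ hδ => ?_
  obtain ⟨ψ, hψ, h1, h2⟩ := h.2.2 δ hδ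
  calc J u ≤ c * B (gradient ψ) + C₁ * δ := by
        refine (hJ ψ hψ).trans ?_
        gcongr
        exact hJB ψ hψ
    _ ≤ c * (B D + C₂ * δ) + C₁ * δ := by
        gcongr
        refine (hB ψ hψ).trans ?_
        gcongr
    _ = _ := by ring

end Rays

/-! ### Trace inequality on the cones -/

section Cones

namespace CantorScale

variable (S : CantorScale) {m : ℕ} {e : ℝ}

/-- The point at height `ς t` on a ray. -/
def cone (ς : ℝ) (p : ℝ × (Fin m → ℝ) × (Fin m → ℝ)) : E (m + 1) := pt (ς * p.1) (S.ray p.1 p.2)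

theorem measurable_cone (ς : ℝ) :
    Measurable (S.cone ς : ℝ × (Fin m → ℝ) × (Fin m → ℝ) → E (m + 1)) :=
  measurable_pt.comp ((measurable_const.mul measurable_fst).prodMk S.measurable_ray)

theorem cone_eq (ς t : ℝ) (ρ : (Fin m → ℝ) × (Fin m → ℝ)) :
    S.cone ς (t, ρ) = pt 0 (fun i => S.phi (ρ.1 i)) + t • pt ς fun i => S.kap * ρ.2 i := by
  ext i
  refine Fin.cases ?_ (fun i => ?_) i
  · simp [cone, mul_comm]
  · simp [cone, ray]; ring

/-- The measure on pairs of a height in `(r, r')` and a ray. -/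
def coneMeasure (m : ℕ) (r r' : ℝ) : Measure (ℝ × (Fin m → ℝ) × (Fin m → ℝ)) :=
  (volume.restrict (Ioo r r')).prod (rayMeasure m)

theorem coneMeasure_eq (r r' : ℝ) :
    coneMeasure m r r' = (volume.prod (rayMeasure m)).restrict (Ioo r r' ×ˢ univ) := by
  unfold coneMeasure
  rw [← Measure.prod_restrict, Measure.restrict_univ]

theorem coneMeasure_univ (r r' : ℝ) :
    coneMeasure m r r' univ = ENNReal.ofReal (r' - r) * 2 ^ m := by
  unfold coneMeasure
  rw [← univ_prod_univ, Measure.prod_prod, rayMeasure_univ, Measure.restrict_apply_univ,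
    Real.volume_Ioo]

theorem coneMeasure_mono {r₁ r₂ r₁' r₂' : ℝ} (h : Ioo r₁ r₁' ⊆ Ioo r₂ r₂') :
    coneMeasure m r₁ r₁' ≤ coneMeasure m r₂ r₂' := by
  rw [coneMeasure_eq, coneMeasure_eq]
  exact Measure.restrict_mono (prod_mono h Subset.rfl) le_rfl

theorem ae_coneMeasure (r r' : ℝ) :
    ∀ᵐ p ∂coneMeasure m r r', p.1 ∈ Ioo r r' ∧ p.2.2 ∈ dirBox m := by
  have h1 : ∀ᵐ p ∂coneMeasure m r r', p.1 ∈ Ioo r r' := by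
    unfold coneMeasure
    exact Measure.quasiMeasurePreserving_fst.ae (ae_restrict_mem measurableSet_Ioo)
  have h2 : ∀ᵐ p ∂coneMeasure m r r', p.2.1 ∈ unitBox m ∧ p.2.2 ∈ dirBox m := by
    unfold coneMeasure
    exact Measure.quasiMeasurePreserving_snd.ae ae_rayMeasure
  filter_upwards [h1, h2] with p a b using ⟨a, b.2⟩

theorem cone_mem_cube {ς : ℝ} (hς : |ς| = 1) {p : ℝ × (Fin m → ℝ) × (Fin m → ℝ)}
    (hp : p.1 ∈ Ioo (0 : ℝ) 1) (hp' : p.2.2 ∈ dirBox m) : S.cone ς p ∈ cube (m + 1) := by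
  refine S.pt_ray_mem_cube hp.1.le hp.2.le ?_ hp'
  rw [abs_mul, hς, one_mul, abs_of_pos hp.1]
  exact hp.2

theorem lintegral_sign_mul {ς : ℝ} (hς : |ς| = 1) (f : ℝ → ℝ≥0∞) :
    ∫⁻ t, f (ς * t) = ∫⁻ t, f t := by
  rcases (abs_eq zero_le_one).1 hς with h | h
  · simp [h]
  · simp only [h, neg_mul, one_mul]
    exact lintegral_neg_eq_self f

/-- The weight `t^e` cancels the occupation density `t^(-e)`, so weighted integrals over the cones
are controlled by volume integrals with a constant uniform up to the vertices. -/
theorem lintegral_cone_le (he : (2 * S.lam) ^ m = S.lam ^ e) (hem : e ≤ m) {ς : ℝ} (hς : |ς| = 1)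
    {f : E (m + 1) → ℝ≥0∞} (hf : Measurable f) :
    ∫⁻ p, ENNReal.ofReal (p.1 ^ e) * f (S.cone ς p) ∂coneMeasure m 0 1 ≤
      ENNReal.ofReal (S.kap ^ m)⁻¹ * ∫⁻ z in cube (m + 1), f z := by
  have hk := S.kap_pos
  set f' := (cube (m + 1)).indicator f with hf'
  have hfm : Measurable f' := hf.indicator isOpen_cube.measurableSet
  have e1 : ∫⁻ p, ENNReal.ofReal (p.1 ^ e) * f (S.cone ς p) ∂coneMeasure m 0 1 =
      ∫⁻ p, ENNReal.ofReal (p.1 ^ e) * f' (S.cone ς p) ∂coneMeasure m 0 1 := by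
    refine lintegral_congr_ae ?_
    filter_upwards [ae_coneMeasure (m := m) 0 1] with p hp
    rw [hf', indicator_of_mem (S.cone_mem_cube hς hp.1 hp.2)]
  have hw : Measurable fun p : ℝ × (Fin m → ℝ) × (Fin m → ℝ) => ENNReal.ofReal (p.1 ^ e) :=
    (measurable_fst.pow_const e).ennreal_ofReal
  have hm1 : ∀ t, Measurable fun y : Fin m → ℝ => f' (pt t y) := fun t =>
    hfm.comp (measurable_pt.comp (measurable_const.prodMk measurable_id))
  have hm2 : Measurable fun t => ∫⁻ y : Fin m → ℝ, f' (pt t y) :=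
    (hfm.comp measurable_pt).lintegral_prod_right'
  rw [e1]
  unfold coneMeasure
  rw [lintegral_prod (fun p : ℝ × (Fin m → ℝ) × (Fin m → ℝ) =>
    ENNReal.ofReal (p.1 ^ e) * f' (S.cone ς p))
    (hw.mul (hfm.comp (S.measurable_cone ς))).aemeasurable]
  calc _ ≤ ∫⁻ t in Ioo (0 : ℝ) 1, ENNReal.ofReal (S.kap ^ m)⁻¹ *
        ∫⁻ y : Fin m → ℝ, f' (pt (ς * t) y) := by
        refine setLIntegral_mono_ae' measurableSet_Ioo (Eventually.of_forall fun t ht => ?_)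
        have hc : Measurable fun ρ : (Fin m → ℝ) × (Fin m → ℝ) => f' (S.cone ς (t, ρ)) :=
          hfm.comp ((S.measurable_cone ς).comp (measurable_const.prodMk measurable_id))
        show ∫⁻ ρ, ENNReal.ofReal (t ^ e) * f' (S.cone ς (t, ρ)) ∂rayMeasure m ≤ _
        rw [lintegral_const_mul _ hc]
        refine (mul_le_mul_right
          (S.lintegral_ray_le he hem ht.1 ht.2.le (hm1 (ς * t))) _).trans (le_of_eq ?_)
        rw [← mul_assoc, ← ENNReal.ofReal_mul (Real.rpow_nonneg ht.1.le _)]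
        congr 2
        rw [mul_comm, mul_assoc, ← Real.rpow_add ht.1, neg_add_cancel, Real.rpow_zero, mul_one]
    _ ≤ ∫⁻ t : ℝ, ENNReal.ofReal (S.kap ^ m)⁻¹ * ∫⁻ y : Fin m → ℝ, f' (pt (ς * t) y) :=
        setLIntegral_le_lintegral _ _
    _ = ENNReal.ofReal (S.kap ^ m)⁻¹ * ∫⁻ t : ℝ, ∫⁻ y : Fin m → ℝ, f' (pt (ς * t) y) :=
        lintegral_const_mul _ (hm2.comp (measurable_const.mul measurable_id))
    _ = _ := by
        rw [lintegral_sign_mul hς fun t => ∫⁻ y : Fin m → ℝ, f' (pt t y), ← lintegral_pt hfm,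
          hf', lintegral_indicator isOpen_cube.measurableSet]

/-- At heights above `r` the weight may be dropped at the cost of `r^(-e)`. This makes integrals
over a window continuous for `L¹` convergence. -/
theorem lintegral_cone_window_le (he : (2 * S.lam) ^ m = S.lam ^ e) (hem : e ≤ m) (he0 : 0 ≤ e)
    {ς : ℝ} (hς : |ς| = 1) {f : E (m + 1) → ℝ≥0∞} (hf : Measurable f) {r r' : ℝ} (hr : 0 < r)
    (hr' : r' ≤ 1) :
    ∫⁻ p, f (S.cone ς p) ∂coneMeasure m r r' ≤
      ENNReal.ofReal ((S.kap ^ m)⁻¹ * r ^ (-e)) * ∫⁻ z in cube (m + 1), f z := by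
  have hk := S.kap_pos
  calc _ ≤ ∫⁻ p, ENNReal.ofReal (r ^ (-e)) * (ENNReal.ofReal (p.1 ^ e) * f (S.cone ς p))
        ∂coneMeasure m r r' := by
        refine lintegral_mono_ae ?_
        filter_upwards [ae_coneMeasure (m := m) r r'] with p hp
        rw [← mul_assoc, ← ENNReal.ofReal_mul (by positivity)]
        refine le_mul_of_one_le_left zero_le ?_
        rw [ENNReal.one_le_ofReal, Real.rpow_neg hr.le, inv_mul_eq_div,
          one_le_div (by positivity)]
        exact Real.rpow_le_rpow hr.le hp.1.1.le he0
    _ ≤ ∫⁻ p, ENNReal.ofReal (r ^ (-e)) * (ENNReal.ofReal (p.1 ^ e) * f (S.cone ς p))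
        ∂coneMeasure m 0 1 :=
        lintegral_mono' (coneMeasure_mono (Ioo_subset_Ioo hr.le hr')) le_rfl
    _ ≤ ENNReal.ofReal (r ^ (-e)) * (ENNReal.ofReal (S.kap ^ m)⁻¹ * ∫⁻ z in cube (m + 1), f z) := by
        rw [lintegral_const_mul']
        · gcongr
          exact S.lintegral_cone_le he hem hς hf
        · exact ENNReal.ofReal_ne_top
    _ = _ := by
        rw [← mul_assoc, ← ENNReal.ofReal_mul (by positivity), mul_comm (r ^ (-e))]

/-- Points at height `±1` are outside the open cube, where the test function vanishes, and there
`block 0` has cutoff `1` and profile `±1`. -/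
theorem shifted_cone_one {M ς : ℝ} (hς : |ς| = 1) {ψ : E (m + 1) → ℝ}
    (hψ : ψ ∈ shiftedTestFunctions (cube (m + 1)) fun z => M * S.block 0 z)
    {ρ : (Fin m → ℝ) × (Fin m → ℝ)} (hρ : ρ.2 ∈ dirBox m) : ψ (S.cone ς (1, ρ)) = ς * M := by
  obtain ⟨φ, hφ, rfl⟩ := hψ
  have h1 : S.cone ς (1, ρ) ∉ cube (m + 1) := fun h => by
    have h2 : |S.cone ς (1, ρ) 0| < 1 := abs_lt_of_mem_cube h
    simp [cone, hς] at h2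
  have h3 : S.hcut 3 (S.cone ς (1, ρ)) = 1 :=
    S.hcut_pt_ray (k := 0) zero_le_one (by simp) hρ
  have h4 : S.hcut 0 (S.cone ς (1, ρ)) = 1 :=
    S.hcut_eq_one_of_lt (k := 3) (by norm_num) (by rw [h3]; exact one_ne_zero)
  have h5 : S.prof ς = ς := by
    rcases (abs_eq zero_le_one).1 hς with h | h
    · rw [h, S.prof_one]
    · rw [h, S.prof_neg, S.prof_one]
  have h6 : S.cone ς (1, ρ) 0 = ς := by simp [cone]
  simp only [hφ.eq_zero h1, add_zero, block, h4, h6, pow_zero, div_one, h5, one_mul]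
  ring

theorem enorm_direction_le {ς : ℝ} (hς : |ς| = 1) {σ : Fin m → ℝ} (hσ : σ ∈ dirBox m) :
    ‖pt ς fun i => S.kap * σ i‖ₑ ≤ ENNReal.ofReal (m + 1) := by
  rw [← ofReal_norm]
  refine ENNReal.ofReal_le_ofReal ?_
  suffices h : ∀ j, |(pt ς fun i => S.kap * σ i) j| ≤ 1 by
    simpa using norm_le_of_forall_abs_le zero_le_one h
  refine Fin.cases ?_ ?_
  · simp [hς]
  · intro i
    have h1 := abs_le_one_of_mem_dirBox hσ i
    have h2 := S.kap_lt
    have h3 := S.kap_pos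
    rw [pt_succ, abs_mul, abs_of_pos h3]
    nlinarith [abs_nonneg (σ i)]

theorem enorm_cone_sub_le {M ς : ℝ} (hς : |ς| = 1) {ψ : E (m + 1) → ℝ}
    (hψ : ψ ∈ shiftedTestFunctions (cube (m + 1)) fun z => M * S.block 0 z)
    {ρ : (Fin m → ℝ) × (Fin m → ℝ)} (hρ : ρ.2 ∈ dirBox m) {r t : ℝ} (ht : t ∈ Ioo r 1) :
    ‖ψ (S.cone ς (t, ρ)) - ς * M‖ₑ ≤
      ENNReal.ofReal (m + 1) * ∫⁻ τ in Ioo r 1, ‖gradient ψ (S.cone ς (τ, ρ))‖ₑ := by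
  have hc : ContDiff ℝ 1 ψ := contDiff_of_mem_shiftedTestFunctions
    (contDiff_const.mul (S.contDiff_one_block 0)) hψ
  rw [← S.shifted_cone_one hς hψ hρ, ← enorm_neg, neg_sub]
  simp only [cone_eq]
  refine (enorm_sub_le_lintegral_gradient hc _ _ ht.2.le).trans ?_
  gcongr
  · exact S.enorm_direction_le hς hρ
  · exact ht.1.le

/-- The trace inequality along the rays, over a window of heights. -/
theorem lintegral_cone_sub_le (he : (2 * S.lam) ^ m = S.lam ^ e) (hem : e ≤ m) (he0 : 0 ≤ e)
    {M ς : ℝ} (hς : |ς| = 1) {u : E (m + 1) → ℝ} {D : E (m + 1) → E (m + 1)} (hu : Measurable u)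
    (hD : Measurable D) (h : IsL1Limit (shiftedTestFunctions (cube (m + 1))
      fun z => M * S.block 0 z) (cube (m + 1)) u D) {r r' : ℝ} (hr : 0 < r) (hr' : r' ≤ 1) :
    ∫⁻ p, ‖u (S.cone ς p) - ς * M‖ₑ ∂coneMeasure m r r' ≤
      ENNReal.ofReal (r' - r) * ENNReal.ofReal (m + 1) *
        ∫⁻ p, ‖D (S.cone ς p)‖ₑ ∂coneMeasure m 0 1 := by
  have hcone := S.measurable_cone (m := m) ς
  have hψc : ∀ ψ ∈ shiftedTestFunctions (cube (m + 1)) fun z => M * S.block 0 z,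
      ContDiff ℝ 1 ψ := fun ψ hψ => contDiff_of_mem_shiftedTestFunctions
    (contDiff_const.mul (S.contDiff_one_block 0)) hψ
  -- Heights are kept above `r` so that both functionals are Lipschitz in `L¹`. Those Lipschitz
  -- constants blow up as `r → 0`, but the final constant does not involve them.
  have key := h.functional_le
    (J := fun v => ∫⁻ p, ‖v (S.cone ς p) - ς * M‖ₑ ∂coneMeasure m r r')
    (B := fun G => ∫⁻ p, ‖G (S.cone ς p)‖ₑ ∂coneMeasure m r 1)
    (c := ENNReal.ofReal (r' - r) * ENNReal.ofReal (m + 1))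
    (C₁ := ENNReal.ofReal ((S.kap ^ m)⁻¹ * r ^ (-e)))
    (C₂ := ENNReal.ofReal ((S.kap ^ m)⁻¹ * r ^ (-e)))
    (ENNReal.mul_ne_top ENNReal.ofReal_ne_top ENNReal.ofReal_ne_top)
    ENNReal.ofReal_ne_top ENNReal.ofReal_ne_top ?_ ?_ ?_
  · refine key.trans ?_
    gcongr
    exact coneMeasure_mono (Ioo_subset_Ioo hr.le le_rfl)
  · intro ψ hψ
    have hψm : Measurable ψ := (hψc ψ hψ).continuous.measurable
    calc _ ≤ ∫⁻ p, ‖ψ (S.cone ς p) - ς * M‖ₑ + ‖u (S.cone ς p) - ψ (S.cone ς p)‖ₑ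
          ∂coneMeasure m r r' := by
          refine lintegral_mono fun p => ?_
          have : u (S.cone ς p) - ς * M =
            (ψ (S.cone ς p) - ς * M) + (u (S.cone ς p) - ψ (S.cone ς p)) := by ring
          rw [this]
          exact enorm_add_le _ _
      _ = (∫⁻ p, ‖ψ (S.cone ς p) - ς * M‖ₑ ∂coneMeasure m r r') +
          ∫⁻ p, ‖u (S.cone ς p) - ψ (S.cone ς p)‖ₑ ∂coneMeasure m r r' :=
          lintegral_add_left ((hψm.comp hcone).sub_const _).enorm _
      _ ≤ _ := by
          gcongr
          exact S.lintegral_cone_window_le he hem he0 hς (hu.sub hψm).enorm hr hr'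
  · intro ψ hψ
    have hgm : Measurable (gradient ψ) := (continuous_gradient (hψc ψ hψ)).measurable
    calc _ ≤ ∫⁻ p, ‖D (S.cone ς p)‖ₑ + ‖D (S.cone ς p) - gradient ψ (S.cone ς p)‖ₑ
          ∂coneMeasure m r 1 := by
          refine lintegral_mono fun p => ?_
          have : gradient ψ (S.cone ς p) =
            D (S.cone ς p) - (D (S.cone ς p) - gradient ψ (S.cone ς p)) := by abel
          conv_lhs => rw [this]
          exact enorm_sub_le
      _ = (∫⁻ p, ‖D (S.cone ς p)‖ₑ ∂coneMeasure m r 1) +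
          ∫⁻ p, ‖D (S.cone ς p) - gradient ψ (S.cone ς p)‖ₑ ∂coneMeasure m r 1 :=
          lintegral_add_left (hD.comp hcone).enorm _
      _ ≤ _ := by
          gcongr
          exact S.lintegral_cone_window_le he hem he0 hς (hD.sub hgm).enorm hr le_rfl
  · intro ψ hψ
    have hψm : Measurable ψ := (hψc ψ hψ).continuous.measurable
    have hgm : Measurable (gradient ψ) := (continuous_gradient (hψc ψ hψ)).measurable
    have m1 : Measurable fun p : ℝ × (Fin m → ℝ) × (Fin m → ℝ) => ‖ψ (S.cone ς p) - ς * M‖ₑ :=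
      ((hψm.comp hcone).sub_const _).enorm
    have m2 : Measurable fun p : ℝ × (Fin m → ℝ) × (Fin m → ℝ) => ‖gradient ψ (S.cone ς p)‖ₑ :=
      (hgm.comp hcone).enorm
    simp only [coneMeasure]
    rw [lintegral_prod_symm _ m1.aemeasurable, lintegral_prod_symm _ m2.aemeasurable,
      ← lintegral_const_mul _ m2.lintegral_prod_left']
    refine lintegral_mono_ae ?_
    filter_upwards [ae_rayMeasure (m := m)] with ρ hρ
    calc _ ≤ ∫⁻ _ in Ioo r r', ENNReal.ofReal (m + 1) *
          ∫⁻ τ in Ioo r 1, ‖gradient ψ (S.cone ς (τ, ρ))‖ₑ := by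
          refine setLIntegral_mono_ae' measurableSet_Ioo (Eventually.of_forall fun t ht => ?_)
          exact S.enorm_cone_sub_le hς hψ hρ.2 ⟨ht.1, ht.2.trans_le hr'⟩
      _ = _ := by
          rw [setLIntegral_const, Real.volume_Ioo]
          ring

end CantorScale

end Cones

/-! ### Gradient integrals on the cones by Hölder's inequality -/

section Traces

namespace CantorScale

variable (S : CantorScale) {m : ℕ} {e : ℝ}

theorem rpow_le_aOut_cone {β ς : ℝ} (hβ : 0 ≤ β) (hς : |ς| = 1)
    {p : ℝ × (Fin m → ℝ) × (Fin m → ℝ)} (hp : p.1 ∈ Ioo (0 : ℝ) 1) (hp' : p.2.2 ∈ dirBox m) :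
    p.1 ^ β ≤ S.aOut β (S.cone ς p) := by
  have h0 : |S.cone ς p 0| = p.1 := by
    show |ς * p.1| = p.1
    rw [abs_mul, hς, one_mul, abs_of_pos hp.1]
  obtain ⟨k, hk1, hk2⟩ := S.exists_scale hp.1.ne' (by rw [abs_of_pos hp.1]; exact hp.2.le)
  rw [abs_of_pos hp.1] at hk1 hk2
  have := S.rpow_le_aOut (z := S.cone ς p) hβ (by rw [h0]; exact hk1.le) (by rw [h0]; exact hk2)
    (S.hcut_pt_ray hp.1.le hk2 hp')
  rwa [h0] at this

theorem lintegral_coneMeasure_fst {f : ℝ → ℝ≥0∞} (hf : Measurable f) (r r' : ℝ) :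
    ∫⁻ p, f p.1 ∂coneMeasure m r r' = (∫⁻ t in Ioo r r', f t) * 2 ^ m := by
  unfold coneMeasure
  rw [lintegral_prod (fun p : ℝ × (Fin m → ℝ) × (Fin m → ℝ) => f p.1)
    (hf.comp measurable_fst).aemeasurable]
  simp only [lintegral_const, rayMeasure_univ]
  rw [lintegral_mul_const _ hf]

/-- Gradients whose `q`-th power is integrable against the coefficient are integrable on the cones
over the Cantor set. -/
theorem exists_lintegral_cone_gradient_le (he : (2 * S.lam) ^ m = S.lam ^ e) (hem : e ≤ m)
    (he0 : 0 ≤ e) {α' q : ℝ} (hq : 1 < q) (hα' : 0 < α') (hαe : α' + e < q - 1) :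
    ∃ C : ℝ≥0∞, C ≠ ⊤ ∧ ∀ (ς : ℝ) (D : E (m + 1) → E (m + 1)), |ς| = 1 → Measurable D →
      ∫⁻ p, ‖D (S.cone ς p)‖ₑ ∂coneMeasure m 0 1 ≤
        C * (∫⁻ z in cube (m + 1), ENNReal.ofReal (S.aOut α' z) * ‖D z‖ₑ ^ q) ^ (1 / q) := by
  have hq0 : 0 < q := by linarith
  have hq1 : 0 < q - 1 := by linarith
  have hk := S.kap_pos
  set q' := q / (q - 1) with hq'
  have hconj : q.HolderConjugate q' := Real.HolderConjugate.conjExponent hq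
  have hq'0 : 0 < q' := by positivity
  -- With this exponent `t^(γ q) = t^α' * t^e`: the first factor is at most `aOut` on the cones, the
  -- second is absorbed by the occupation estimate. The dual weight `t^(-γ q')` has exponent `-(α' +
  -- e)/(q - 1) > -1` and is integrable.
  set γ := (α' + e) / q with hγ
  have hγq : γ * q = α' + e := by rw [hγ]; field_simp
  have hγq' : -1 < -γ * q' := by
    have : γ * q' = (α' + e) / (q - 1) := by rw [hγ, hq']; field_simp
    rw [neg_mul, this, neg_lt_neg_iff, div_lt_one hq1]
    exact hαe
  have hfin : ∫⁻ t in Ioo (0 : ℝ) 1, ENNReal.ofReal (t ^ (-γ * q')) ≠ ⊤ := by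
    have h1 := (integrableOn_abs_rpow hγq').mono_set
      (Ioo_subset_Ioo (by norm_num : (-1 : ℝ) ≤ 0) (le_refl (1 : ℝ)))
    have h2 := h1.2
    rw [hasFiniteIntegral_iff_enorm] at h2
    refine ne_top_of_le_ne_top h2.ne ?_
    refine setLIntegral_mono_ae' measurableSet_Ioo (Eventually.of_forall fun t ht => ?_)
    rw [abs_of_pos ht.1]
    exact Real.ofReal_le_enorm _
  have hgm : Measurable fun t : ℝ => ENNReal.ofReal (t ^ (-γ * q')) :=
    (measurable_id.pow_const _).ennreal_ofReal
  refine ⟨ENNReal.ofReal (S.kap ^ m)⁻¹ ^ (1 / q) *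
    ((∫⁻ t in Ioo (0 : ℝ) 1, ENNReal.ofReal (t ^ (-γ * q'))) * 2 ^ m) ^ (1 / q'), ?_, ?_⟩
  · refine ENNReal.mul_ne_top ?_ ?_
    · exact ENNReal.rpow_ne_top_of_nonneg (by positivity) ENNReal.ofReal_ne_top
    · exact ENNReal.rpow_ne_top_of_nonneg (by positivity)
        (ENNReal.mul_ne_top hfin (ENNReal.pow_ne_top (by norm_num)))
  intro ς D hς hD
  have hcone := S.measurable_cone (m := m) ς
  set f : ℝ × (Fin m → ℝ) × (Fin m → ℝ) → ℝ≥0∞ := fun p =>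
    ENNReal.ofReal (p.1 ^ γ) * ‖D (S.cone ς p)‖ₑ with hf
  set g : ℝ × (Fin m → ℝ) × (Fin m → ℝ) → ℝ≥0∞ := fun p => ENNReal.ofReal (p.1 ^ (-γ)) with hg
  have hfm : Measurable f :=
    (measurable_fst.pow_const γ).ennreal_ofReal.mul (hD.comp hcone).enorm
  have hgm' : Measurable g := (measurable_fst.pow_const (-γ)).ennreal_ofReal
  have e1 : ∫⁻ p, ‖D (S.cone ς p)‖ₑ ∂coneMeasure m 0 1 = ∫⁻ p, (f * g) p ∂coneMeasure m 0 1 := by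
    refine lintegral_congr_ae ?_
    filter_upwards [ae_coneMeasure (m := m) 0 1] with p hp
    have h1 := Real.rpow_pos_of_pos hp.1.1 γ
    simp only [hf, hg, Pi.mul_apply]
    rw [mul_right_comm, ← ENNReal.ofReal_mul h1.le, ← Real.rpow_add hp.1.1, add_neg_cancel,
      Real.rpow_zero, ENNReal.ofReal_one, one_mul]
  have e2 : ∫⁻ p, f p ^ q ∂coneMeasure m 0 1 ≤ ENNReal.ofReal (S.kap ^ m)⁻¹ *
      ∫⁻ z in cube (m + 1), ENNReal.ofReal (S.aOut α' z) * ‖D z‖ₑ ^ q := by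
    have hW : Measurable fun z => ENNReal.ofReal (S.aOut α' z) * ‖D z‖ₑ ^ q :=
      (S.continuous_aOut hα').measurable.ennreal_ofReal.mul (hD.enorm.pow_const q)
    refine le_trans (lintegral_mono_ae ?_) (S.lintegral_cone_le he hem hς hW)
    filter_upwards [ae_coneMeasure (m := m) 0 1] with p hp
    have h1 := S.rpow_le_aOut_cone hα'.le hς hp.1 hp.2
    simp only [hf]
    rw [ENNReal.mul_rpow_of_nonneg _ _ hq0.le,
      ENNReal.ofReal_rpow_of_nonneg (Real.rpow_nonneg hp.1.1.le _) hq0.le,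
      ← Real.rpow_mul hp.1.1.le, hγq, Real.rpow_add hp.1.1, mul_comm (p.1 ^ α'),
      ENNReal.ofReal_mul (Real.rpow_nonneg hp.1.1.le _), mul_assoc]
    gcongr
  have e3 : ∫⁻ p, g p ^ q' ∂coneMeasure m 0 1 =
      (∫⁻ t in Ioo (0 : ℝ) 1, ENNReal.ofReal (t ^ (-γ * q'))) * 2 ^ m := by
    rw [← lintegral_coneMeasure_fst hgm]
    refine lintegral_congr_ae ?_
    filter_upwards [ae_coneMeasure (m := m) 0 1] with p hp
    simp only [hg]
    rw [ENNReal.ofReal_rpow_of_nonneg (Real.rpow_nonneg hp.1.1.le _) hq'0.le,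
      ← Real.rpow_mul hp.1.1.le]
  rw [e1]
  refine (ENNReal.lintegral_mul_le_Lp_mul_Lq _ hconj hfm.aemeasurable hgm'.aemeasurable).trans ?_
  rw [e3]
  calc _ ≤ (ENNReal.ofReal (S.kap ^ m)⁻¹ *
      ∫⁻ z in cube (m + 1), ENNReal.ofReal (S.aOut α' z) * ‖D z‖ₑ ^ q) ^ (1 / q) *
      ((∫⁻ t in Ioo (0 : ℝ) 1, ENNReal.ofReal (t ^ (-γ * q'))) * 2 ^ m) ^ (1 / q') := by gcongr
    _ = _ := by
      rw [ENNReal.mul_rpow_of_nonneg _ _ (by positivity)]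
      ring

end CantorScale

end Traces

/-! ### The jump excludes Lebesgue points -/

section LebesguePoints

theorem lintegral_le_add_four {α : Type*} [MeasurableSpace α] {μ : Measure α}
    {a f₁ f₂ f₃ f₄ : α → ℝ≥0∞} (h₁ : Measurable f₁) (h₂ : Measurable f₂) (h₃ : Measurable f₃)
    (h : ∀ x, a x ≤ (f₁ x + f₂ x) + (f₃ x + f₄ x)) :
    ∫⁻ x, a x ∂μ ≤ ((∫⁻ x, f₁ x ∂μ) + ∫⁻ x, f₂ x ∂μ) + ((∫⁻ x, f₃ x ∂μ) + ∫⁻ x, f₄ x ∂μ) := by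
  refine (lintegral_mono h).trans (le_of_eq ?_)
  rw [← lintegral_add_left h₁, ← lintegral_add_left h₃]
  exact lintegral_add_left (h₁.add h₂) _

namespace CantorScale

variable (S : CantorScale) {m : ℕ}

/-- At each height above `r` the directions fill a box of side at least comparable to `kap * r`, and
all points reached lie within `(m + 1) * r'` of the vertex. -/
theorem lintegral_cone_le_ball {f : E (m + 1) → ℝ≥0∞} (hf : Measurable f) {ς : ℝ} (hς : |ς| = 1)
    (θ : Fin m → ℝ) {r r' : ℝ} (hr : 0 < r) (hr' : 0 < r') :
    ∫⁻ σ in dirBox m, ∫⁻ t in Ioo r r', f (S.cone ς (t, θ, σ)) ≤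
      ENNReal.ofReal ((S.kap * r) ^ m)⁻¹ *
        ∫⁻ z in Metric.ball (pt 0 fun i => S.phi (θ i)) ((m + 2) * r'), f z := by
  have hk := S.kap_pos
  set x : Fin m → ℝ := fun i => S.phi (θ i) with hx
  set s := Metric.ball (pt 0 x) ((m + 2) * r') with hs
  set f' := s.indicator f with hf'
  have hfm : Measurable f' := hf.indicator Metric.isOpen_ball.measurableSet
  have hmap : Measurable fun p : (Fin m → ℝ) × ℝ => ((p.2, θ, p.1) : ℝ × (Fin m → ℝ) × (Fin m → ℝ)) :=
    measurable_snd.prodMk (measurable_const.prodMk measurable_fst)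
  have hm0 : Measurable fun p : (Fin m → ℝ) × ℝ => f (S.cone ς (p.2, θ, p.1)) :=
    hf.comp ((S.measurable_cone ς).comp hmap)
  have hm1 : ∀ t, Measurable fun y : Fin m → ℝ => f (pt t y) := fun t =>
    hf.comp (measurable_pt.comp (measurable_const.prodMk measurable_id))
  have hm2 : Measurable fun t => ∫⁻ y : Fin m → ℝ, f' (pt t y) :=
    (hfm.comp measurable_pt).lintegral_prod_right'
  rw [lintegral_lintegral_swap (f := fun σ t => f (S.cone ς (t, θ, σ))) hm0.aemeasurable]
  calc _ ≤ ∫⁻ t in Ioo r r', ENNReal.ofReal ((S.kap * r) ^ m)⁻¹ *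
        ∫⁻ y : Fin m → ℝ, f' (pt (ς * t) y) := by
        refine setLIntegral_mono_ae' measurableSet_Ioo (Eventually.of_forall fun t ht => ?_)
        have ht0 : 0 < t := hr.trans ht.1
        have hset : MeasurableSet {y : Fin m → ℝ | ∀ i, |y i - x i| ≤ S.kap * t} := by
          simp only [ofPred_forall]
          exact MeasurableSet.iInter fun i => measurableSet_le (by fun_prop) measurable_const
        refine (lintegral_dirBox (hm1 (ς * t)) x (by positivity : 0 < S.kap * t)).trans_le ?_
        refine mul_le_mul' (ENNReal.ofReal_le_ofReal ?_) ?_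
        · have := ht.1.le
          gcongr
        rw [← lintegral_indicator hset]
        refine lintegral_mono fun y => ?_
        by_cases hy : y ∈ {y : Fin m → ℝ | ∀ i, |y i - x i| ≤ S.kap * t}
        · rw [indicator_of_mem hy, hf', indicator_of_mem]
          rw [hs, Metric.mem_ball, dist_eq_norm]
          have hb : ∀ j, |(pt (ς * t) y - pt 0 x) j| ≤ r' := by
            refine Fin.cases ?_ fun i => ?_
            · simp only [PiLp.sub_apply, pt_zero, sub_zero, abs_mul, hς, one_mul]
              rw [abs_of_pos ht0]; exact ht.2.le
            · simp only [PiLp.sub_apply, pt_succ]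
              refine (hy i).trans ?_
              nlinarith [S.kap_lt, ht.2]
          refine (norm_le_of_forall_abs_le hr'.le hb).trans_lt ?_
          push_cast
          nlinarith
        · rw [indicator_of_notMem hy]
          exact zero_le
    _ ≤ ∫⁻ t : ℝ, ENNReal.ofReal ((S.kap * r) ^ m)⁻¹ * ∫⁻ y : Fin m → ℝ, f' (pt (ς * t) y) :=
        setLIntegral_le_lintegral _ _
    _ = ENNReal.ofReal ((S.kap * r) ^ m)⁻¹ * ∫⁻ t : ℝ, ∫⁻ y : Fin m → ℝ, f' (pt (ς * t) y) :=
        lintegral_const_mul _ (hm2.comp (measurable_const.mul measurable_id))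
    _ = _ := by
        rw [lintegral_sign_mul hς fun t => ∫⁻ y : Fin m → ℝ, f' (pt t y), ← lintegral_pt hfm,
          hf', lintegral_indicator Metric.isOpen_ball.measurableSet]

/-- The mean over the part of the cones of the `k`-th window and over the point with parameter `θ`
of the Cantor set. -/
def coneMean (f : E (m + 1) → ℝ≥0∞) (ς : ℝ) (k : ℕ) (θ : Fin m → ℝ) : ℝ≥0∞ :=
  (ENNReal.ofReal (S.lam ^ k - S.lam ^ (k + 1)))⁻¹ *
    ∫⁻ σ in dirBox m, ∫⁻ t in Ioo (S.lam ^ (k + 1)) (S.lam ^ k), f (S.cone ς (t, θ, σ))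

theorem window_pos (k : ℕ) : 0 < S.lam ^ k - S.lam ^ (k + 1) := by
  have := S.lam_pow_pos k
  rw [pow_succ]
  nlinarith [S.lam_lt_one]

theorem measurable_coneMean_integrand {f : E (m + 1) → ℝ≥0∞} (hf : Measurable f) (ς : ℝ) :
    Measurable fun p : ((Fin m → ℝ) × (Fin m → ℝ)) × ℝ => f (S.cone ς (p.2, p.1)) :=
  hf.comp ((S.measurable_cone ς).comp (measurable_snd.prodMk measurable_fst))

theorem measurable_coneMean {f : E (m + 1) → ℝ≥0∞} (hf : Measurable f) (ς : ℝ) (k : ℕ) :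
    Measurable (S.coneMean f ς k) := by
  have h1 := (S.measurable_coneMean_integrand hf ς).lintegral_prod_right'
    (ν := volume.restrict (Ioo (S.lam ^ (k + 1)) (S.lam ^ k)))
  exact h1.lintegral_prod_right'.const_mul _

theorem lintegral_coneMean {f : E (m + 1) → ℝ≥0∞} (hf : Measurable f) (ς : ℝ) (k : ℕ) :
    ∫⁻ θ in unitBox m, S.coneMean f ς k θ =
      (ENNReal.ofReal (S.lam ^ k - S.lam ^ (k + 1)))⁻¹ *
        ∫⁻ p, f (S.cone ς p) ∂coneMeasure m (S.lam ^ (k + 1)) (S.lam ^ k) := by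
  have h1 := (S.measurable_coneMean_integrand hf ς).lintegral_prod_right'
    (ν := volume.restrict (Ioo (S.lam ^ (k + 1)) (S.lam ^ k)))
  unfold coneMean coneMeasure
  rw [lintegral_const_mul _ h1.lintegral_prod_right',
    lintegral_prod_symm (fun p => f (S.cone ς p)) (hf.comp (S.measurable_cone ς)).aemeasurable]
  unfold rayMeasure
  rw [lintegral_prod _ h1.aemeasurable]

/-- The window at scale `lam^k` is a fixed fraction of the ball of radius `(m + 2) * lam^k`, so the
cone mean is at most a constant times the ball average. -/
theorem tendsto_coneMean {u : E (m + 1) → ℝ} (hu : Measurable u)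
    (hi : IntegrableOn u (cube (m + 1))) {ς : ℝ} (hς : |ς| = 1) {θ : Fin m → ℝ} {c : ℝ}
    (h : Tendsto (fun r : ℝ => ⨍ y in Metric.ball (pt 0 fun i => S.phi (θ i)) r, |u y - c|)
      (𝓝[>] 0) (𝓝 0)) :
    Tendsto (fun k => S.coneMean (fun z => ‖u z - c‖ₑ) ς k θ) atTop (𝓝 0) := by
  have hk := S.kap_pos
  have hl := S.lam_pos
  set x : E (m + 1) := pt 0 fun i => S.phi (θ i) with hx
  have hxc : x ∈ cube (m + 1) := by
    refine Fin.cases ?_ fun i => ?_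
    · simp [hx]
    · have := abs_le.1 (S.abs_phi_le (θ i))
      simp only [hx, pt_succ, mem_Ioo]
      constructor <;> linarith [this.1, this.2]
  obtain ⟨ε, hε, hball⟩ := Metric.isOpen_iff.1 isOpen_cube x hxc
  have hR : Tendsto (fun k : ℕ => ((m : ℝ) + 2) * S.lam ^ k) atTop (𝓝[>] 0) := by
    rw [tendsto_nhdsWithin_iff]
    refine ⟨?_, Eventually.of_forall fun k => ?_⟩
    · simpa using (tendsto_pow_atTop_nhds_zero_of_lt_one hl.le S.lam_lt_one).const_mul ((m : ℝ) + 2)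
    · have := S.lam_pow_pos k
      show 0 < ((m : ℝ) + 2) * S.lam ^ k
      positivity
  set V := volume (Metric.ball (0 : E (m + 1)) 1) with hV
  have hVtop : V ≠ ⊤ := measure_ball_lt_top.ne
  set K : ℝ≥0∞ := ENNReal.ofReal ((1 - S.lam)⁻¹ * ((S.kap * S.lam) ^ m)⁻¹ * (m + 2) ^ (m + 1)) * V
    with hK
  have hKtop : K ≠ ⊤ := ENNReal.mul_ne_top ENNReal.ofReal_ne_top hVtop
  have hlim : Tendsto (fun k : ℕ => K * ENNReal.ofReal
      (⨍ y in Metric.ball x (((m : ℝ) + 2) * S.lam ^ k), |u y - c|)) atTop (𝓝 0) := by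
    have h1 := ENNReal.tendsto_ofReal (h.comp hR)
    have h2 := ENNReal.Tendsto.const_mul h1 (Or.inr hKtop)
    simpa using h2
  refine tendsto_of_tendsto_of_tendsto_of_le_of_le' tendsto_const_nhds hlim
    (Eventually.of_forall fun _ => zero_le) ?_
  have hsmall : ∀ᶠ k : ℕ in atTop, ((m : ℝ) + 2) * S.lam ^ k < ε :=
    (hR.mono_right nhdsWithin_le_nhds).eventually (Iio_mem_nhds hε)
  filter_upwards [hsmall] with k hkε
  have hlk := S.lam_pow_pos k
  set R := ((m : ℝ) + 2) * S.lam ^ k with hRdef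
  have hR0 : 0 < R := by positivity
  have hintg : IntegrableOn (fun y => |u y - c|) (Metric.ball x R) := by
    have h1 : IntegrableOn u (Metric.ball x R) :=
      hi.mono_set ((Metric.ball_subset_ball hkε.le).trans hball)
    have h2 : IntegrableOn (fun _ : E (m + 1) => c) (Metric.ball x R) := by
      simp [integrableOn_const_iff, measure_ball_lt_top]
    exact (h1.sub h2).abs
  have havg := ofReal_setAverage hintg (Eventually.of_forall fun y => abs_nonneg _)
  have hball_pos : volume (Metric.ball x R) ≠ 0 := (Metric.measure_ball_pos _ _ hR0).ne'
  have hball_top : volume (Metric.ball x R) ≠ ⊤ := measure_ball_lt_top.ne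
  have hlint : ∫⁻ y in Metric.ball x R, ‖u y - c‖ₑ =
      volume (Metric.ball x R) * ENNReal.ofReal (⨍ y in Metric.ball x R, |u y - c|) := by
    rw [havg, ENNReal.mul_div_cancel hball_pos hball_top]
    exact lintegral_congr fun y => Real.enorm_eq_ofReal_abs _
  have hm : Measurable fun z => ‖u z - c‖ₑ := (hu.sub_const c).enorm
  unfold coneMean
  refine (mul_le_mul_right (S.lintegral_cone_le_ball hm hς θ (S.lam_pow_pos (k + 1)) hlk) _).trans
    (le_of_eq ?_)
  rw [← hx, ← hRdef, hlint, ← mul_assoc, ← mul_assoc]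
  congr 1
  rw [Measure.addHaar_ball _ _ hR0.le, finrank_euclideanSpace_fin, ← hV, ← mul_assoc, hK,
    ← ENNReal.ofReal_inv_of_pos (S.window_pos k), ← ENNReal.ofReal_mul (by
      have := S.window_pos k; positivity), ← ENNReal.ofReal_mul (by
      have := S.window_pos k; positivity)]
  congr 2
  have h1 : S.lam ^ k - S.lam ^ (k + 1) = S.lam ^ k * (1 - S.lam) := by ring
  have h2 : (1 - S.lam) ≠ 0 := by linarith [S.lam_lt_one]
  rw [h1, hRdef, pow_succ S.lam k]
  field_simp
  simp only [mul_pow]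
  ring

/-- Triangle inequality through `c` for the distance `2 * M` between the values `M` and `-M`,
averaged over the window. The factor `2^m` is the volume of `dirBox`. -/
theorem le_coneMean_add {M c : ℝ} {u : E (m + 1) → ℝ} (hu : Measurable u) (k : ℕ)
    (θ : Fin m → ℝ) :
    2 ^ m * ENNReal.ofReal (2 * M) ≤
      (S.coneMean (fun z => ‖u z - 1 * M‖ₑ) 1 k θ + S.coneMean (fun z => ‖u z - -1 * M‖ₑ) (-1) k θ)
      + (S.coneMean (fun z => ‖u z - c‖ₑ) 1 k θ + S.coneMean (fun z => ‖u z - c‖ₑ) (-1) k θ) := by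
  have hw := S.window_pos k
  have hmeas : ∀ (d ς : ℝ), Measurable fun p : (Fin m → ℝ) × ℝ =>
      ‖u (S.cone ς (p.2, θ, p.1)) - d‖ₑ := fun d ς =>
    ((hu.comp ((S.measurable_cone ς).comp
      (measurable_snd.prodMk (measurable_const.prodMk measurable_fst)))).sub_const d).enorm
  have hmeas1 : ∀ (d ς : ℝ) (σ : Fin m → ℝ), Measurable fun t : ℝ =>
      ‖u (S.cone ς (t, θ, σ)) - d‖ₑ := fun d ς σ =>
    (hmeas d ς).comp (measurable_const.prodMk measurable_id)
  have hmeas2 : ∀ (d ς : ℝ), Measurable fun σ : Fin m → ℝ =>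
      ∫⁻ t in Ioo (S.lam ^ (k + 1)) (S.lam ^ k), ‖u (S.cone ς (t, θ, σ)) - d‖ₑ := fun d ς =>
    (hmeas d ς).lintegral_prod_right'
  have hpt : ∀ σ : Fin m → ℝ, ENNReal.ofReal (S.lam ^ k - S.lam ^ (k + 1)) *
      ENNReal.ofReal (2 * M) ≤
      ((∫⁻ t in Ioo (S.lam ^ (k + 1)) (S.lam ^ k), ‖u (S.cone 1 (t, θ, σ)) - 1 * M‖ₑ) +
        ∫⁻ t in Ioo (S.lam ^ (k + 1)) (S.lam ^ k), ‖u (S.cone (-1) (t, θ, σ)) - -1 * M‖ₑ) +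
      ((∫⁻ t in Ioo (S.lam ^ (k + 1)) (S.lam ^ k), ‖u (S.cone 1 (t, θ, σ)) - c‖ₑ) +
        ∫⁻ t in Ioo (S.lam ^ (k + 1)) (S.lam ^ k), ‖u (S.cone (-1) (t, θ, σ)) - c‖ₑ) := by
    intro σ
    rw [mul_comm, ← Real.volume_Ioo, ← setLIntegral_const]
    refine lintegral_le_add_four (hmeas1 _ _ _) (hmeas1 _ _ _) (hmeas1 _ _ _) fun t => ?_
    simp only [Real.enorm_eq_ofReal_abs]
    rw [← ENNReal.ofReal_add (abs_nonneg _) (abs_nonneg _),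
      ← ENNReal.ofReal_add (abs_nonneg _) (abs_nonneg _),
      ← ENNReal.ofReal_add (by positivity) (by positivity)]
    refine ENNReal.ofReal_le_ofReal ?_
    have h1 := neg_abs_le (u (S.cone 1 (t, θ, σ)) - 1 * M)
    have h2 := le_abs_self (u (S.cone 1 (t, θ, σ)) - c)
    have h3 := le_abs_self (u (S.cone (-1) (t, θ, σ)) - -1 * M)
    have h4 := neg_abs_le (u (S.cone (-1) (t, θ, σ)) - c)
    linarith
  calc 2 ^ m * ENNReal.ofReal (2 * M) = (ENNReal.ofReal (S.lam ^ k - S.lam ^ (k + 1)))⁻¹ *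
        ∫⁻ _ in dirBox m, ENNReal.ofReal (S.lam ^ k - S.lam ^ (k + 1)) *
          ENNReal.ofReal (2 * M) := by
        rw [setLIntegral_const, volume_dirBox, ← mul_assoc, ← mul_assoc,
          ENNReal.inv_mul_cancel (by simpa using hw) ENNReal.ofReal_ne_top, one_mul, mul_comm]
    _ ≤ _ := by
        unfold coneMean
        rw [← mul_add, ← mul_add, ← mul_add]
        gcongr
        exact lintegral_le_add_four (hmeas2 _ _) (hmeas2 _ _) (hmeas2 _ _) hpt

/-- If the means of `u` over the upper and the lower cones stay close to `M` and `-M`, then the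
points of the Cantor set cannot almost all be Lebesgue points. -/
theorem volume_nonLebesgue_ne_zero {M : ℝ} {u : E (m + 1) → ℝ} (hu : Measurable u)
    (hi : IntegrableOn u (cube (m + 1))) {K : ℝ≥0∞} (hK : K < 2 ^ m * ENNReal.ofReal M)
    (hT : ∀ ς : ℝ, |ς| = 1 → ∀ k : ℕ, ∫⁻ p, ‖u (S.cone ς p) - ς * M‖ₑ
      ∂coneMeasure m (S.lam ^ (k + 1)) (S.lam ^ k) ≤
        ENNReal.ofReal (S.lam ^ k - S.lam ^ (k + 1)) * K) :
    volume {θ ∈ unitBox m | ¬ IsLebesguePoint u (pt 0 fun i => S.phi (θ i))} ≠ 0 := by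
  intro h0
  have hae : ∀ᵐ θ ∂volume.restrict (unitBox m),
      IsLebesguePoint u (pt 0 fun i => S.phi (θ i)) := by
    rw [ae_restrict_iff' measurableSet_unitBox, ae_iff]
    simpa only [Classical.not_imp] using h0
  set F : ℕ → (Fin m → ℝ) → ℝ≥0∞ := fun k θ =>
    S.coneMean (fun z => ‖u z - 1 * M‖ₑ) 1 k θ + S.coneMean (fun z => ‖u z - -1 * M‖ₑ) (-1) k θ
    with hF
  have hm : ∀ d : ℝ, Measurable fun z => ‖u z - d‖ₑ := fun d => (hu.sub_const d).enorm
  have hFm : ∀ k, Measurable (F k) := fun k =>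
    (S.measurable_coneMean (hm _) 1 k).add (S.measurable_coneMean (hm _) (-1) k)
  -- At a Lebesgue point both cone means of `|u - c|` tend to zero. The value `c` depends on `θ`,
  -- but the resulting lower bound for the limit does not.
  have hlow : ∀ᵐ θ ∂volume.restrict (unitBox m),
      2 ^ m * ENNReal.ofReal (2 * M) ≤ liminf (fun k => F k θ) atTop := by
    filter_upwards [hae] with θ hθ
    obtain ⟨c, hc⟩ := hθ
    have h1 := (S.tendsto_coneMean hu hi (by simp : |(1 : ℝ)| = 1) hc).add
      (S.tendsto_coneMean hu hi (by simp : |(-1 : ℝ)| = 1) hc)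
    rw [add_zero] at h1
    refine le_of_forall_le_add_mul ENNReal.one_ne_top fun δ hδ => ?_
    rw [one_mul, ← tsub_le_iff_right]
    refine le_liminf_of_le (by isBoundedDefault) ?_
    filter_upwards [h1.eventually (Iic_mem_nhds (pos_iff_ne_zero.2 hδ))] with k hk
    rw [tsub_le_iff_right]
    exact (S.le_coneMean_add (c := c) hu k θ).trans (add_le_add le_rfl hk)
  have hup : ∀ k, ∫⁻ θ in unitBox m, F k θ ≤ 2 * K := fun k => by
    have hw := S.window_pos k
    have h1 : ∀ ς : ℝ, |ς| = 1 →
        ∫⁻ θ in unitBox m, S.coneMean (fun z => ‖u z - ς * M‖ₑ) ς k θ ≤ K := fun ς hς => by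
      rw [S.lintegral_coneMean (hm _)]
      refine (mul_le_mul_right (hT ς hς k) _).trans (le_of_eq ?_)
      rw [← mul_assoc, ENNReal.inv_mul_cancel (by simpa using hw) ENNReal.ofReal_ne_top, one_mul]
    rw [hF, lintegral_add_left (S.measurable_coneMean (hm _) 1 k), two_mul]
    exact add_le_add (h1 1 (by simp)) (h1 (-1) (by simp))
  -- Fatou's lemma over the parameter box of volume one sets the pointwise lower bound `2^m * 2M`
  -- against the integrated upper bound `2K`.
  have h2 : 2 ^ m * ENNReal.ofReal (2 * M) ≤ 2 * K := by
    calc _ = ∫⁻ _ in unitBox m, 2 ^ m * ENNReal.ofReal (2 * M) := by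
          rw [setLIntegral_const, volume_unitBox, mul_one]
      _ ≤ ∫⁻ θ in unitBox m, liminf (fun k => F k θ) atTop := lintegral_mono_ae hlow
      _ ≤ liminf (fun k => ∫⁻ θ in unitBox m, F k θ) atTop := lintegral_liminf_le hFm
      _ ≤ 2 * K := by
          refine liminf_le_of_le (by isBoundedDefault) fun b hb => ?_
          obtain ⟨k, hk⟩ := hb.exists
          exact hk.trans (hup k)
  have h3 : 2 ^ m * ENNReal.ofReal (2 * M) = 2 * (2 ^ m * ENNReal.ofReal M) := by
    rw [ENNReal.ofReal_mul (by norm_num)]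
    simp only [ENNReal.ofReal_ofNat]
    ring
  rw [h3] at h2
  exact absurd ((ENNReal.mul_le_mul_iff_right (by norm_num) (by norm_num)).1 h2) (not_le.2 hK)

end CantorScale

end LebesguePoints

/-! ### Dimension of images of parameter sets -/

section HausdorffDimension

namespace CantorScale

variable (S : CantorScale) {m : ℕ}

theorem abs_sub_le_rpow {d : ℝ} (hd : 0 < d) (hlam : S.lam ^ d = 1 / 2) {x y : ℝ}
    (hx : x ∈ Ico (0 : ℝ) 1) (hy : y ∈ Ico (0 : ℝ) 1) :
    |x - y| ≤ (1 / (1 - 2 * S.lam)) ^ d * |S.phi x - S.phi y| ^ d := by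
  have hl := S.lam_pos
  have hl2 : 0 < 1 - 2 * S.lam := by linarith [S.lam_lt]
  rw [← Real.mul_rpow (by positivity) (abs_nonneg _), one_div_mul_eq_div]
  set ρ := |S.phi x - S.phi y| / (1 - 2 * S.lam) with hρ
  have hpow : ∀ k : ℕ, ((1 / 2 : ℝ)) ^ k = (S.lam ^ k) ^ d := fun k => by
    rw [← hlam, ← Real.rpow_natCast, ← Real.rpow_mul hl.le, ← Real.rpow_natCast,
      ← Real.rpow_mul hl.le, mul_comm]
  have hstep : ∀ k : ℕ, ρ < S.lam ^ k → |x - y| ≤ (1 / 2) ^ (k + 1) := fun k hk => by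
    refine S.abs_sub_le_of_abs_phi_sub_lt k hx hy ?_
    rw [hρ, div_lt_iff₀ hl2] at hk
    linarith
  have hρ0 : 0 ≤ ρ := by positivity
  rcases hρ0.eq_or_lt with h0 | h0
  · have h1 : ∀ k : ℕ, |x - y| ≤ (1 / 2) ^ (k + 1) := fun k =>
      hstep k (by rw [← h0]; exact S.lam_pow_pos k)
    have h2 : Tendsto (fun k : ℕ => (1 / 2 : ℝ) ^ (k + 1)) atTop (𝓝 0) :=
      (tendsto_add_atTop_iff_nat 1).2
        (tendsto_pow_atTop_nhds_zero_of_lt_one (by norm_num) (by norm_num))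
    exact (ge_of_tendsto' h2 h1).trans (Real.rpow_nonneg hρ0 d)
  · rcases lt_or_ge ρ 1 with h1 | h1
    · obtain ⟨k, hk1, hk2⟩ := exists_nat_pow_near_of_lt_one h0 h1.le hl S.lam_lt_one
      -- The digit lemma needs a strict inequality. If `ρ` equals a power of `lam`, the next coarser
      -- scale gives exactly the required bound.
      rcases hk2.lt_or_eq with h2 | h2
      · refine (hstep k h2).trans ?_
        rw [hpow]
        exact Real.rpow_le_rpow (by positivity) hk1.le hd.le
      · cases k with
        | zero => rw [pow_zero] at h2; exact absurd h2 h1.ne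
        | succ k =>
          have h3 : ρ < S.lam ^ k := by
            rw [h2]
            exact pow_lt_pow_right_of_lt_one₀ hl S.lam_lt_one (Nat.lt_succ_self k)
          refine (hstep k h3).trans ?_
          rw [hpow, h2]
    · have h2 : |x - y| ≤ 1 := by
        rw [abs_le]; constructor <;> linarith [hx.1, hx.2, hy.1, hy.2]
      exact h2.trans (Real.one_le_rpow h1 hd.le)

/-- The inverse of the parametrization is Hölder continuous with exponent `d`, so it raises
dimension at most by the factor `1 / d`, while `Θ` has dimension at least `m`. Only nonzero outer
measure is needed, so `Θ` need not be measurable. -/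
theorem le_dimH_image {d : ℝ≥0} (hd : 0 < d) (hlam : S.lam ^ (d : ℝ) = 1 / 2)
    {Θ : Set (Fin m → ℝ)} (hΘ : Θ ⊆ unitBox m) (h0 : volume Θ ≠ 0) :
    (m : ℝ≥0∞) * d ≤ dimH ((fun θ : Fin m → ℝ => pt 0 fun i => S.phi (θ i)) '' Θ) := by
  set P : (Fin m → ℝ) → E (m + 1) := fun θ => pt 0 fun i => S.phi (θ i) with hP
  have hl2 : 0 < 1 - 2 * S.lam := by linarith [S.lam_lt]
  set C : ℝ := (1 / (1 - 2 * S.lam)) ^ (d : ℝ) with hC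
  have hC0 : 0 ≤ C := by positivity
  have hdist : ∀ θ ∈ Θ, ∀ θ' ∈ Θ, dist θ θ' ≤ C * dist (P θ) (P θ') ^ (d : ℝ) := by
    intro θ hθ θ' hθ'
    refine (dist_pi_le_iff (by positivity)).2 fun i => ?_
    rw [Real.dist_eq]
    refine (S.abs_sub_le_rpow (by exact_mod_cast hd) hlam (hΘ hθ i (mem_univ i))
      (hΘ hθ' i (mem_univ i))).trans ?_
    gcongr
    have := PiLp.norm_apply_le (P θ - P θ') i.succ
    rw [dist_eq_norm]
    simpa [hP] using this
  have hinj : InjOn P Θ := fun θ hθ θ' hθ' h => by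
    have := hdist θ hθ θ' hθ'
    rw [h, dist_self, Real.zero_rpow (by exact_mod_cast hd.ne'), mul_zero] at this
    exact dist_le_zero.1 this
  have hinv : ∀ θ ∈ Θ, Function.invFunOn P Θ (P θ) = θ := fun θ hθ =>
    hinj.leftInvOn_invFunOn hθ
  have hhol : HolderOnWith (Real.toNNReal C) d (Function.invFunOn P Θ) (P '' Θ) := by
    rintro _ ⟨θ, hθ, rfl⟩ _ ⟨θ', hθ', rfl⟩
    rw [hinv θ hθ, hinv θ' hθ', edist_dist, edist_dist,
      ENNReal.ofReal_rpow_of_nonneg dist_nonneg d.coe_nonneg]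
    show _ ≤ ENNReal.ofReal C * _
    rw [← ENNReal.ofReal_mul hC0]
    exact ENNReal.ofReal_le_ofReal (hdist θ hθ θ' hθ')
  have himg : Function.invFunOn P Θ '' (P '' Θ) = Θ := by
    rw [image_image]
    exact (image_congr hinv).trans (image_id' Θ)
  have h1 := hhol.dimH_image_le hd
  rw [himg] at h1
  have h2 : ((m : ℝ≥0) : ℝ≥0∞) ≤ dimH Θ := by
    refine le_dimH_of_hausdorffMeasure_ne_zero ?_
    have := hausdorffMeasure_pi_real (ι := Fin m)
    rw [Fintype.card_fin] at this
    rw [NNReal.coe_natCast, this]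
    exact h0
  have h3 := h2.trans h1
  rw [ENNReal.le_div_iff_mul_le (Or.inl (by exact_mod_cast hd.ne')) (Or.inl ENNReal.coe_ne_top)]
    at h3
  exact_mod_cast h3

end CantorScale

end HausdorffDimension

/-! ### Failure of higher integrability of the gradient -/

section HigherIntegrability

namespace CantorScale

variable (S : CantorScale) {m : ℕ} {e : ℝ}

theorem measurableSet_thick (k : ℕ) : MeasurableSet (S.thick k : Set (E (m + 1))) := by
  have h0 : Measurable fun z : E (m + 1) => |z 0| := by fun_prop
  have h2 : MeasurableSet {z : E (m + 1) | |z 0| ≤ 2 * S.lam ^ k} :=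
    measurableSet_le h0 measurable_const
  have h3 : MeasurableSet {z : E (m + 1) | S.hcut k z ≠ 0} :=
    (isOpen_ne_fun (S.contDiff_hcut k).continuous continuous_const).measurableSet
  exact h2.inter h3

theorem abs_lt_of_mem_thick {k : ℕ} (hk : 2 ≤ k) {z : E (m + 1)} (hz : z ∈ S.thick k)
    (i : Fin (m + 1)) : |z i| < 3 / 4 := by
  have hw := S.w_lt
  refine Fin.cases ?_ (fun i => ?_) i
  · refine hz.1.trans_lt ?_
    have h1 : S.lam ^ k ≤ S.lam ^ 2 := pow_le_pow_of_le_one S.lam_pos.le S.lam_lt_one.le hk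
    nlinarith [S.lam_pos, S.lam_lt]
  · by_contra h0
    exact S.chi_ne_zero_of_hcut_ne_zero hz.2 i (S.chi_eq_zero k (by linarith [not_lt.1 h0]))

theorem thick_subset_cube {k : ℕ} (hk : 2 ≤ k) : (S.thick k : Set (E (m + 1))) ⊆ cube (m + 1) :=
  fun _ hz i => abs_lt.1 ((S.abs_lt_of_mem_thick hk hz i).trans (by norm_num))

theorem enorm_pt_one_zero : ‖(pt 1 0 : E (m + 1))‖ₑ = 1 := by
  have : ‖(pt 1 0 : E (m + 1))‖ = 1 := by
    rw [EuclideanSpace.norm_eq, Fin.sum_univ_succ]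
    simp
  rw [← ofReal_norm, this, ENNReal.ofReal_one]

theorem pt_eq_add_smul (t : ℝ) (y : Fin m → ℝ) : pt t y = pt 0 y + t • pt 1 0 := by
  ext i
  refine Fin.cases ?_ (fun i => ?_) i <;> simp

/-- The vertical oscillation over the cones is controlled by the gradient near the Cantor set. -/
theorem lintegral_vertical_le (he : (2 * S.lam) ^ m = S.lam ^ e) (hem : e ≤ m) (he0 : 0 ≤ e)
    {M : ℝ} {u : E (m + 1) → ℝ} {D : E (m + 1) → E (m + 1)} (hu : Measurable u)
    (hD : Measurable D) (h : IsL1Limit (shiftedTestFunctions (cube (m + 1))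
      fun z => M * S.block 0 z) (cube (m + 1)) u D) {k : ℕ} (hk : 2 ≤ k) :
    ∫⁻ p, ‖u (S.cone 1 p) - u (S.cone (-1) p)‖ₑ ∂coneMeasure m (S.lam ^ (k + 1)) (S.lam ^ k) ≤
      ENNReal.ofReal (S.lam ^ k - S.lam ^ (k + 1)) *
        ENNReal.ofReal ((S.kap ^ m)⁻¹ * (S.lam ^ (k + 1)) ^ (-e)) *
        ∫⁻ z in S.thick k, ‖D z‖ₑ := by
  have hkap := S.kap_pos
  have hr := S.lam_pow_pos (k + 1)
  have hr' : S.lam ^ k ≤ 1 := pow_le_one₀ S.lam_pos.le S.lam_lt_one.le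
  have hc1 := S.measurable_cone (m := m) 1
  have hc2 := S.measurable_cone (m := m) (-1)
  have hψc : ∀ ψ ∈ shiftedTestFunctions (cube (m + 1)) fun z => M * S.block 0 z,
      ContDiff ℝ 1 ψ := fun ψ hψ => contDiff_of_mem_shiftedTestFunctions
    (contDiff_const.mul (S.contDiff_one_block 0)) hψ
  refine h.functional_le
    (J := fun v => ∫⁻ p, ‖v (S.cone 1 p) - v (S.cone (-1) p)‖ₑ
      ∂coneMeasure m (S.lam ^ (k + 1)) (S.lam ^ k))
    (B := fun G => ∫⁻ z in S.thick k, ‖G z‖ₑ)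
    (C₁ := ENNReal.ofReal ((S.kap ^ m)⁻¹ * (S.lam ^ (k + 1)) ^ (-e)) +
      ENNReal.ofReal ((S.kap ^ m)⁻¹ * (S.lam ^ (k + 1)) ^ (-e)))
    (C₂ := 1)
    (ENNReal.mul_ne_top ENNReal.ofReal_ne_top ENNReal.ofReal_ne_top)
    (ENNReal.add_ne_top.2 ⟨ENNReal.ofReal_ne_top, ENNReal.ofReal_ne_top⟩) ENNReal.one_ne_top
    ?_ ?_ ?_
  · intro ψ hψ
    have hψm : Measurable ψ := (hψc ψ hψ).continuous.measurable
    calc _ ≤ ∫⁻ p, ‖ψ (S.cone 1 p) - ψ (S.cone (-1) p)‖ₑ + (‖u (S.cone 1 p) - ψ (S.cone 1 p)‖ₑ +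
          ‖u (S.cone (-1) p) - ψ (S.cone (-1) p)‖ₑ)
          ∂coneMeasure m (S.lam ^ (k + 1)) (S.lam ^ k) := by
          refine lintegral_mono fun p => ?_
          have : u (S.cone 1 p) - u (S.cone (-1) p) =
            (ψ (S.cone 1 p) - ψ (S.cone (-1) p)) + ((u (S.cone 1 p) - ψ (S.cone 1 p)) -
              (u (S.cone (-1) p) - ψ (S.cone (-1) p))) := by ring
          rw [this]
          exact (enorm_add_le _ _).trans (add_le_add le_rfl enorm_sub_le)
      _ = (∫⁻ p, ‖ψ (S.cone 1 p) - ψ (S.cone (-1) p)‖ₑ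
            ∂coneMeasure m (S.lam ^ (k + 1)) (S.lam ^ k)) +
          ((∫⁻ p, ‖u (S.cone 1 p) - ψ (S.cone 1 p)‖ₑ
            ∂coneMeasure m (S.lam ^ (k + 1)) (S.lam ^ k)) +
          ∫⁻ p, ‖u (S.cone (-1) p) - ψ (S.cone (-1) p)‖ₑ
            ∂coneMeasure m (S.lam ^ (k + 1)) (S.lam ^ k)) := by
          refine (lintegral_add_left ((hψm.comp hc1).sub (hψm.comp hc2)).enorm _).trans ?_
          congr 1
          exact lintegral_add_left ((hu.comp hc1).sub (hψm.comp hc1)).enorm _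
      _ ≤ _ := by
          rw [add_mul]
          gcongr
          · exact S.lintegral_cone_window_le he hem he0 (by simp) (hu.sub hψm).enorm hr hr'
          · exact S.lintegral_cone_window_le he hem he0 (by simp) (hu.sub hψm).enorm hr hr'
  · intro ψ hψ
    have hgm : Measurable (gradient ψ) := (continuous_gradient (hψc ψ hψ)).measurable
    calc _ ≤ ∫⁻ z in S.thick k, ‖D z‖ₑ + ‖D z - gradient ψ z‖ₑ := by
          refine lintegral_mono fun z => ?_
          have : gradient ψ z = D z - (D z - gradient ψ z) := by abel
          conv_lhs => rw [this]
          exact enorm_sub_le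
      _ = (∫⁻ z in S.thick k, ‖D z‖ₑ) + ∫⁻ z in S.thick k, ‖D z - gradient ψ z‖ₑ :=
          lintegral_add_left hD.enorm _
      _ ≤ _ := by
          rw [one_mul]
          gcongr
          exact S.thick_subset_cube hk
  · intro ψ hψ
    have hψm : Measurable ψ := (hψc ψ hψ).continuous.measurable
    have hgm : Measurable (gradient ψ) := (continuous_gradient (hψc ψ hψ)).measurable
    set f := (S.thick k).indicator fun z : E (m + 1) => ‖gradient ψ z‖ₑ with hf
    have hfm : Measurable f := hgm.enorm.indicator (S.measurableSet_thick k)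
    set g : (Fin m → ℝ) → ℝ≥0∞ := fun y => ∫⁻ τ : ℝ, f (pt τ y) with hg
    have hgm' : Measurable g := (hfm.comp measurable_pt).lintegral_prod_left'
    have hgint : ∫⁻ y, g y = ∫⁻ z in S.thick k, ‖gradient ψ z‖ₑ := by
      rw [← lintegral_indicator (S.measurableSet_thick k), ← hf,
        ← measurePreserving_pt.lintegral_comp hfm,
        lintegral_prod_symm (fun p : ℝ × (Fin m → ℝ) => f (pt p.1 p.2))
          (hfm.comp measurable_pt).aemeasurable]
    -- The two cone points share their horizontal position, at which the cutoff of generation `k`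
    -- equals `1`. The vertical segment joining them therefore stays in `thick k`.
    have hpt : ∀ᵐ p ∂coneMeasure m (S.lam ^ (k + 1)) (S.lam ^ k),
        ‖ψ (S.cone 1 p) - ψ (S.cone (-1) p)‖ₑ ≤ g (S.ray p.1 p.2) := by
      filter_upwards [ae_coneMeasure (m := m) (S.lam ^ (k + 1)) (S.lam ^ k)] with p hp
      have ht0 : 0 < p.1 := hr.trans hp.1.1
      have h1 := enorm_sub_le_lintegral_gradient (hψc ψ hψ) (pt 0 (S.ray p.1 p.2)) (pt 1 0)
        (by linarith : -p.1 ≤ p.1)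
      simp only [← pt_eq_add_smul, enorm_pt_one_zero, one_mul] at h1
      have h2 : S.cone 1 p = pt p.1 (S.ray p.1 p.2) := by simp [cone]
      have h3 : S.cone (-1) p = pt (-p.1) (S.ray p.1 p.2) := by simp [cone]
      rw [h2, h3]
      refine h1.trans ?_
      rw [hg, ← lintegral_indicator measurableSet_Ioo]
      refine lintegral_mono fun τ => ?_
      by_cases hτ : τ ∈ Ioo (-p.1) p.1
      · have h4 : S.hcut (k + 3) (pt τ (S.ray p.1 p.2)) = 1 :=
          S.hcut_pt_ray ht0.le hp.1.2.le hp.2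
        have h5 : S.hcut k (pt τ (S.ray p.1 p.2)) = 1 :=
          S.hcut_eq_one_of_lt (k := k + 3) (by omega) (by rw [h4]; exact one_ne_zero)
        have h6 : pt τ (S.ray p.1 p.2) ∈ S.thick k := by
          refine ⟨?_, by rw [h5]; exact one_ne_zero⟩
          rw [pt_zero]
          linarith [abs_lt.2 hτ, hp.1.2]
        rw [indicator_of_mem hτ, hf, indicator_of_mem h6]
      · rw [indicator_of_notMem hτ]
        exact zero_le
    refine (lintegral_mono_ae hpt).trans ?_
    unfold coneMeasure
    rw [lintegral_prod (fun p : ℝ × (Fin m → ℝ) × (Fin m → ℝ) => g (S.ray p.1 p.2))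
      (hgm'.comp S.measurable_ray).aemeasurable]
    calc _ ≤ ∫⁻ _ in Ioo (S.lam ^ (k + 1)) (S.lam ^ k),
          ENNReal.ofReal ((S.kap ^ m)⁻¹ * (S.lam ^ (k + 1)) ^ (-e)) *
            ∫⁻ z in S.thick k, ‖gradient ψ z‖ₑ := by
          refine setLIntegral_mono_ae' measurableSet_Ioo (Eventually.of_forall fun t ht => ?_)
          refine (S.lintegral_ray_le he hem (hr.trans ht.1) (ht.2.le.trans hr') hgm').trans ?_
          rw [hgint]
          refine mul_le_mul' (ENNReal.ofReal_le_ofReal ?_) le_rfl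
          have := Real.rpow_le_rpow_of_nonpos hr ht.1.le (by linarith : -e ≤ 0)
          gcongr
      _ = _ := by
          rw [setLIntegral_const, Real.volume_Ioo]
          ring

/-- A gradient in `L^(1+ε)` would, by Hölder's inequality on the small sets `thick k`, make the
vertical oscillation over the cones tend to zero, whereas the traces keep it away from zero. -/
theorem not_memW1pLoc (he : (2 * S.lam) ^ m = S.lam ^ e) (hem : e ≤ m) (he0 : 0 ≤ e)
    {M : ℝ} {u : E (m + 1) → ℝ} {D : E (m + 1) → E (m + 1)} (hu : Measurable u)
    (hD : Measurable D) (h : IsL1Limit (shiftedTestFunctions (cube (m + 1))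
      fun z => M * S.block 0 z) (cube (m + 1)) u D) {K : ℝ≥0∞} (hK : K < 2 ^ m * ENNReal.ofReal M)
    (hT : ∀ ς : ℝ, |ς| = 1 → ∀ k : ℕ, ∫⁻ p, ‖u (S.cone ς p) - ς * M‖ₑ
      ∂coneMeasure m (S.lam ^ (k + 1)) (S.lam ^ k) ≤
        ENNReal.ofReal (S.lam ^ k - S.lam ^ (k + 1)) * K)
    {ε : ℝ} (hε : e < ε) {p : ℝ≥0∞} (hp : ENNReal.ofReal (1 + ε) < p) :
    ¬ MemW1pLoc p (cube (m + 1)) u := by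
  intro hloc
  have hε0 : 0 < ε := he0.trans_lt hε
  have hl := S.lam_pos
  have hkap := S.kap_pos
  set Ω : Set (E (m + 1)) := {z | ∀ i, |z i| < 3 / 4} with hΩ
  have hΩo : IsOpen Ω := by
    simp only [hΩ, ofPred_forall]
    exact isOpen_iInter_of_finite fun i => isOpen_lt (by fun_prop) (by fun_prop)
  have hcl : closure Ω ⊆ {z | ∀ i, |z i| ≤ 3 / 4} := by
    refine closure_minimal (fun z hz i => (hz i).le) ?_
    simp only [ofPred_forall]
    exact isClosed_iInter fun i => isClosed_le (by fun_prop) (by fun_prop)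
  have hclc : closure Ω ⊆ cube (m + 1) := fun z hz i =>
    abs_lt.1 ((hcl hz i).trans_lt (by norm_num))
  have hΩc : Ω ⊆ cube (m + 1) := subset_closure.trans hclc
  have hcomp : IsCompact (closure Ω) :=
    isCompact_closedCube.of_isClosed_subset isClosed_closure (hclc.trans cube_subset_closedCube)
  obtain ⟨-, G, hG, hGp⟩ := hloc Ω hΩo hcomp hclc
  have hDw : HasWeakGradient (cube (m + 1)) u D := h.hasWeakGradient fun ψ hψ =>
    contDiff_of_mem_shiftedTestFunctions (contDiff_const.mul (S.contDiff_one_block 0)) hψ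
  have hDG := HasWeakGradient.ae_eq hΩo (hDw.mono hΩc) hG
  have hfin : IsFiniteMeasure (volume.restrict Ω) :=
    ⟨by rw [Measure.restrict_apply_univ]; exact (measure_mono hΩc).trans_lt volume_cube_lt_top⟩
  have hDp : MemLp D (ENNReal.ofReal (1 + ε)) (volume.restrict Ω) :=
    ((memLp_congr_ae hDG).2 hGp).mono_exponent hp.le
  have hp0 : (0 : ℝ) < 1 + ε := by linarith
  set N := ∫⁻ z in Ω, ‖D z‖ₑ ^ (1 + ε) with hN
  have hNtop : N ≠ ⊤ := by
    have := lintegral_rpow_enorm_lt_top_of_eLpNorm_lt_top (by simpa using hp0)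
      ENNReal.ofReal_ne_top hDp.2
    rw [ENNReal.toReal_ofReal hp0.le] at this
    exact this.ne
  have hconj : (1 + ε).HolderConjugate ((1 + ε) / ε) := by
    have := Real.HolderConjugate.conjExponent (by linarith : 1 < 1 + ε)
    rwa [Real.conjExponent, add_sub_cancel_left] at this
  have hhol : ∀ k, 2 ≤ k → ∫⁻ z in S.thick k, ‖D z‖ₑ ≤ N ^ (1 / (1 + ε)) *
      ENNReal.ofReal ((4 * 2 ^ m * (S.lam ^ k) ^ (1 + e)) ^ (ε / (1 + ε))) := by
    intro k hk
    have hlk := S.lam_pow_pos k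
    have h1 := ENNReal.lintegral_mul_le_Lp_mul_Lq (volume.restrict (S.thick k)) hconj
      (f := fun z => ‖D z‖ₑ) (g := 1) hD.enorm.aemeasurable aemeasurable_const
    simp only [mul_one, Pi.one_apply, ENNReal.one_rpow, lintegral_const, one_mul,
      Measure.restrict_apply_univ, one_div_div] at h1
    refine h1.trans ?_
    refine mul_le_mul' ?_ ?_
    · gcongr
      exact lintegral_mono_set fun z hz i => S.abs_lt_of_mem_thick hk hz i
    · rw [← ENNReal.ofReal_rpow_of_nonneg (by positivity) (by positivity)]
      gcongr
      exact S.volume_thick_le_rpow he k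
  -- Net exponent of the scale: `-e` from the occupation density plus `(1 + e) * ε / (1 + ε)` from
  -- the volume of `thick k`. It is positive because `e < ε`.
  set η := (ε - e) / (1 + ε) with hη
  have hη0 : 0 < η := div_pos (by linarith) hp0
  set A : ℝ := (S.kap ^ m)⁻¹ * S.lam ^ (-e) * (4 * 2 ^ m) ^ (ε / (1 + ε)) with hA
  have hreal : ∀ k : ℕ, (S.kap ^ m)⁻¹ * (S.lam ^ (k + 1)) ^ (-e) *
      (4 * 2 ^ m * (S.lam ^ k) ^ (1 + e)) ^ (ε / (1 + ε)) = A * (S.lam ^ k) ^ η := by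
    intro k
    have hlk := S.lam_pow_pos k
    rw [Real.mul_rpow (by positivity) (by positivity), ← Real.rpow_mul hlk.le, pow_succ,
      Real.mul_rpow hlk.le hl.le]
    have : (S.lam ^ k) ^ η = (S.lam ^ k) ^ (-e) * (S.lam ^ k) ^ ((1 + e) * (ε / (1 + ε))) := by
      rw [← Real.rpow_add hlk]
      congr 1
      rw [hη]
      field_simp
      ring
    rw [this, hA]
    ring
  have hlim : Tendsto (fun k : ℕ => 2 * K + ENNReal.ofReal (A * (S.lam ^ k) ^ η) *
      N ^ (1 / (1 + ε))) atTop (𝓝 (2 * K + 0)) := by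
    refine tendsto_const_nhds.add ?_
    have h1 : Tendsto (fun k : ℕ => ENNReal.ofReal (A * (S.lam ^ k) ^ η)) atTop (𝓝 0) := by
      rw [← ENNReal.ofReal_zero]
      exact ENNReal.tendsto_ofReal
        (summable_pow_rpow S.lam_pos S.lam_lt_one hη0 A).tendsto_atTop_zero
    have h2 := ENNReal.Tendsto.mul_const h1 (b := N ^ (1 / (1 + ε)))
      (Or.inr (ENNReal.rpow_ne_top_of_nonneg (by positivity) hNtop))
    simpa using h2
  have hbound : ∀ᶠ k : ℕ in atTop, 2 * (2 ^ m * ENNReal.ofReal M) ≤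
      2 * K + ENNReal.ofReal (A * (S.lam ^ k) ^ η) * N ^ (1 / (1 + ε)) := by
    filter_upwards [eventually_ge_atTop 2] with k hk
    have hw := S.window_pos k
    have hlk := S.lam_pow_pos k
    have hV := S.lintegral_vertical_le he hem he0 hu hD h hk
    set ν := coneMeasure m (S.lam ^ (k + 1)) (S.lam ^ k) with hν
    have hc1 := hu.comp (S.measurable_cone (m := m) 1)
    have hc2 := hu.comp (S.measurable_cone (m := m) (-1))
    have h1 : ENNReal.ofReal (2 * M) * ν univ ≤
        ((∫⁻ p, ‖u (S.cone 1 p) - 1 * M‖ₑ ∂ν) + ∫⁻ p, ‖u (S.cone (-1) p) - -1 * M‖ₑ ∂ν) +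
        ((∫⁻ p, ‖u (S.cone 1 p) - u (S.cone (-1) p)‖ₑ ∂ν) + ∫⁻ _, 0 ∂ν) := by
      rw [← lintegral_const]
      refine lintegral_le_add_four (hc1.sub_const _).enorm (hc2.sub_const _).enorm
        (hc1.sub hc2).enorm fun p => ?_
      simp only [Real.enorm_eq_ofReal_abs, add_zero]
      rw [← ENNReal.ofReal_add (abs_nonneg _) (abs_nonneg _),
        ← ENNReal.ofReal_add (by positivity) (abs_nonneg _)]
      refine ENNReal.ofReal_le_ofReal ?_
      have h1 := neg_abs_le (u (S.cone 1 p) - 1 * M)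
      have h2 := le_abs_self (u (S.cone 1 p) - u (S.cone (-1) p))
      have h3 := le_abs_self (u (S.cone (-1) p) - -1 * M)
      linarith
    rw [lintegral_zero, add_zero, hν, coneMeasure_univ, ← hν] at h1
    have hsplit : ENNReal.ofReal (A * (S.lam ^ k) ^ η) =
        ENNReal.ofReal ((S.kap ^ m)⁻¹ * (S.lam ^ (k + 1)) ^ (-e)) *
          ENNReal.ofReal ((4 * 2 ^ m * (S.lam ^ k) ^ (1 + e)) ^ (ε / (1 + ε))) :=
      (congrArg _ (hreal k).symm).trans (ENNReal.ofReal_mul (by positivity))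
    have h2 : ENNReal.ofReal (S.lam ^ k - S.lam ^ (k + 1)) * (2 * (2 ^ m * ENNReal.ofReal M)) ≤
        ENNReal.ofReal (S.lam ^ k - S.lam ^ (k + 1)) *
          (2 * K + ENNReal.ofReal (A * (S.lam ^ k) ^ η) * N ^ (1 / (1 + ε))) := by
      calc _ = ENNReal.ofReal (2 * M) * (ENNReal.ofReal (S.lam ^ k - S.lam ^ (k + 1)) * 2 ^ m) := by
            rw [ENNReal.ofReal_mul (by norm_num)]
            simp only [ENNReal.ofReal_ofNat]
            ring
        _ ≤ _ := h1
        _ ≤ (ENNReal.ofReal (S.lam ^ k - S.lam ^ (k + 1)) * K +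
            ENNReal.ofReal (S.lam ^ k - S.lam ^ (k + 1)) * K) +
            ENNReal.ofReal (S.lam ^ k - S.lam ^ (k + 1)) *
            ENNReal.ofReal ((S.kap ^ m)⁻¹ * (S.lam ^ (k + 1)) ^ (-e)) *
            (N ^ (1 / (1 + ε)) *
              ENNReal.ofReal ((4 * 2 ^ m * (S.lam ^ k) ^ (1 + e)) ^ (ε / (1 + ε)))) := by
            refine add_le_add (add_le_add (hT 1 (by simp) k) (hT (-1) (by simp) k)) (hV.trans ?_)
            gcongr
            exact hhol k hk
        _ = _ := by
            rw [hsplit]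
            ring
    exact (ENNReal.mul_le_mul_iff_right (by simpa using hw) ENNReal.ofReal_ne_top).1 h2
  have h2 := ge_of_tendsto hlim hbound
  rw [add_zero] at h2
  exact absurd ((ENNReal.mul_le_mul_iff_right (by norm_num) (by norm_num)).1 h2) (not_le.2 hK)

end CantorScale

end HigherIntegrability

/-! ### Choice of parameters and conclusion -/

section Conclusion

theorem exists_cantorScale {m : ℕ} {e d : ℝ} (hm : 1 ≤ m) (he : 0 < e) (hd : 0 < d)
    (hde : d = 1 - e / m) :
    ∃ S : CantorScale, S.lam ^ d = 1 / 2 ∧ (2 * S.lam) ^ m = S.lam ^ e := by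
  have hm0 : (0 : ℝ) < m := by exact_mod_cast hm
  have hd1 : d < 1 := by rw [hde]; linarith [div_pos he hm0]
  -- The ratio for which a two-branch Cantor set has dimension `d`; the product of `m` copies then
  -- has dimension `m * d = m - e`.
  set l : ℝ := 2 ^ (-1 / d) with hl
  have hl0 : 0 < l := by positivity
  have hlt : l < 1 / 2 := by
    have h1 : (1 / 2 : ℝ) = 2 ^ (-1 : ℝ) := by rw [Real.rpow_neg_one]; norm_num
    rw [h1, hl]
    refine Real.rpow_lt_rpow_of_exponent_lt (by norm_num) ?_
    rw [div_lt_iff₀ hd]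
    linarith
  have hld : l ^ d = 1 / 2 := by
    rw [hl, ← Real.rpow_mul (by norm_num), div_mul_cancel₀ _ hd.ne', Real.rpow_neg_one]
    norm_num
  refine ⟨⟨l, (1 - 2 * l) / 8, hl0, hlt, by linarith, by linarith, by nlinarith⟩, hld, ?_⟩
  show (2 * l) ^ m = l ^ e
  have h2 : 2 * l = l ^ (e / m) := by
    have h3 : e / m = 1 - d := by rw [hde]; ring
    rw [h3, Real.rpow_sub hl0, Real.rpow_one, hld]
    ring
  rw [h2, ← Real.rpow_natCast, ← Real.rpow_mul hl0.le, div_mul_cancel₀ _ hm0.ne']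

/-- The trace error grows like `M^(r/q)` with `r < q`, so it is eventually below `M`. -/
theorem exists_large_amplitude (m : ℕ) {C : ℝ≥0∞} (hC : C ≠ ⊤) {c r q : ℝ} (hc : 0 ≤ c)
    (hq : 0 < q) (hrq : r < q) :
    ∃ M : ℝ, 1 ≤ M ∧ ENNReal.ofReal (m + 1) * (C * ENNReal.ofReal (c * M ^ r) ^ (1 / q)) <
      2 ^ m * ENNReal.ofReal M := by
  set c' : ℝ := (m + 1) * (C.toReal * c ^ (1 / q)) with hc'
  have hexp : 0 < 1 - r / q := by
    rw [sub_pos, div_lt_one hq]; exact hrq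
  obtain ⟨M, hM1, hM2⟩ := (((tendsto_rpow_atTop hexp).eventually_gt_atTop c').and
    (eventually_ge_atTop 1)).exists
  have hM0 : 0 < M := by linarith
  refine ⟨M, hM2, ?_⟩
  have h1 : ENNReal.ofReal (m + 1) * (C * ENNReal.ofReal (c * M ^ r) ^ (1 / q)) =
      ENNReal.ofReal (c' * M ^ (r / q)) := by
    rw [ENNReal.ofReal_rpow_of_nonneg (by positivity) (by positivity), ← ENNReal.ofReal_toReal hC,
      ← ENNReal.ofReal_mul ENNReal.toReal_nonneg, ← ENNReal.ofReal_mul (by positivity),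
      hc', Real.mul_rpow hc (by positivity), ← Real.rpow_mul hM0.le, mul_one_div]
    congr 1
    ring
  have h2 : c' * M ^ (r / q) < M := by
    calc c' * M ^ (r / q) < M ^ (1 - r / q) * M ^ (r / q) := by gcongr
      _ = M := by rw [← Real.rpow_add hM0, sub_add_cancel, Real.rpow_one]
  rw [h1]
  refine ((ENNReal.ofReal_lt_ofReal_iff hM0).2 h2).trans_le ?_
  exact le_mul_of_one_le_left zero_le (one_le_pow₀ (by norm_num))

theorem exists_irregular_minimizer {m : ℕ} (hm : 1 ≤ m) {α q s Λ μ : ℝ} (hα : 0 < α)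
    (hs : s ∈ Icc (0 : ℝ) 1) (hΛ : 1 ≤ Λ) {g : ℝ → ℝ}
    (hg : IsNearlyLinear g ∨ ∀ t : ℝ, 0 ≤ t → g t = 1) {L : E (m + 1) → ℝ}
    (hL : IsAdmissibleIntegrand Λ μ g L) {ε : ℝ} (hε : ε ∈ Ioo 0 (q - 1 - α)) :
    ∃ a u₀ : E (m + 1) → ℝ, (∀ x ∈ closedCube (m + 1), 0 ≤ a x) ∧
      MemHolderClass α (closedCube (m + 1)) a ∧ ContDiffOn ℝ ∞ u₀ (closedCube (m + 1)) ∧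
      ∃ u : E (m + 1) → ℝ, IsDirichletMinimizer L a s q (cube (m + 1)) u₀ u ∧
        (∀ p : ℝ≥0∞, ENNReal.ofReal (1 + ε) < p → ¬ MemW1pLoc p (cube (m + 1)) u) ∧
        ENNReal.ofReal ((m : ℝ) - ε) ≤ dimH {x ∈ cube (m + 1) | ¬ IsLebesguePoint u x} := by
  obtain ⟨hε0, hεq⟩ := hε
  have hΛ0 : 0 < Λ := by linarith
  have hm1 : (1 : ℝ) ≤ m := by exact_mod_cast hm
  -- `e` is the dimension lost by the Cantor set. It must be smaller than `ε`, and the cap at `1/2`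
  -- keeps `d = 1 - e/m` positive.
  set e : ℝ := min ε 1 / 2 with he
  have he0 : 0 < e := by rw [he]; exact half_pos (lt_min hε0 one_pos)
  have heε : e < ε := by
    have := min_le_left ε 1
    rw [he]; linarith
  have he1 : e ≤ 1 / 2 := by
    have := min_le_right ε 1
    rw [he]; linarith
  have hq : 1 < q := by linarith
  obtain ⟨d, hd⟩ : ∃ d : ℝ, d = 1 - e / m := ⟨_, rfl⟩
  have hd0 : 0 < d := by
    rw [hd, sub_pos, div_lt_one (by linarith)]; linarith
  obtain ⟨S, hSd, hSe⟩ := exists_cantorScale hm he0 hd0 hd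
  obtain ⟨c₀, hc₀⟩ := hL.exists_lower_bound hΛ0 hg
  obtain ⟨c, hc, hLc⟩ := hL.exists_upper_bound hΛ0 hg (half_pos he0)
  -- `α' = q - 1 - ε` exceeds `α` by the range of `ε` and satisfies `α' + e < q - 1`, as the traces
  -- need. `β = q - 1 - e/2` lies below `q - 1`, for existence, and above `q - 1 - e`, for finite
  -- energy of the competitor.
  obtain ⟨C, hC, hmin⟩ := S.exists_minimizer hm hSe he0 (δ := e / 2) (α' := q - 1 - ε)
    (β := q - 1 - e / 2) hL.contDiff_one.continuous (hL.strictMidpointConvex hΛ0) hc₀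
    (by linarith) (by linarith) hc hLc hs hq (by linarith) (by linarith) (by linarith) (by linarith)
  obtain ⟨C', hC', htr⟩ := S.exists_lintegral_cone_gradient_le hSe (by linarith) he0.le hq
    (α' := q - 1 - ε) (by linarith) (by linarith)
  obtain ⟨M, hM, hK⟩ := exists_large_amplitude m hC' hC (by linarith : 0 < q)
    (by linarith : 1 + e / 2 < q)
  obtain ⟨u, D, hu, hD, hlim, humin, hbd⟩ := hmin M hM
  have hT : ∀ ς : ℝ, |ς| = 1 → ∀ k : ℕ, ∫⁻ p, ‖u (S.cone ς p) - ς * M‖ₑ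
      ∂CantorScale.coneMeasure m (S.lam ^ (k + 1)) (S.lam ^ k) ≤
        ENNReal.ofReal (S.lam ^ k - S.lam ^ (k + 1)) *
        (ENNReal.ofReal (m + 1) * (C' * ENNReal.ofReal (C * M ^ (1 + e / 2)) ^ (1 / q))) := by
    intro ς hς k
    refine (S.lintegral_cone_sub_le hSe (by linarith) he0.le hς hu hD hlim (S.lam_pow_pos (k + 1))
      (pow_le_one₀ S.lam_pos.le S.lam_lt_one.le)).trans ?_
    rw [mul_assoc]
    gcongr
    refine (htr ς D hς hD).trans ?_
    gcongr
  refine ⟨S.coef (q - 1 - ε) (q - 1 - e / 2) q M, fun z => M * S.block 0 z,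
    fun x _ => S.coef_nonneg hM x,
    S.memHolderClass_coefficient hα.le (by linarith) (by linarith) _,
    (contDiff_const.mul (S.contDiff_block 0)).contDiffOn, u, humin, fun p hp => ?_, ?_⟩
  · exact S.not_memW1pLoc hSe (by linarith) he0.le hu hD hlim hK hT heε hp
  · have hvol := S.volume_nonLebesgue_ne_zero hu (memLp_one_iff_integrable.1 hlim.1) hK hT
    have hdim := S.le_dimH_image (d := d.toNNReal) (Real.toNNReal_pos.2 hd0)
      (by rwa [Real.coe_toNNReal d hd0.le]) (fun θ hθ => hθ.1) hvol
    refine le_trans ?_ (hdim.trans (dimH_mono ?_))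
    · show _ ≤ (m : ℝ≥0∞) * ENNReal.ofReal d
      rw [← ENNReal.ofReal_natCast, ← ENNReal.ofReal_mul (by positivity)]
      refine ENNReal.ofReal_le_ofReal ?_
      have : (m : ℝ) * d = m - e := by rw [hd]; field_simp
      rw [this]
      linarith
    · rintro _ ⟨θ, hθ, rfl⟩
      refine ⟨?_, hθ.2⟩
      refine Fin.cases ?_ fun i => ?_
      · simp
      · have := abs_le.1 (S.abs_phi_le (θ i))
        simp only [pt_succ, mem_Ioo]
        constructor <;> linarith [this.1, this.2]

end Conclusion

end DoublePhase

end

open MeasureTheory Filter Set Topology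
open scoped ENNReal NNReal ContDiff

theorem theorem1p4 {n : ℕ} (hn : 2 ≤ n) {α q s Λ μ : ℝ} (hα : 0 < α) (hq : 1 < q)
    (hαq : 1 + α < q) (hs : s ∈ Set.Icc (0 : ℝ) 1) (hΛ : 1 ≤ Λ) (hμ : 1 ≤ μ)
    {g : ℝ → ℝ} (hg : DoublePhase.IsNearlyLinear g ∨ ∀ t : ℝ, 0 ≤ t → g t = 1)
    {L : DoublePhase.E n → ℝ} (hL : DoublePhase.IsAdmissibleIntegrand Λ μ g L)
    {ε : ℝ} (hε : ε ∈ Set.Ioo 0 (q - 1 - α)) :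
    ∃ a u₀ : DoublePhase.E n → ℝ,
      (∀ x ∈ DoublePhase.closedCube n, 0 ≤ a x) ∧
      DoublePhase.MemHolderClass α (DoublePhase.closedCube n) a ∧
      ContDiffOn ℝ ∞ u₀ (DoublePhase.closedCube n) ∧
      ∃ u : DoublePhase.E n → ℝ,
        DoublePhase.IsDirichletMinimizer L a s q (DoublePhase.cube n) u₀ u ∧
        (∀ p : ℝ≥0∞, ENNReal.ofReal (1 + ε) < p →
          ¬ DoublePhase.MemW1pLoc p (DoublePhase.cube n) u) ∧
        ENNReal.ofReal ((n : ℝ) - 1 - ε) ≤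
          dimH {x ∈ DoublePhase.cube n | ¬ DoublePhase.IsLebesguePoint u x} := by
  obtain ⟨m, rfl⟩ : ∃ m, n = m + 1 := ⟨n - 1, by omega⟩
  have h := DoublePhase.exists_irregular_minimizer (by omega) hα hs hΛ hg hL hε
  have hn1 : ((m + 1 : ℕ) : ℝ) - 1 - ε = m - ε := by push_cast; ring
  rw [hn1]
  exact h
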